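/- **Setting.** A *(strict) operadic category* $\mathtt O$ is a category with a cardinality functor $|-|$ to the category of finite ordinals $\bar n=\{1,\dots,n\}$ and all maps, a chosen local terminal object $U_c$ with $|U_c|=1$ in each connected component $c$ (an object is *local terminal* if it is terminal in its component), and, for each $R$ and $i\in|R|$, a fiber functor $\mathtt O/R\to\mathtt O$, $(h:T\to R)\mapsto h^{-1}(i)$, $(f:h\to g)\mapsto f_i:h^{-1}(i)\to g^{-1}(i)$, such that $|h^{-1}(i)|=|h|^{-1}(i)$ and $|f_i|$ is induced by $|f|$; the fibers of identities are chosen local terminal objects; over $U_c$ the fiber functor is the domain functor; $f^{-1}(j)=f_i^{-1}(j)$ for $h=gf$, $i=|g|(j)$; and $f_j=(f_i)_j$ for triangles over an object over $R$. Chosen local terminal objects are called *trivial*. A *quasibijection* is a morphism with trivial fibers; $f$ is *order preserving* if $|f|$ is. Let $\mathtt O$ be an operadic category such that: $|f|$ is surjective for all $f$ (constant-freeness); every morphism is $\phi\sigma$ with $\sigma$ a quasibijection and $\phi$ order preserving ($\mathtt{Fac}$); quasibijections are invertible ($\mathtt{QBI}$); whenever $f':S'\to T'$ is order preserving, $\sigma:T'\to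 T''$ is a quasibijection, and objects $F_j$ $(j\in|T''|)$ and maps $\pi_i:f'^{-1}(i)\to F_{|\sigma|(i)}$ $(i\in|T'|)$ are given, there are unique $\pi:S'\to S''$ and $f'':S''\to T''$ with $f''\pi=\sigma f'$, $f''$ order preserving, $f''^{-1}(j)=F_j$, and with the $\pi_i$ as the maps $f'^{-1}(i)=(\sigma f')^{-1}(j)\to f''^{-1}(j)$, $j=|\sigma|(i)$, induced by $\pi$ ($\mathtt{SBU}$); if $t$ is local terminal and the fiber of $T\to t$ is $T$, then $t$ is trivial ($\mathtt{UFib}$). Let $e:\mathrm{Ob}(\mathtt O)\to\mathbb N$ be a *grading*: $e(T)+\sum_i e(f^{-1}(i))=e(S)$ for all $f:S\to T$; and assume that $f:S\to T$ is an isomorphism if and only if $e(f):=e(S)-e(T)=0$. Write $F\triangleright_i T\xrightarrow{\phi}S$ if $\phi$ is *elementary*: order preserving, with $F=\phi^{-1}(i)$ of grade $\ge1$ and all other fibers trivial. Let $(\mathtt V,\otimes,\Bbbk)$ be a symmetric monoidal category. **Operads.** For a family $P(T)$, $T\in\mathtt O$, of objects of $\mathtt V$ and $f:T\to S$ put $P(f)=\bigotimes_{i\in|S|}P(f^{-1}(i))$.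 An *$\mathtt O$-operad* is such a family with units $\Bbbk\to P(U_c)$ and maps $\gamma_f:P(f)\otimes P(S)\to P(T)$ that are associative, i.e. for $h=gf$, $T\xrightarrow fS\xrightarrow gR$, the composites $\gamma_f(1\otimes\gamma_g)$ and $\gamma_h(\bigotimes_{i}\gamma_{f_i}\otimes1)$ on $\bigotimes_{i\in|R|}P(f_i)\otimes P(g)\otimes P(R)$ agree up to the canonical symmetries of $\mathtt V$, and unital: inserting units makes $\gamma_{1_T}$ and $\gamma_{T\to U_c}$ the identity of $P(T)$. It is *extended unital* if one is given maps $\eta_t:\Bbbk\to P(t)$ for all local terminal $t$ which extend the units and satisfy $\gamma_f(\eta\otimes\eta_t)=\eta_s$ for each $f:s\to t$ between local terminal objects, where the first $\eta$ is that of the fiber of $f$. For $f:T\to t$ with $t$ local terminal and fiber $F$, let $\vartheta(T,t):P(F)\cong P(F)\otimes\Bbbk\xrightarrow{1\otimes\eta_t}P(f)\otimes P(t)\xrightarrow{\gamma_f}P(T)$. The operad is *strictly* extended unital if $\vartheta(T,t)$ is an identity whenever $e(T)\ge1$, and *$1$-connected* if all $\eta_t$ are isomorphisms. Morphisms are families of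 maps commuting with all $\gamma_f$ and $\eta_t$. **Markl's operads.** Let $\mathtt{Iso}$ be the groupoid of isomorphisms of $\mathtt O$. A *Markl's $\mathtt O$-operad* is a presheaf $M:\mathtt{Iso}^{\rm op}\to\mathtt V$ with a circle product $\circ_\phi:M(S)\otimes M(F)\to M(T)$ for each elementary $F\triangleright T\xrightarrow\phi S$, such that: (i) for elementary $T\xrightarrow{(\phi,j)}S\xrightarrow{(\psi,i)}P$ with $|\psi|(j)=i$ and $\xi=\psi\phi$, one has $\circ_\phi(\circ_\psi\otimes1)=\circ_\xi(1\otimes\circ_{\phi_i})$ on $M(P)\otimes M(\psi^{-1}(i))\otimes M(\phi^{-1}(j))$; (ii) for $\xi=\psi'\phi'=\psi''\phi''$ with elementary $T\xrightarrow{(\phi',j)}P'\xrightarrow{(\psi',i)}S$ and $T\xrightarrow{(\phi'',l)}P''\xrightarrow{(\psi'',k)}S$, $i\neq k$, $|\psi'|(j)=k$, $|\psi''|(l)=i$, and nontrivial fibers $F',G',F'',G''$ of $\phi',\psi',\phi'',\psi''$, one has $\circ_{\phi''}(\circ_{\psi''}\otimes1)=\circ_{\phi'}(\circ_{\psi'}\otimes1)(1\otimes(\sigma''^{-1})^*\otimes\sigma'^*)(1\otimes\tau)$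 on $M(S)\otimes M(G'')\otimes M(F'')$, where $\sigma'=\phi''_k:F'=\xi^{-1}(k)\to G''$ and $\sigma''=\phi'_i:F''=\xi^{-1}(i)\to G'$ are the canonical quasibijections and $\tau$ is the symmetry; (iii) for a commutative square $\sigma\phi'=\phi''\omega$ with $\omega:T'\to T''$ an isomorphism, $\sigma:S'\to S''$ a quasibijection, and $F'\triangleright_iT'\xrightarrow{\phi'}S'$, $F''\triangleright_jT''\xrightarrow{\phi''}S''$ elementary ($j=|\sigma|(i)$), one has $\omega^*\circ_{\phi''}=\circ_{\phi'}(\sigma^*\otimes\bar\omega^*)$, where $\bar\omega:F'=(\sigma\phi')^{-1}(j)\to F''$ is induced by $\omega$. It is *extended unital* if it is equipped with maps $\eta_t:\Bbbk\to M(t)$, $t$ local terminal, such that, with $\vartheta(T,t):M(F)\cong\Bbbk\otimes M(F)\xrightarrow{\eta_t\otimes1}M(t)\otimes M(F)\xrightarrow{\circ_!}M(T)$ for $F\triangleright T\xrightarrow{!}t$, $e(T)\ge1$: $\vartheta(T,U)=1$ for trivial $U$; $\omega^*\eta_t=\eta_s$ for each $\omega:s\to t$ between local terminal objects; and (iii$'$)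 for every commutative square $\phi:=\sigma\phi'=\phi''\omega$ with isomorphisms $\omega:T'\to T''$, $\sigma:S'\to S''$ and elementary $F'\triangleright_iT'\xrightarrow{\phi'}S'$, $F''\triangleright_jT''\xrightarrow{\phi''}S''$, $j=|\sigma|(i)$, $F:=\phi^{-1}(j)$, $$\omega^*\circ_{\phi''}\bigl(1\otimes(\omega_j^*)^{-1}\vartheta(F,\sigma^{-1}(j))\bigr)=\circ_{\phi'}(\sigma^*\otimes1)\quad\text{on } M(S'')\otimes M(F').$$ *Strictly* extended unital means that all $\vartheta(T,t)$ are identities, *$1$-connected* that all $\eta_t$ are isomorphisms. Morphisms are families of maps commuting with the presheaf structures, the circle products and the $\eta_t$. **Theorem.** There is a functor $\Phi$ from the category of strictly extended unital $\mathtt O$-operads in $\mathtt V$ to the category of strictly extended unital Markl's $\mathtt O$-operads in $\mathtt V$ that is the identity on the underlying families of objects, of morphisms and of extended units and equips $P$ with the presheaf structure and circle products $$\omega^*:P(T)\cong\Bbbk\otimes P(T)\xrightarrow{\eta\otimes1}P(\omega)\otimes P(T)\xrightarrow{\gamma_\omega}P(S),\qquad \circ_\phi:P(S)\otimes P(F)\cong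 P(F)\otimes P(S)\to P(\phi)\otimes P(S)\xrightarrow{\gamma_\phi}P(T)$$ for isomorphisms $\omega:S\to T$ and elementary $F\triangleright T\xrightarrow\phi S$ (with extended units inserted at all fibers of $\omega$, respectively at all trivial fibers of $\phi$). It restricts to an isomorphism of categories between the full subcategories of $1$-connected operads. -/

import Mathlib

open CategoryTheory MonoidalCategory

universe v u v' u'

/-! ### Ordered tensor products -/

section TensorList

variable {V : Type u'} [Category.{v'} V] [MonoidalCategory V] {ι κ : Type*}

/-- The tensor product `A a₁ ⊗ (A a₂ ⊗ (⋯ ⊗ 𝟙))` over a list `[a₁, a₂, …]` of indices. -/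
def tensorList (A : ι → V) : List ι → V
  | [] => 𝟙_ V
  | a :: l => A a ⊗ tensorList A l

namespace tensorList

/-- Functoriality of the tensor product of a list. -/
def map {A B : ι → V} (φ : ∀ i, A i ⟶ B i) : ∀ l : List ι, tensorList A l ⟶ tensorList B l
  | [] => 𝟙 (𝟙_ V)
  | a :: l => φ a ⊗ₘ map φ l

theorem map_id (A : ι → V) : ∀ l : List ι, map (fun i => 𝟙 (A i)) l = 𝟙 (tensorList A l)
  | [] => rfl
  | a :: l => by
    change 𝟙 (A a) ⊗ₘ map (fun i => 𝟙 (A i)) l = 𝟙 (A a ⊗ tensorList A l)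
    rw [map_id A l, id_tensorHom_id]

theorem map_comp {A B C : ι → V} (φ : ∀ i, A i ⟶ B i) (ψ : ∀ i, B i ⟶ C i) :
    ∀ l : List ι, map (fun i => φ i ≫ ψ i) l = map φ l ≫ map ψ l
  | [] => (Category.id_comp _).symm
  | a :: l => by
    change (φ a ≫ ψ a) ⊗ₘ map (fun i => φ i ≫ ψ i) l = (φ a ⊗ₘ map φ l) ≫ (ψ a ⊗ₘ map ψ l)
    rw [map_comp φ ψ l, tensorHom_comp_tensorHom]

/-- Given a map `𝟙 ⟶ A j` for every member `j` of the list, the composite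
`𝟙 ≅ 𝟙 ⊗ ⋯ ⊗ 𝟙 ⟶ ⨂ A`. -/
def ofUnits (A : ι → V) : ∀ l : List ι, (∀ j ∈ l, 𝟙_ V ⟶ A j) → (𝟙_ V ⟶ tensorList A l)
  | [], _ => 𝟙 (𝟙_ V)
  | a :: l, e => (λ_ (𝟙_ V)).inv ≫
      (e a List.mem_cons_self ⊗ₘ ofUnits A l fun j hj => e j (List.mem_cons_of_mem a hj))

/-- The canonical map `(⨂ A) ⊗ (⨂ A') ⟶ ⨂ A` for the concatenation of two lists. -/
def append (A : ι → V) : ∀ l l' : List ι,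
    tensorList A l ⊗ tensorList A l' ⟶ tensorList A (l ++ l')
  | [], l' => (λ_ (tensorList A l')).hom
  | a :: l, l' => (α_ (A a) (tensorList A l) (tensorList A l')).hom ≫ (A a ◁ append A l l')

/-- The canonical map from an iterated tensor product to the tensor product over the
concatenation of the inner lists. -/
def flatten (A : ι → V) (m : κ → List ι) : ∀ L : List κ,
    tensorList (fun k => tensorList A (m k)) L ⟶ tensorList A (L.flatMap m)
  | [] => 𝟙 (𝟙_ V)
  | k :: L => (tensorList A (m k) ◁ flatten A m L) ≫ append A (m k) (L.flatMap m)

/-- Change of the names of the indices along a map `e`. -/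
def reindex (A : ι → V) (e : κ → ι) : ∀ l : List κ,
    tensorList (fun k => A (e k)) l ⟶ tensorList A (l.map e)
  | [] => 𝟙 (𝟙_ V)
  | k :: l => A (e k) ◁ reindex A e l

variable [SymmetricCategory V]

/-- The canonical map `(⨂ A) ⊗ (⨂ B) ⟶ ⨂ (A ⊗ B)`. -/
def zip (A B : ι → V) : ∀ l : List ι,
    tensorList A l ⊗ tensorList B l ⟶ tensorList (fun i => A i ⊗ B i) l
  | [] => (λ_ (𝟙_ V)).hom
  | a :: l => tensorμ (A a) (tensorList A l) (B a) (tensorList B l) ≫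
      ((A a ⊗ B a) ◁ zip A B l)

variable [DecidableEq ι]

/-- The canonical isomorphism moving the factor with index `i` to the front. -/
def pull (A : ι → V) (i : ι) : ∀ l : List ι, i ∈ l →
    (tensorList A l ≅ A i ⊗ tensorList A (l.erase i))
  | [], h => absurd h List.not_mem_nil
  | a :: l, h =>
    if ha : a = i then
      eqToIso (by subst ha; rw [List.erase_cons_head]; rfl)
    else
      whiskerLeftIso (A a) (pull A i l ((List.mem_cons.1 h).resolve_left (Ne.symm ha))) ≪≫
        (α_ (A a) (A i) (tensorList A (l.erase i))).symm ≪≫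
        whiskerRightIso (β_ (A a) (A i)) (tensorList A (l.erase i)) ≪≫
        (α_ (A i) (A a) (tensorList A (l.erase i))) ≪≫
        eqToIso (by rw [List.erase_cons_tail (by simpa using ha)]; rfl)

/-- The symmetry isomorphism between the tensor products over two lists that are permutations
of each other; it matches the factors with equal indices (and is the canonical one when the
indices in the lists are pairwise distinct). -/
def reorder (A : ι → V) : ∀ l l' : List ι, l.Perm l' → (tensorList A l ≅ tensorList A l')
  | [], _, h => eqToIso (by rw [List.nil_perm.1 h])
  | a :: l, l', h =>
    whiskerLeftIso (A a) (reorder A l (l'.erase a) (List.cons_perm_iff_perm_erase.1 h).2) ≪≫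
      (pull A a l' (List.cons_perm_iff_perm_erase.1 h).1).symm

/-- Given `i` in a list without repetitions, and maps `𝟙 ⟶ A j` for all `j ≠ i`, the composite
`A i ≅ 𝟙 ⊗ ⋯ ⊗ A i ⊗ ⋯ ⊗ 𝟙 ⟶ ⨂ A`. -/
def insertUnits (A : ι → V) (l : List ι) (hl : l.Nodup) (i : ι) (hi : i ∈ l)
    (e : ∀ j, j ≠ i → (𝟙_ V ⟶ A j)) : A i ⟶ tensorList A l :=
  (ρ_ (A i)).inv ≫ (A i ◁ ofUnits A (l.erase i) fun j hj => e j (hl.mem_erase_iff.1 hj).1) ≫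
    (pull A i l hi).inv

end tensorList

end TensorList

/-! ### Operadic categories -/

/-- An object is local terminal if it is terminal in its connected component. -/
def IsLocalTerminal {O : Type u} [Category.{v} O] (t : O) : Prop :=
  ∀ T : O, Zigzag T t → Nonempty (Unique (T ⟶ t))

/-- The connected component of an object. -/
def component {O : Type u} [Category.{v} O] (T : O) : CategoryTheory.ConnectedComponents O :=
  Quotient.mk (Zigzag.setoid O) T

/-- The data of an operadic category: the cardinality functor to the category of the finite
ordinals `Fin n` and all maps, the chosen local terminal objects, and the fiber functors
`O/R ⥤ O` for `i ∈ |R|`, with `|h⁻¹(i)| = |h|⁻¹(i)` on objects. -/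
class OperadicCategoryData (O : Type u) [Category.{v} O] where
  card : O → ℕ
  cardMap {T S : O} (f : T ⟶ S) : Fin (card T) → Fin (card S)
  cardMap_id (T : O) (x : Fin (card T)) : cardMap (𝟙 T) x = x
  cardMap_comp {T S R : O} (f : T ⟶ S) (g : S ⟶ R) (x : Fin (card T)) :
    cardMap (f ≫ g) x = cardMap g (cardMap f x)
  chosen : CategoryTheory.ConnectedComponents O → O
  component_chosen (c : CategoryTheory.ConnectedComponents O) : component (chosen c) = c
  chosen_isLocalTerminal (c : CategoryTheory.ConnectedComponents O) : IsLocalTerminal (chosen c)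
  card_chosen (c : CategoryTheory.ConnectedComponents O) : card (chosen c) = 1
  fiberFunctor (R : O) (i : Fin (card R)) : Over R ⥤ O
  card_fiber {T R : O} (h : T ⟶ R) (i : Fin (card R)) :
    (Finset.univ.filter fun x : Fin (card T) => cardMap h x = i).card =
      card ((fiberFunctor R i).obj (Over.mk h))

namespace OperadicCategory

open OperadicCategoryData

section Data

variable {O : Type u} [Category.{v} O] [OperadicCategoryData O]

/-- The `i`th fiber `f⁻¹(i)`. -/
def fiber {T S : O} (f : T ⟶ S) (i : Fin (card S)) : O :=
  (fiberFunctor S i).obj (Over.mk f)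

/-- The map `f_i : h⁻¹(i) ⟶ g⁻¹(i)` induced by a commutative triangle `h = g ∘ f`. -/
def fiberMap {T S R : O} (f : T ⟶ S) (g : S ⟶ R) (h : T ⟶ R) (w : f ≫ g = h)
    (i : Fin (card R)) : fiber h i ⟶ fiber g i :=
  (fiberFunctor R i).map (Over.homMk f w : Over.mk h ⟶ Over.mk g)

theorem fiberMap_comp {T S Q R : O} (f : T ⟶ S) (a : S ⟶ Q) (b : T ⟶ Q) (c : Q ⟶ R)
    (g : S ⟶ R) (h : T ⟶ R) (hb : f ≫ a = b) (hg : a ≫ c = g) (hh : b ≫ c = h)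
    (hf : f ≫ g = h) (i : Fin (card R)) :
    fiberMap f g h hf i ≫ fiberMap a c g hg i = fiberMap b c h hh i := by
  subst hb
  exact ((fiberFunctor R i).map_comp (Over.homMk f hf : Over.mk h ⟶ Over.mk g)
    (Over.homMk a hg : Over.mk g ⟶ Over.mk c)).symm

/-- The isomorphism of fibers induced by an isomorphism over `R`. -/
def fiberIso {T S R : O} (ω : T ≅ S) (g : S ⟶ R) (h : T ⟶ R) (w : ω.hom ≫ g = h)
    (i : Fin (card R)) : fiber h i ≅ fiber g i :=
  (fiberFunctor R i).mapIso (Over.isoMk ω w : Over.mk h ≅ Over.mk g)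

/-- The order preserving inclusion of `|h⁻¹(i)| = |h|⁻¹(i)` into `|T|`. -/
noncomputable def incl {T R : O} (h : T ⟶ R) (i : Fin (card R)) :
    Fin (card (fiber h i)) ↪o Fin (card T) :=
  Finset.orderEmbOfFin _ (card_fiber h i)

/-- Trivial objects are the chosen local terminal ones. -/
def IsTrivial (X : O) : Prop := ∃ c : CategoryTheory.ConnectedComponents O, X = chosen c

/-- A quasibijection is a morphism all of whose fibers are trivial. -/
def IsQuasiBijection {T S : O} (f : T ⟶ S) : Prop := ∀ i, IsTrivial (fiber f i)

/-- The morphisms `f` for which `|f|` is order preserving. -/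
def IsOrderPreserving {T S : O} (f : T ⟶ S) : Prop := Monotone (cardMap f)

end Data

end OperadicCategory

open OperadicCategoryData OperadicCategory in
/-- Strict operadic categories. -/
class OperadicCategory (O : Type u) [Category.{v} O] extends OperadicCategoryData O where
  isQuasiBijection_id (T : O) : IsQuasiBijection (𝟙 T)
  /-- `|f_i|` is the map `|h|⁻¹(i) → |g|⁻¹(i)` induced by `|f|`. -/
  incl_cardMap_fiberMap {T S R : O} (f : T ⟶ S) (g : S ⟶ R) (h : T ⟶ R) (w : f ≫ g = h)
    (i : Fin (card R)) (x : Fin (card (fiber h i))) :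
    incl g i (cardMap (fiberMap f g h w i) x) = cardMap f (incl h i x)
  /-- The fiber functor over a chosen local terminal object is the domain functor. -/
  fiberFunctor_chosen (c : CategoryTheory.ConnectedComponents O) (i : Fin (card (chosen c))) :
    fiberFunctor (chosen c) i = Over.forget (chosen c)
  /-- `f⁻¹(j) = f_i⁻¹(j)` for `j ∈ |g|⁻¹(i)`. -/
  fiber_fiberMap {T S R : O} (f : T ⟶ S) (g : S ⟶ R) (h : T ⟶ R) (w : f ≫ g = h)
    (i : Fin (card R)) (x : Fin (card (fiber g i))) :
    fiber f (incl g i x) = fiber (fiberMap f g h w i) x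
  /-- `f_j = (f_i)_j` for `j ∈ |c|⁻¹(i)`. -/
  fiberMap_fiberMap {T S Q R : O} (f : T ⟶ S) (a : S ⟶ Q) (b : T ⟶ Q) (c : Q ⟶ R)
    (g : S ⟶ R) (h : T ⟶ R) (hb : f ≫ a = b) (hg : a ≫ c = g) (hh : b ≫ c = h)
    (hf : f ≫ g = h) (i : Fin (card R)) (x : Fin (card (fiber c i))) :
    fiberMap f a b hb (incl c i x) =
      eqToHom (fiber_fiberMap b c h hh i x) ≫
        fiberMap (fiberMap f g h hf i) (fiberMap a c g hg i) (fiberMap b c h hh i)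
          (fiberMap_comp f a b c g h hb hg hh hf i) x ≫
        eqToHom (fiber_fiberMap a c g hg i x).symm

namespace OperadicCategory

open OperadicCategoryData

section Facts

theorem isLocalTerminal_of_iso {O : Type u} [Category.{v} O] {s t : O} (e : s ≅ t)
    (ht : IsLocalTerminal t) : IsLocalTerminal s := by
  intro T hT
  obtain ⟨h⟩ := ht T (hT.trans (Zigzag.of_hom e.hom))
  refine ⟨⟨⟨h.default ≫ e.inv⟩, fun f => ?_⟩⟩
  rw [← cancel_mono e.hom]
  exact (h.uniq _).trans (h.uniq _).symm

variable {O : Type u} [Category.{v} O] [OperadicCategory O]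

theorem IsTrivial.isLocalTerminal {X : O} (h : IsTrivial X) : IsLocalTerminal X := by
  obtain ⟨c, rfl⟩ := h
  exact chosen_isLocalTerminal c

theorem IsTrivial.eq_chosen {X : O} (h : IsTrivial X) :
    chosen (component X) = X := by
  obtain ⟨c, rfl⟩ := h
  rw [component_chosen]

theorem IsTrivial.card_eq {X : O} (h : IsTrivial X) : card X = 1 := by
  obtain ⟨c, rfl⟩ := h
  exact card_chosen c

/-- The unique fiber of a morphism to a trivial object is its domain. -/
theorem IsTrivial.fiber_eq {T X : O} (h : IsTrivial X) (f : T ⟶ X) (i : Fin (card X)) :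
    fiber f i = T := by
  obtain ⟨c, rfl⟩ := h
  unfold fiber
  rw [fiberFunctor_chosen]
  rfl

/-- The fibers of isomorphisms are local terminal. -/
theorem fiber_isLocalTerminal {T S : O} (ω : T ≅ S) (i : Fin (card S)) :
    IsLocalTerminal (fiber ω.hom i) :=
  isLocalTerminal_of_iso (fiberIso ω (𝟙 S) ω.hom (Category.comp_id _) i)
    (isQuasiBijection_id S i).isLocalTerminal

theorem cardMap_incl {T R : O} (h : T ⟶ R) (i : Fin (card R)) (x : Fin (card (fiber h i))) :
    cardMap h (incl h i x) = i := by
  have := Finset.orderEmbOfFin_mem _ (card_fiber h i) x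
  exact (Finset.mem_filter.1 this).2

theorem exists_incl_eq {T R : O} (h : T ⟶ R) (y : Fin (card T)) :
    ∃ x, incl h (cardMap h y) x = y := by
  have := Finset.range_orderEmbOfFin _ (card_fiber h (cardMap h y))
  have hy : y ∈ Set.range (incl h (cardMap h y)) := by
    unfold incl
    erw [this]
    simp
  exact hy

/-- If `g⁻¹(|g|(j))` is trivial, then `f⁻¹(j) = h⁻¹(|g|(j))` for `h = g ∘ f`. -/
theorem fiber_eq_of_trivial {T S R : O} (f : T ⟶ S) (g : S ⟶ R) (h : T ⟶ R) (w : f ≫ g = h)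
    (j : Fin (card S)) (i : Fin (card R)) (hij : cardMap g j = i) (ht : IsTrivial (fiber g i)) :
    fiber f j = fiber h i := by
  subst hij
  obtain ⟨x, hx⟩ := exists_incl_eq g j
  have h1 := fiber_fiberMap f g h w (cardMap g j) x
  rw [hx] at h1
  exact h1.trans (ht.fiber_eq _ _)

/-- The list of the elements of `|S|`, regrouped along `|g| : |S| → |R|`. -/
theorem perm_regroup {S R : O} (g : S ⟶ R) :
    ((List.finRange (card R)).flatMap fun i =>
      (List.finRange (card (fiber g i))).map (incl g i)).Perm (List.finRange (card S)) := by
  rw [List.perm_ext_iff_of_nodup]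
  · intro y
    simp only [List.mem_flatMap, List.mem_finRange, List.mem_map, true_and, iff_true]
    obtain ⟨x, hx⟩ := exists_incl_eq g y
    exact ⟨_, x, hx⟩
  · rw [List.nodup_flatMap]
    refine ⟨fun i _ => (List.nodup_finRange _).map (incl g i).injective, ?_⟩
    refine (List.nodup_finRange _).imp ?_
    intro i i' hne y hy hy'
    obtain ⟨x, -, rfl⟩ := List.mem_map.1 hy
    obtain ⟨x', -, hx'⟩ := List.mem_map.1 hy'
    apply hne
    rw [← cardMap_incl g i x, ← hx', cardMap_incl]
  · exact List.nodup_finRange _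

end Facts

/-! ### Conditions on operadic categories -/

section Conditions

variable (O : Type u) [Category.{v} O] [OperadicCategory O]

/-- `|f|` is surjective for every morphism `f`. -/
def ConstantFree : Prop :=
  ∀ ⦃T S : O⦄ (f : T ⟶ S), Function.Surjective (cardMap f)

/-- Every morphism is a quasibijection followed by an order preserving morphism. -/
def Factorizable : Prop :=
  ∀ ⦃T S : O⦄ (f : T ⟶ S), ∃ (X : O) (σ : T ⟶ X) (φ : X ⟶ S),
    IsQuasiBijection σ ∧ IsOrderPreserving φ ∧ σ ≫ φ = f

/-- All quasibijections are invertible. -/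
def QuasiBijectionsInvertible : Prop :=
  ∀ ⦃T S : O⦄ (f : T ⟶ S), IsQuasiBijection f → IsIso f

/-- The unique fiber axiom: if the fiber of `T ⟶ t`, with `t` local terminal, is `T`, then `t` is
a chosen local terminal object. -/
def UniqueFiber : Prop :=
  ∀ ⦃T t : O⦄ (f : T ⟶ t), IsLocalTerminal t → ∀ i, fiber f i = T → IsTrivial t

/-- For a commutative square `f'' ∘ π = σ ∘ f'` with `σ` a quasibijection, the member
`f'⁻¹(i) = (σ f')⁻¹(j) ⟶ f''⁻¹(j)`, `j = |σ|(i)`, of the derived sequence. -/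
def derived {O : Type u} [Category.{v} O] [OperadicCategory O] {S' S'' T' T'' : O}
    (f' : S' ⟶ T') (σ : T' ⟶ T'') (hσ : IsQuasiBijection σ) (π : S' ⟶ S'') (f'' : S'' ⟶ T'')
    (w : π ≫ f'' = f' ≫ σ) (i : Fin (card T')) :
    fiber f' i ⟶ fiber f'' (cardMap σ i) :=
  eqToHom (fiber_eq_of_trivial f' σ (f' ≫ σ) rfl i _ rfl (hσ _)) ≫
    fiberMap π f'' (f' ≫ σ) w (cardMap σ i)

/-- The (strong) blow up axiom: a corner `S' ⟶ T' ⟶ T''` of an order preserving `f'` and a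
quasibijection `σ`, together with objects `F j` and maps `f'⁻¹(i) ⟶ F (|σ| i)`, completes
uniquely to a commutative square with `f''` order preserving, with fibers `F j`, and with the
given maps as its derived sequence. -/
def BlowUp : Prop :=
  ∀ ⦃S' T' T'' : O⦄ (f' : S' ⟶ T') (σ : T' ⟶ T'') (_ : IsOrderPreserving f')
    (hσ : IsQuasiBijection σ) (F : Fin (card T'') → O)
    (p : ∀ i : Fin (card T'), fiber f' i ⟶ F (cardMap σ i)),
    ∃! q : Σ S'' : O, (S' ⟶ S'') × (S'' ⟶ T''),
      IsOrderPreserving q.2.2 ∧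
      ∃ (w : q.2.1 ≫ q.2.2 = f' ≫ σ) (hF : ∀ j, fiber q.2.2 j = F j),
        ∀ i, derived f' σ hσ q.2.1 q.2.2 w i ≫ eqToHom (hF (cardMap σ i)) = p i

end Conditions

/-! ### Gradings and elementary morphisms -/

/-- A grading: `e(T) + e(F₁) + ⋯ + e(F_k) = e(S)` for `f : S ⟶ T` with fibers `F₁, …, F_k`. -/
structure Grading (O : Type u) [Category.{v} O] [OperadicCategory O] where
  grade : O → ℕ
  grade_add {S T : O} (f : S ⟶ T) : grade T + ∑ i, grade (fiber f i) = grade S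

namespace Grading

variable {O : Type u} [Category.{v} O] [OperadicCategory O] (e : Grading O)

/-- The grade `e(f) = e(S) - e(T)` of `f : S ⟶ T`; note that `e(T) ≤ e(S)`. -/
def gradeHom {S T : O} (_ : S ⟶ T) : ℕ := e.grade S - e.grade T

/-- `(φ, i)` is elementary: `φ` is order preserving, its `i`th fiber has grade `≥ 1`, and all its
other fibers are trivial. -/
structure IsElementary {T S : O} (φ : T ⟶ S) (i : Fin (card S)) : Prop where
  orderPreserving : IsOrderPreserving φ
  one_le : 1 ≤ e.grade (fiber φ i)
  trivial (j : Fin (card S)) : j ≠ i → IsTrivial (fiber φ j)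

variable {e}

theorem grade_trivial {X : O} (h : IsTrivial X) : e.grade X = 0 := by
  have h1 := e.grade_add (𝟙 X)
  have h2 : ∀ i, e.grade (fiber (𝟙 X) i) = e.grade X := fun i => by rw [h.fiber_eq]
  simp only [h2, Finset.sum_const, Finset.card_univ, Fintype.card_fin, h.card_eq, one_smul] at h1
  omega

theorem grade_fiber_le {T S : O} (f : T ⟶ S) (i : Fin (card S)) :
    e.grade (fiber f i) ≤ e.grade T := by
  have h1 := e.grade_add f
  have h2 := Finset.single_le_sum (f := fun i => e.grade (fiber f i)) (fun _ _ => Nat.zero_le _)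
    (Finset.mem_univ i)
  omega

theorem grade_le {T S : O} (f : T ⟶ S) : e.grade S ≤ e.grade T := by
  have h1 := e.grade_add f
  omega

theorem exists_iso_trivial {t : O} (ht : IsLocalTerminal t) :
    ∃ U : O, IsTrivial U ∧ Nonempty (t ≅ U) := by
  have hz : Zigzag t (chosen (component t)) := by
    apply Quotient.exact (s := Zigzag.setoid O)
    exact (component_chosen (component t)).symm
  obtain ⟨a⟩ := chosen_isLocalTerminal (component t) t hz
  obtain ⟨b⟩ := ht _ hz.symm
  obtain ⟨a'⟩ := chosen_isLocalTerminal (component t) _ (Zigzag.refl _)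
  obtain ⟨b'⟩ := ht t (Zigzag.refl _)
  exact ⟨_, ⟨_, rfl⟩, ⟨⟨a.default, b.default, (b'.uniq _).trans (b'.uniq _).symm,
    (a'.uniq _).trans (a'.uniq _).symm⟩⟩⟩

theorem grade_localTerminal {t : O} (ht : IsLocalTerminal t) : e.grade t = 0 := by
  obtain ⟨U, hU, ⟨i⟩⟩ := exists_iso_trivial ht
  have := e.grade_le i.inv
  rw [grade_trivial hU] at this
  omega

theorem card_localTerminal {t : O} (ht : IsLocalTerminal t) : card t = 1 := by
  obtain ⟨U, hU, ⟨i⟩⟩ := exists_iso_trivial ht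
  rw [← hU.card_eq]
  have h := Fintype.card_congr (⟨cardMap i.hom, cardMap i.inv,
    fun x => by rw [← cardMap_comp, i.hom_inv_id, cardMap_id],
    fun x => by rw [← cardMap_comp, i.inv_hom_id, cardMap_id]⟩ : Fin (card t) ≃ Fin (card U))
  simpa using h

/-- Morphisms from objects of grade `≥ 1` to local terminal objects are elementary. -/
theorem isElementary_of_isLocalTerminal {T t : O} (f : T ⟶ t) (ht : IsLocalTerminal t)
    (hT : 1 ≤ e.grade T) (i : Fin (card t)) : e.IsElementary f i := by
  have hs : Subsingleton (Fin (card t)) := by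
    rw [card_localTerminal ht]; infer_instance
  refine ⟨fun x y _ => le_of_eq (Subsingleton.elim _ _), ?_,
    fun j hj => absurd (Subsingleton.elim j i) hj⟩
  have h1 := e.grade_add f
  rw [Fintype.sum_eq_single i fun j hj => absurd (Subsingleton.elim j i) hj,
    grade_localTerminal ht] at h1
  omega

/-- The composite of elementary morphisms with joint fibers is elementary. -/
theorem IsElementary.comp {T S P : O} {φ : T ⟶ S} {ψ : S ⟶ P} {ξ : T ⟶ P} (w : φ ≫ ψ = ξ)
    {i : Fin (card P)} {x : Fin (card (fiber ψ i))} (hφ : e.IsElementary φ (incl ψ i x))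
    (hψ : e.IsElementary ψ i) : e.IsElementary ξ i := by
  refine ⟨?_, ?_, ?_⟩
  · intro a b hab
    rw [← w, cardMap_comp, cardMap_comp]
    exact hψ.orderPreserving (hφ.orderPreserving hab)
  · refine le_trans ?_ (e.grade_fiber_le (fiberMap φ ψ ξ w i) x)
    rw [← fiber_fiberMap]
    exact hφ.one_le
  · intro l hl
    have ht := hψ.trivial l hl
    have hc : 0 < card (fiber ψ l) := by rw [ht.card_eq]; exact Nat.one_pos
    have hy := cardMap_incl ψ l ⟨0, hc⟩
    rw [← fiber_eq_of_trivial φ ψ ξ w _ l hy ht]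
    apply hφ.trivial
    intro h
    apply hl
    rw [← hy, h, cardMap_incl]

/-- The map of nontrivial fibers induced by elementary morphisms with joint fibers is
elementary. -/
theorem IsElementary.fiberMap {T S P : O} {φ : T ⟶ S} {ψ : S ⟶ P} {ξ : T ⟶ P} (w : φ ≫ ψ = ξ)
    {i : Fin (card P)} {x : Fin (card (fiber ψ i))} (hφ : e.IsElementary φ (incl ψ i x)) :
    e.IsElementary (fiberMap φ ψ ξ w i) x := by
  refine ⟨?_, ?_, ?_⟩
  · intro a b hab
    rw [← (incl ψ i).le_iff_le, incl_cardMap_fiberMap, incl_cardMap_fiberMap]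
    exact hφ.orderPreserving ((incl ξ i).monotone hab)
  · rw [← fiber_fiberMap]
    exact hφ.one_le
  · intro l hl
    rw [← fiber_fiberMap]
    exact hφ.trivial _ fun h => hl ((incl ψ i).injective h)

/-- The fiber of a composite `σ φ'`, over the position of the nontrivial fiber of `φ'`, has
grade `≥ 1`. -/
theorem IsElementary.one_le_comp {T' S' S'' : O} {σ : S' ⟶ S''} {φ' : T' ⟶ S'}
    {φ : T' ⟶ S''} (w' : φ' ≫ σ = φ) {j : Fin (card S'')} {x : Fin (card (fiber σ j))}
    (hφ' : e.IsElementary φ' (incl σ j x)) : 1 ≤ e.grade (fiber φ j) := by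
  refine le_trans hφ'.one_le ?_
  rw [fiber_fiberMap φ' σ φ w' j x]
  exact e.grade_fiber_le _ _

end Grading

end OperadicCategory

open OperadicCategory OperadicCategoryData

/-! ### Operads -/

section Operads

variable (O : Type u) [Category.{v} O] [OperadicCategory O]
  (V : Type u') [Category.{v'} V] [MonoidalCategory V] [SymmetricCategory V]

/-- For a family `E` of objects of `V` indexed by the objects of `O`, the tensor product
`E(f) = ⨂ E(f⁻¹(i))` over `i ∈ |S|`. -/
abbrev tensorFibers {O : Type u} [Category.{v} O] [OperadicCategory O]
    {V : Type u'} [Category.{v'} V] [MonoidalCategory V]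
    (E : O → V) {T S : O} (f : T ⟶ S) : V :=
  tensorList (fun i => E (fiber f i)) (List.finRange (card S))

/-- The canonical map `⨂ᵢ E(f_i) ⟶ E(f)`, which uses the equalities `f_i⁻¹(j) = f⁻¹(j)` and
rearranges the factors along `|g|`. -/
noncomputable def regroup {O : Type u} [Category.{v} O] [OperadicCategory O]
    {V : Type u'} [Category.{v'} V] [MonoidalCategory V] [SymmetricCategory V]
    (E : O → V) {T S R : O} (f : T ⟶ S) (g : S ⟶ R) (h : T ⟶ R) (w : f ≫ g = h) :
    tensorList (fun i => tensorFibers E (fiberMap f g h w i)) (List.finRange (card R)) ⟶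
      tensorFibers E f :=
  tensorList.map (fun i =>
      tensorList.map (fun x => eqToHom (congrArg E (fiber_fiberMap f g h w i x).symm))
        (List.finRange (card (fiber g i))) ≫
      tensorList.reindex (fun j => E (fiber f j)) (incl g i)
        (List.finRange (card (fiber g i)))) (List.finRange (card R)) ≫
    tensorList.flatten (fun j => E (fiber f j))
      (fun i => (List.finRange (card (fiber g i))).map (incl g i)) (List.finRange (card R)) ≫
    (tensorList.reorder (fun j => E (fiber f j)) _ _ (perm_regroup g)).hom

/-- `O`-operads in `V`. -/
structure Operad where
  obj : O → V
  unit (c : CategoryTheory.ConnectedComponents O) : 𝟙_ V ⟶ obj (chosen c)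
  γ {T S : O} (f : T ⟶ S) : tensorFibers obj f ⊗ obj S ⟶ obj T
  assoc {T S R : O} (f : T ⟶ S) (g : S ⟶ R) (h : T ⟶ R) (w : f ≫ g = h) :
    (tensorList (fun i => tensorFibers obj (fiberMap f g h w i)) (List.finRange (card R)) ◁ γ g) ≫
        (regroup obj f g h w ▷ obj S) ≫ γ f =
      (α_ _ (tensorFibers obj g) (obj R)).inv ≫
        (tensorList.zip (fun i => tensorFibers obj (fiberMap f g h w i))
            (fun i => obj (fiber g i)) (List.finRange (card R)) ▷ obj R) ≫
        (tensorList.map (fun i => γ (fiberMap f g h w i)) (List.finRange (card R)) ▷ obj R) ≫ γ h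
  id_γ (T : O) :
    (λ_ (obj T)).inv ≫
      (tensorList.ofUnits (fun i => obj (fiber (𝟙 T) i)) (List.finRange (card T))
        (fun i _ => unit (component (fiber (𝟙 T) i)) ≫
          eqToHom (congrArg obj (isQuasiBijection_id T i).eq_chosen)) ▷ obj T) ≫
      γ (𝟙 T) = 𝟙 (obj T)
  γ_unit {T : O} (c : CategoryTheory.ConnectedComponents O) (f : T ⟶ chosen c) (i : Fin (card (chosen c))) :
    (ρ_ (obj T)).inv ≫ (obj T ◁ unit c) ≫
      ((eqToHom (congrArg obj (IsTrivial.fiber_eq ⟨c, rfl⟩ f i).symm) ≫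
        tensorList.insertUnits (fun j => obj (fiber f j)) (List.finRange (card (chosen c)))
          (List.nodup_finRange _) i (List.mem_finRange i)
          (fun j hj => absurd (Fin.ext (by have := card_chosen c; omega)) hj)) ▷
            obj (chosen c)) ≫
      γ f = 𝟙 (obj T)

/-- Extended unital `O`-operads: `η` is a morphism of unital operads from the constant operad on
the operadic subcategory of local terminal objects to the restriction of the operad. -/
structure ExtUnitalOperad extends Operad O V where
  η (t : O) (ht : IsLocalTerminal t) : 𝟙_ V ⟶ obj t
  η_chosen (c : CategoryTheory.ConnectedComponents O) : η (chosen c) (chosen_isLocalTerminal c) = unit c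
  η_γ {s t : O} (f : s ⟶ t) (hs : IsLocalTerminal s) (ht : IsLocalTerminal t)
    (hf : ∀ i, IsLocalTerminal (fiber f i)) :
    (λ_ (𝟙_ V)).inv ≫
      (tensorList.ofUnits (fun i => obj (fiber f i)) (List.finRange (card t))
        (fun i _ => η (fiber f i) (hf i)) ⊗ₘ η t ht) ≫ γ f = η s hs

variable {O V}

/-- The map `ϑ(T,t) : P(F) ≅ P(F) ⊗ 𝟙 ⟶ P(F) ⊗ P(t) = P(f) ⊗ P(t) ⟶ P(T)` for a morphism
`f : T ⟶ t` to a local terminal object, with the unique fiber `F`. -/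
def ExtUnitalOperad.θ (P : ExtUnitalOperad O V) {T t : O} (f : T ⟶ t)
    (ht : IsLocalTerminal t) (i : Fin (card t)) : P.obj (fiber f i) ⟶ P.obj T :=
  (ρ_ (P.obj (fiber f i))).inv ≫ (P.obj (fiber f i) ◁ P.η t ht) ≫
    (tensorList.insertUnits (fun j => P.obj (fiber f j)) (List.finRange (card t))
      (List.nodup_finRange _) i (List.mem_finRange i)
      (fun j hj => absurd (Fin.ext (by have := Grading.card_localTerminal ht; omega)) hj) ▷
        P.obj t) ≫
    P.γ f

variable (V) in
/-- Strictly extended unital `O`-operads in `V`: the maps `ϑ(T,t)`, `e(T) ≥ 1`, are identities. -/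
structure StrictOperad (e : Grading O) extends ExtUnitalOperad O V where
  strict {T t : O} (f : T ⟶ t) (ht : IsLocalTerminal t) (_ : 1 ≤ e.grade T) (i : Fin (card t)) :
    ∃ h : obj (fiber f i) = obj T, toExtUnitalOperad.θ f ht i = eqToHom h

namespace StrictOperad

variable {e : Grading O}

/-- Morphisms are families of morphisms commuting with the structure operations and with the
extended units. -/
@[ext]
structure Hom (P Q : StrictOperad V e) where
  app (T : O) : P.obj T ⟶ Q.obj T
  app_γ {T S : O} (f : T ⟶ S) :
    P.γ f ≫ app T =
      (tensorList.map (fun i => app (fiber f i)) (List.finRange (card S)) ⊗ₘ app S) ≫ Q.γ f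
  app_η (t : O) (ht : IsLocalTerminal t) : P.η t ht ≫ app t = Q.η t ht

instance : Category (StrictOperad V e) where
  Hom P Q := Hom P Q
  id P :=
    { app := fun T => 𝟙 (P.obj T)
      app_γ := fun f => by
        rw [tensorList.map_id, id_tensorHom_id, Category.comp_id]
        exact (Category.id_comp _).symm
      app_η := fun _ _ => Category.comp_id _ }
  comp φ ψ :=
    { app := fun T => φ.app T ≫ ψ.app T
      app_γ := fun f => by
        rw [tensorList.map_comp, ← Category.assoc, φ.app_γ, Category.assoc, ψ.app_γ,
          ← Category.assoc, ← tensorHom_comp_tensorHom]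
      app_η := fun t ht => by rw [← Category.assoc, φ.app_η, ψ.app_η] }
  id_comp φ := Hom.ext (funext fun _ => Category.id_comp _)
  comp_id φ := Hom.ext (funext fun _ => Category.comp_id _)
  assoc φ ψ χ := Hom.ext (funext fun _ => Category.assoc _ _ _)

/-- The family of objects of `V` underlying an operad. -/
def underlying : StrictOperad V e ⥤ (O → V) where
  obj P := P.obj
  map φ := φ.app

variable (V e) in
/-- `1`-connected operads: the extended unit is an isomorphism. -/
def oneConnected : ObjectProperty (StrictOperad V e) :=
  fun P => ∀ t ht, IsIso (P.η t ht)

end StrictOperad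

end Operads

/-! ### Markl's operads -/

section Markl

variable {O : Type u} [Category.{v} O] [OperadicCategory O]

/-- The data of a Markl's operad with extended units: a family of objects, the action of the
isomorphisms, the circle products along elementary morphisms, and the extended units. -/
structure MarklData (V : Type u') [Category.{v'} V] [MonoidalCategory V] (e : Grading O) where
  obj : O → V
  map {S T : O} (ω : S ≅ T) : obj T ⟶ obj S
  circ {T S : O} (φ : T ⟶ S) (i : Fin (card S)) (hφ : e.IsElementary φ i) :
    obj S ⊗ obj (fiber φ i) ⟶ obj T
  η (t : O) (ht : IsLocalTerminal t) : 𝟙_ V ⟶ obj t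

namespace MarklData

variable {V : Type u'} [Category.{v'} V] [MonoidalCategory V] {e : Grading O}

/-- The map `ϑ(T,t) : M(F) ≅ 𝟙 ⊗ M(F) ⟶ M(t) ⊗ M(F) ⟶ M(T)` for a morphism
`f : T ⟶ t` from an object of grade `≥ 1` to a local terminal object, with the unique
fiber `F`. -/
def θ (M : MarklData V e) {T t : O} (f : T ⟶ t) (ht : IsLocalTerminal t) (hT : 1 ≤ e.grade T)
    (i : Fin (card t)) : M.obj (fiber f i) ⟶ M.obj T :=
  (λ_ (M.obj (fiber f i))).inv ≫ (M.η t ht ▷ M.obj (fiber f i)) ≫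
    M.circ f i (Grading.isElementary_of_isLocalTerminal f ht hT i)

variable [SymmetricCategory V]

/-- The axioms of a Markl's operad. -/
structure IsMarkl (M : MarklData V e) : Prop where
  map_id (T : O) : M.map (Iso.refl T) = 𝟙 (M.obj T)
  map_comp {T S R : O} (ω : T ≅ S) (ω' : S ≅ R) :
    M.map (ω ≪≫ ω') = M.map ω' ≫ M.map ω
  /-- Associativity for elementary morphisms with joint fibers. -/
  joint {T S P : O} (φ : T ⟶ S) (ψ : S ⟶ P) (ξ : T ⟶ P) (w : φ ≫ ψ = ξ) (i : Fin (card P))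
    (x : Fin (card (fiber ψ i))) (hφ : e.IsElementary φ (incl ψ i x))
    (hψ : e.IsElementary ψ i) :
    (M.circ ψ i hψ ▷ M.obj (fiber φ (incl ψ i x))) ≫ M.circ φ (incl ψ i x) hφ =
      (α_ (M.obj P) (M.obj (fiber ψ i)) (M.obj (fiber φ (incl ψ i x)))).hom ≫
        (M.obj P ◁ ((M.obj (fiber ψ i) ◁
            eqToHom (congrArg M.obj (fiber_fiberMap φ ψ ξ w i x))) ≫
          M.circ (fiberMap φ ψ ξ w i) x (hφ.fiberMap w))) ≫
        M.circ ξ i (hφ.comp w hψ)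
  /-- Compatibility for elementary morphisms with disjoint fibers. Here `s'` and `s''` are the
  canonical quasibijections `φ'⁻¹(j) = ξ⁻¹(k) ⟶ ψ''⁻¹(k)` and
  `φ''⁻¹(l) = ξ⁻¹(i) ⟶ ψ'⁻¹(i)`. -/
  disjoint {T P' P'' S : O} (φ' : T ⟶ P') (ψ' : P' ⟶ S) (φ'' : T ⟶ P'') (ψ'' : P'' ⟶ S)
    (ξ : T ⟶ S) (w' : φ' ≫ ψ' = ξ) (w'' : φ'' ≫ ψ'' = ξ)
    (i k : Fin (card S)) (hik : i ≠ k) (j : Fin (card P')) (l : Fin (card P''))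
    (hj : cardMap ψ' j = k) (hl : cardMap ψ'' l = i)
    (hφ' : e.IsElementary φ' j) (hψ' : e.IsElementary ψ' i)
    (hφ'' : e.IsElementary φ'' l) (hψ'' : e.IsElementary ψ'' k)
    (s' : fiber φ' j ≅ fiber ψ'' k) (s'' : fiber φ'' l ≅ fiber ψ' i)
    (_ : s'.hom =
      eqToHom (fiber_eq_of_trivial φ' ψ' ξ w' j k hj (hψ'.trivial k hik.symm)) ≫
        fiberMap φ'' ψ'' ξ w'' k)
    (_ : s''.hom =
      eqToHom (fiber_eq_of_trivial φ'' ψ'' ξ w'' l i hl (hψ''.trivial i hik)) ≫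
        fiberMap φ' ψ' ξ w' i) :
    (M.circ ψ'' k hψ'' ▷ M.obj (fiber φ'' l)) ≫ M.circ φ'' l hφ'' =
      (α_ (M.obj S) (M.obj (fiber ψ'' k)) (M.obj (fiber φ'' l))).hom ≫
        (M.obj S ◁ (β_ (M.obj (fiber ψ'' k)) (M.obj (fiber φ'' l))).hom) ≫
        (M.obj S ◁ (M.map s''.symm ⊗ₘ M.map s')) ≫
        (α_ (M.obj S) (M.obj (fiber ψ' i)) (M.obj (fiber φ' j))).inv ≫
        (M.circ ψ' i hψ' ▷ M.obj (fiber φ' j)) ≫ M.circ φ' j hφ'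
  /-- Equivariance: `ω` is an isomorphism and `σ` a quasibijection; the map of fibers is
  `φ'⁻¹(i) = φ⁻¹(j) ⟶ φ''⁻¹(j)`, `j = |σ|(i)`. -/
  equivariant {T' T'' S' S'' : O} (ω : T' ≅ T'') (σ : S' ≅ S'') (φ' : T' ⟶ S')
    (φ'' : T'' ⟶ S'') (φ : T' ⟶ S'') (w' : φ' ≫ σ.hom = φ) (w'' : ω.hom ≫ φ'' = φ)
    (hσ : IsQuasiBijection σ.hom) (i : Fin (card S')) (j : Fin (card S''))
    (hij : cardMap σ.hom i = j) (hφ' : e.IsElementary φ' i) (hφ'' : e.IsElementary φ'' j) :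
    M.circ φ'' j hφ'' ≫ M.map ω =
      (M.map σ ⊗ₘ (M.map (fiberIso ω φ'' φ w'' j) ≫
        eqToHom (congrArg M.obj (fiber_eq_of_trivial φ' σ.hom φ w' i j hij (hσ j)).symm))) ≫
        M.circ φ' i hφ'

/-- A Markl's operad with extended units. -/
structure IsExtUnital (M : MarklData V e) : Prop extends M.IsMarkl where
  /-- Unitality: the circle product with the unit of a trivial `U` along `T ⟶ U` is the
  identity. -/
  unital {T U : O} (f : T ⟶ U) (hU : IsTrivial U) (hT : 1 ≤ e.grade T) (i : Fin (card U)) :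
    M.θ f hU.isLocalTerminal hT i = eqToHom (congrArg M.obj (hU.fiber_eq f i))
  /-- `η` is a natural transformation on local terminal objects. -/
  natural {s t : O} (ω : s ≅ t) (hs : IsLocalTerminal s) (ht : IsLocalTerminal t) :
    M.η t ht ≫ M.map ω = M.η s hs
  /-- Equivariance for an arbitrary isomorphism `σ`; the fibers of `φ'`, `φ''` and
  `φ` are `F' = φ'⁻¹(i)`, `F'' = φ''⁻¹(j)` and `F = φ⁻¹(j)`, where `j = |σ|(i)`, and
  `F'` is the fiber of the map `F ⟶ σ⁻¹(j)` to a local terminal object. -/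
  equivariant' {T' T'' S' S'' : O} (ω : T' ≅ T'') (σ : S' ≅ S'') (φ' : T' ⟶ S')
    (φ'' : T'' ⟶ S'') (φ : T' ⟶ S'') (w' : φ' ≫ σ.hom = φ) (w'' : ω.hom ≫ φ'' = φ)
    (j : Fin (card S'')) (x : Fin (card (fiber σ.hom j)))
    (hφ' : e.IsElementary φ' (incl σ.hom j x)) (hφ'' : e.IsElementary φ'' j) :
    (M.obj S'' ◁ (eqToHom (congrArg M.obj (fiber_fiberMap φ' σ.hom φ w' j x)) ≫
        M.θ (fiberMap φ' σ.hom φ w' j) (fiber_isLocalTerminal σ j)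
          (hφ'.one_le_comp w') x ≫
        M.map (fiberIso ω φ'' φ w'' j).symm)) ≫
        M.circ φ'' j hφ'' ≫ M.map ω =
      (M.map σ ▷ M.obj (fiber φ' (incl σ.hom j x))) ≫ M.circ φ' (incl σ.hom j x) hφ'

/-- Strict extended unitality: the maps `ϑ(T,t)` are identities. -/
def IsStrict (M : MarklData V e) : Prop :=
  ∀ {T t : O} (f : T ⟶ t) (ht : IsLocalTerminal t) (hT : 1 ≤ e.grade T) (i : Fin (card t)),
    ∃ h : M.obj (fiber f i) = M.obj T, M.θ f ht hT i = eqToHom h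

end MarklData

variable (V : Type u') [Category.{v'} V] [MonoidalCategory V] [SymmetricCategory V]

/-- Strictly extended unital Markl's operads in `V`. -/
structure StrictMarkl (e : Grading O) extends MarklData V e where
  isExtUnital : toMarklData.IsExtUnital
  isStrict : toMarklData.IsStrict

namespace StrictMarkl

variable {V} {e : Grading O}

/-- Morphisms are families of morphisms commuting with the presheaf structures, the circle
products and the extended units. -/
@[ext]
structure Hom (M N : StrictMarkl V e) where
  app (T : O) : M.obj T ⟶ N.obj T
  app_map {S T : O} (ω : S ≅ T) : M.map ω ≫ app S = app T ≫ N.map ω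
  app_circ {T S : O} (φ : T ⟶ S) (i : Fin (card S)) (hφ : e.IsElementary φ i) :
    M.circ φ i hφ ≫ app T = (app S ⊗ₘ app (fiber φ i)) ≫ N.circ φ i hφ
  app_η (t : O) (ht : IsLocalTerminal t) : M.η t ht ≫ app t = N.η t ht

instance : Category (StrictMarkl V e) where
  Hom M N := Hom M N
  id M :=
    { app := fun T => 𝟙 (M.obj T)
      app_map := fun _ => by rw [Category.comp_id, Category.id_comp]
      app_circ := fun _ _ _ => by rw [Category.comp_id, id_tensorHom_id, Category.id_comp]
      app_η := fun _ _ => Category.comp_id _ }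
  comp φ ψ :=
    { app := fun T => φ.app T ≫ ψ.app T
      app_map := fun ω => by
        rw [← Category.assoc, φ.app_map, Category.assoc, ψ.app_map, Category.assoc]
      app_circ := fun f i hf => by
        rw [← Category.assoc, φ.app_circ, Category.assoc, ψ.app_circ, ← Category.assoc,
          tensorHom_comp_tensorHom]
      app_η := fun t ht => by rw [← Category.assoc, φ.app_η, ψ.app_η] }
  id_comp φ := Hom.ext (funext fun _ => Category.id_comp _)
  comp_id φ := Hom.ext (funext fun _ => Category.comp_id _)
  assoc φ ψ χ := Hom.ext (funext fun _ => Category.assoc _ _ _)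

/-- The family of objects of `V` underlying a Markl's operad. -/
def underlying : StrictMarkl V e ⥤ (O → V) where
  obj M := M.obj
  map φ := φ.app

variable (V e) in
/-- `1`-connected Markl's operads: the extended unit is an isomorphism. -/
def oneConnected : ObjectProperty (StrictMarkl V e) :=
  fun M => ∀ t ht, IsIso (M.η t ht)

end StrictMarkl

variable {V} in
/-- The Markl's data underlying an extended unital operad `P`: the same objects and extended units,
`ω^* : P(T) ≅ 𝟙 ⊗ P(T) ⟶ P(ω) ⊗ P(T) ⟶ P(S)` for an isomorphism `ω : S ≅ T`, and
`∘_φ : P(S) ⊗ P(F) ≅ P(F) ⊗ P(S) ⟶ P(φ) ⊗ P(S) ⟶ P(T)` for an elementary `φ : T ⟶ S` with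
nontrivial fiber `F`, where the extended units are inserted at the remaining fibers. -/
def ExtUnitalOperad.toMarklData (P : ExtUnitalOperad O V) (e : Grading O) : MarklData V e where
  obj := P.obj
  map {_ T} ω :=
    (λ_ (P.obj T)).inv ≫
      (tensorList.ofUnits (fun i => P.obj (fiber ω.hom i)) (List.finRange (card T))
        (fun i _ => P.η (fiber ω.hom i) (fiber_isLocalTerminal ω i)) ▷ P.obj T) ≫
      P.γ ω.hom
  circ {_ S} φ i hφ :=
    (β_ (P.obj S) (P.obj (fiber φ i))).hom ≫
      (tensorList.insertUnits (fun j => P.obj (fiber φ j)) (List.finRange (card S))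
        (List.nodup_finRange _) i (List.mem_finRange i)
        (fun j hj => P.η (fiber φ j) (hφ.trivial j hj).isLocalTerminal) ▷ P.obj S) ≫
      P.γ φ
  η := P.η

end Markl

/-- A functor is an isomorphism of categories. -/
def IsIsomorphismOfCategories {C : Type*} [Category* C] {D : Type*} [Category* D]
    (F : C ⥤ D) : Prop :=
  ∃ G : D ⥤ C, F ⋙ G = 𝟭 C ∧ G ⋙ F = 𝟭 D

-- An operad composition `γ_f` uses all fibers of `f` at once, a circle product only one. The
-- theorem holds because morphisms can be dismantled one fiber at a time: by the factorization and
-- blow up axioms, a morphism that is not invertible is an isomorphism, followed by an elementary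
-- morphism and by a morphism with one fiber of positive grade fewer (`nonempty_splitting`). In a
-- `1`-connected Markl's operad this dictates `γ` by recursion on the grade of the source:
-- isomorphisms act, and otherwise `γ_f` is the circle product along the elementary factor applied
-- to `γ` of the last factor. The content is that this does not depend on the chosen splitting and
-- is associative.
--
-- Diagrams in `V` are handled by elements. A generalized element of `X` is a morphism to `X` from a
-- tensor product of labelled objects, modulo permutation of the factors. All structure
-- isomorphisms, including the symmetry, act on such elements as they would on tuples of elements of
-- sets. Nothing is lost: a permutation of factors with distinct labels that returns each factor to
-- its place is the identity (`IsPermutation.eq_id`), so a generic element, given by an isomorphism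
-- from a word with distinct labels, distinguishes morphisms (`IsGeneric.eq_of_map_eq`). Thus
-- operads and Markl's operads may be treated as structures on families of sets. In the
-- `1`-connected case one may moreover keep only the extended unit over each local terminal object
-- (`MarklData.Elements.detects`).
--
-- Associativity is proved for sets. For three composable morphisms there are four associativity
-- statements for pairs, together with one for the maps induced on fibers. Two of the former can be
-- deduced from the remaining statements, provided that the elements over certain fibers are values
-- of `γ` (`AssocAt.comp_left`, `AssocAt.comp_right`). Isomorphisms and unary morphisms, those with
-- one fiber of positive grade, are settled by the Markl axioms: equivariance moves isomorphisms,
-- joint associativity handles nested fibers, and the disjoint axiom exchanges two fibers over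
-- different points. The core is `assocBelow`: splitting off any fiber gives the same composition as
-- the chosen splitting. It is an induction on the grade. Two factorizations that collapse the same
-- fiber differ by an isomorphism (`factorization_unique`); two that collapse different fibers are
-- compared by exchanging them. From there `assoc_unary` and `assoc` follow by peeling off one fiber
-- at a time.
--
-- In the other direction, each Markl axiom for an operad is an equality of two composites along one
-- morphism, checked fiber by fiber in `SetOperad`. The two passages are mutually inverse, also on
-- morphisms, because a family of maps that respects isomorphisms, circle products and extended
-- units respects every composition (`SetMarkl.IsGenerated.commutesAt`). Applied to identity maps,
-- this says that an operad is determined by its Markl's operad.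

universe w

/-! ### Generalized elements of objects of a symmetric monoidal category -/

section GeneralizedElements

variable {V : Type u'} [Category.{v'} V] [MonoidalCategory V]

/-- The lemmas of this kind are stated for arbitrary objects, so that monoidal rewriting never meets
the tensor product of a list; they are applied by unfolding the list. -/
theorem split_assoc_nil_aux {A B C : V} (s : C ⟶ A ⊗ B) :
    s ≫ ((λ_ A).inv ▷ B) ≫ (α_ (𝟙_ V) A B).hom = 𝟙 C ≫ (λ_ C).inv ≫ (𝟙_ V ◁ s) := by
  rw [← leftUnitor_inv_naturality]
  simp

theorem split_assoc_cons_aux {A L L' L'' M N P P' : V} (s : P ⟶ M ⊗ L'') (t : M ⟶ L ⊗ L')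
    (e : P ⟶ P') (s' : P' ⟶ L ⊗ N) (t' : N ⟶ L' ⊗ L'')
    (ih : s ≫ (t ▷ L'') ≫ (α_ _ _ _).hom = e ≫ s' ≫ (L ◁ t')) :
    ((A ◁ s) ≫ (α_ _ _ _).inv) ≫ (((A ◁ t) ≫ (α_ _ _ _).inv) ▷ L'') ≫ (α_ (A ⊗ L) L' L'').hom =
      (A ◁ e) ≫ ((A ◁ s') ≫ (α_ _ _ _).inv) ≫ ((A ⊗ L) ◁ t') := by
  have h2 : (A ◁ (s ≫ (t ▷ L'') ≫ (α_ _ _ _).hom)) ≫ (α_ A L (L' ⊗ L'')).inv =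
      (A ◁ (e ≫ s' ≫ (L ◁ t'))) ≫ (α_ A L (L' ⊗ L'')).inv := by rw [ih]
  simp only [MonoidalCategory.whiskerLeft_comp, Category.assoc, comp_whiskerRight] at h2 ⊢
  rw [← associator_inv_naturality_right, ← h2]
  monoidal

theorem whiskerLeft_inverse_aux {A B B' : V} {p : B ⟶ B'} {q : B' ⟶ B} (h : p ≫ q = 𝟙 B) :
    (A ◁ p) ≫ (A ◁ q) = 𝟙 (A ⊗ B) := by
  rw [← MonoidalCategory.whiskerLeft_comp, h, whiskerLeft_id]

theorem cons_append_aux {A L M L' Q Q' : V} {q : Q ⟶ Q'} {s' : Q' ⟶ L' ⊗ M} {s : Q ⟶ L ⊗ M}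
    {p : L ⟶ L'} (h : q ≫ s' = s ≫ (p ▷ M)) :
    (A ◁ q) ≫ (A ◁ s') ≫ (α_ A L' M).inv = ((A ◁ s) ≫ (α_ A L M).inv) ≫ ((A ◁ p) ▷ M) := by
  rw [← MonoidalCategory.whiskerLeft_comp_assoc, h, Category.assoc,
    ← associator_inv_naturality_middle, MonoidalCategory.whiskerLeft_comp_assoc]

theorem cons_append_left_aux {A L L' M Q Q' : V} {q : Q ⟶ Q'} {s' : Q' ⟶ M ⊗ L'} {s : Q ⟶ M ⊗ L}
    {p : L ⟶ L'} (h : q ≫ s' = s ≫ (M ◁ p)) :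
    (A ◁ q) ≫ (A ◁ s') ≫ (α_ A M L').inv = ((A ◁ s) ≫ (α_ A M L).inv) ≫ ((A ⊗ M) ◁ p) := by
  rw [← MonoidalCategory.whiskerLeft_comp_assoc, h, Category.assoc,
    ← associator_inv_naturality_right, MonoidalCategory.whiskerLeft_comp_assoc]

/-- The isomorphism exchanging the first two of three factors. -/
def swapFirst [SymmetricCategory V] (A B L : V) : A ⊗ (B ⊗ L) ⟶ B ⊗ (A ⊗ L) :=
  (α_ A B L).inv ≫ ((β_ A B).hom ▷ L) ≫ (α_ B A L).hom

theorem swapFirst_swapFirst [SymmetricCategory V] (A B L : V) :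
    swapFirst A B L ≫ swapFirst B A L = 𝟙 (A ⊗ (B ⊗ L)) := by
  unfold swapFirst
  simp only [Category.assoc, Iso.hom_inv_id_assoc, ← comp_whiskerRight_assoc,
    SymmetricCategory.symmetry, id_whiskerRight, Category.id_comp, Iso.inv_hom_id]

theorem swapFirst_naturality [SymmetricCategory V] (A B : V) {L L' : V} (p : L ⟶ L') :
    (A ◁ (B ◁ p)) ≫ swapFirst A B L' = swapFirst A B L ≫ (B ◁ (A ◁ p)) := by
  unfold swapFirst
  rw [associator_inv_naturality_right_assoc, whisker_exchange_assoc, Category.assoc,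
    Category.assoc, associator_naturality_right]

theorem swap_append_aux [SymmetricCategory V] {A B L M Q : V} (s : Q ⟶ L ⊗ M) :
    swapFirst A B Q ≫ (B ◁ ((A ◁ s) ≫ (α_ _ _ _).inv)) ≫ (α_ _ _ _).inv =
      ((A ◁ ((B ◁ s) ≫ (α_ _ _ _).inv)) ≫ (α_ _ _ _).inv) ≫ (swapFirst A B L ▷ M) := by
  have h := swapFirst_naturality A B s
  simp only [MonoidalCategory.whiskerLeft_comp, Category.assoc]
  rw [← reassoc_of% h]
  unfold swapFirst
  monoidal

/-- The tensor product of a list of labelled objects. -/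
abbrev tensorWord (l : List (ℕ × V)) : V := tensorList Prod.snd l

/-- Splitting the tensor product of a concatenation. -/
def tensorWord.split : ∀ l l' : List (ℕ × V),
    tensorWord (l ++ l') ⟶ tensorWord l ⊗ tensorWord l'
  | [], l' => (λ_ (tensorWord l')).inv
  | a :: l, l' => (a.2 ◁ split l l') ≫ (α_ a.2 (tensorWord l) (tensorWord l')).inv

theorem tensorWord.split_nil (l' : List (ℕ × V)) :
    split [] l' = (λ_ (tensorWord l')).inv := rfl

theorem tensorWord.isIso_split : ∀ l l' : List (ℕ × V), IsIso (split l l')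
  | [], l' => inferInstanceAs (IsIso (λ_ (tensorWord l')).inv)
  | a :: l, l' =>
    have := isIso_split l l'
    inferInstanceAs (IsIso ((a.2 ◁ split l l') ≫ (α_ a.2 (tensorWord l) (tensorWord l')).inv))

theorem tensorWord.split_assoc : ∀ l l' l'' : List (ℕ × V),
    split (l ++ l') l'' ≫ (split l l' ▷ tensorWord l'') ≫ (α_ _ _ _).hom =
      eqToHom (congrArg tensorWord (List.append_assoc l l' l'')) ≫
        split l (l' ++ l'') ≫ (tensorWord l ◁ split l' l'')
  | [], l', l'' => split_assoc_nil_aux (split l' l'')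
  | a :: l, l', l'' => by
    have ih := split_assoc l l' l''
    have h : eqToHom (congrArg tensorWord (List.append_assoc (a :: l) l' l'')) =
        a.2 ◁ eqToHom (congrArg tensorWord (List.append_assoc l l' l'')) := by
      have : ∀ {m m' : List (ℕ × V)} (e : m = m') (e' : tensorWord (a :: m) = tensorWord (a :: m')),
          eqToHom e' = a.2 ◁ eqToHom (congrArg tensorWord e) := by
        rintro m _ rfl _
        exact (whiskerLeft_id _ _).symm
      exact this (List.append_assoc l l' l'') _
    rw [h]
    exact split_assoc_cons_aux _ _ _ _ _ ih

variable [SymmetricCategory V]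

/-- The structural isomorphisms that permute the factors of a tensor product. -/
inductive IsPermutation : ∀ l l' : List (ℕ × V), (tensorWord l ⟶ tensorWord l') → Prop
  | refl (l) : IsPermutation l l (𝟙 _)
  | cons (a : ℕ × V) {l l'} {p : tensorWord l ⟶ tensorWord l'} :
      IsPermutation l l' p → IsPermutation (a :: l) (a :: l') (a.2 ◁ p)
  | swap (a b : ℕ × V) (l) : IsPermutation (a :: b :: l) (b :: a :: l)
      (swapFirst a.2 b.2 (tensorWord l))
  | trans {l l' l''} {p : tensorWord l ⟶ tensorWord l'} {q : tensorWord l' ⟶ tensorWord l''} :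
      IsPermutation l l' p → IsPermutation l' l'' q → IsPermutation l l'' (p ≫ q)

namespace IsPermutation

theorem perm {l l' : List (ℕ × V)} {p} (h : IsPermutation l l' p) : l.Perm l' := by
  induction h with
  | refl l => exact List.Perm.refl l
  | cons a _ ih => exact ih.cons a
  | swap a b l => exact List.Perm.swap b a l
  | trans _ _ ih ih' => exact ih.trans ih'

theorem exists_inverse {l l' : List (ℕ × V)} {p} (h : IsPermutation l l' p) :
    ∃ q, IsPermutation l' l q ∧ p ≫ q = 𝟙 _ ∧ q ≫ p = 𝟙 _ := by
  induction h with
  | refl l => exact ⟨𝟙 _, refl l, Category.comp_id _, Category.comp_id _⟩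
  | cons a _ ih =>
    obtain ⟨q, hq, h1, h2⟩ := ih
    exact ⟨_, cons a hq, whiskerLeft_inverse_aux h1, whiskerLeft_inverse_aux h2⟩
  | swap a b l => exact ⟨_, swap b a l, swapFirst_swapFirst _ _ _, swapFirst_swapFirst _ _ _⟩
  | trans _ _ ih ih' =>
    obtain ⟨q, hq, h1, h2⟩ := ih
    obtain ⟨q', hq', h1', h2'⟩ := ih'
    refine ⟨_, trans hq' hq, ?_, ?_⟩
    · rw [Category.assoc, reassoc_of% h1', h1]
    · rw [Category.assoc, reassoc_of% h2, h2']

theorem of_eq {l l' : List (ℕ × V)} (h : l = l') :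
    IsPermutation l l' (eqToHom (congrArg tensorWord h)) := by
  subst h
  exact refl l

/-- Together with `append_left`, this makes the tensor product of generalized elements independent
of representatives. -/
theorem append_right {l l' : List (ℕ × V)} {p} (h : IsPermutation l l' p) (m : List (ℕ × V)) :
    ∃ q, IsPermutation (l ++ m) (l' ++ m) q ∧
      q ≫ tensorWord.split l' m = tensorWord.split l m ≫ (p ▷ tensorWord m) := by
  induction h with
  | refl l =>
    exact ⟨_, refl _, by rw [Category.id_comp, id_whiskerRight, Category.comp_id]⟩
  | @cons a l l' p _ ih =>
    obtain ⟨q, hq, h1⟩ := ih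
    exact ⟨_, cons a hq, cons_append_aux h1⟩
  | swap a b l => exact ⟨_, swap a b (l ++ m), swap_append_aux _⟩
  | trans _ _ ih ih' =>
    obtain ⟨q, hq, h1⟩ := ih
    obtain ⟨q', hq', h1'⟩ := ih'
    refine ⟨_, trans hq hq', ?_⟩
    rw [Category.assoc, h1', reassoc_of% h1, comp_whiskerRight]

theorem append_left {l l' : List (ℕ × V)} {p} (h : IsPermutation l l' p) :
    ∀ m : List (ℕ × V), ∃ q, IsPermutation (m ++ l) (m ++ l') q ∧
      q ≫ tensorWord.split m l' = tensorWord.split m l ≫ (tensorWord m ◁ p)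
  | [] => ⟨p, h, by
      rw [tensorWord.split_nil, tensorWord.split_nil]
      exact leftUnitor_inv_naturality p⟩
  | a :: m => by
    obtain ⟨q, hq, h1⟩ := append_left h m
    exact ⟨_, cons a hq, cons_append_left_aux h1⟩

end IsPermutation

end GeneralizedElements

/-! ### Coherence for permutations of tensor factors -/

section Coherence

variable {V : Type u'} [Category.{v'} V] [MonoidalCategory V] [SymmetricCategory V]

/-- The Yang–Baxter relation in the form needed when a third factor is moved to the front past two
that are being exchanged. -/
theorem swapFirst_yangBaxter (A B C L : V) :
    swapFirst B C (A ⊗ L) ≫ (C ◁ swapFirst B A L) ≫ swapFirst C A (B ⊗ L) =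
      (B ◁ swapFirst C A L) ≫ swapFirst B A (C ⊗ L) ≫ (A ◁ swapFirst B C L) := by
  have h := congrArg (fun f => (α_ B C (A ⊗ L)).inv ≫ (α_ (B ⊗ C) A L).inv ≫
    (((α_ B C A).hom ≫ f) ▷ L) ≫ (α_ _ _ _).hom ≫ (A ◁ (α_ C B L).hom)) (BraidedCategory.yang_baxter B C A)
  unfold swapFirst
  refine Eq.trans ?_ (Eq.trans (congrArg (fun f => f ≫ 𝟙 _) h) ?_) <;>
  · monoidal

theorem swap_tail_aux {A B C L M : V} (s : L ⟶ A ⊗ M) :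
    swapFirst B C L ≫ (C ◁ ((B ◁ s) ≫ swapFirst B A M)) ≫ swapFirst C A (B ⊗ M) =
      ((B ◁ ((C ◁ s) ≫ swapFirst C A M)) ≫ swapFirst B A (C ⊗ M)) ≫ (A ◁ swapFirst B C M) := by
  simp only [MonoidalCategory.whiskerLeft_comp, Category.assoc]
  rw [← swapFirst_yangBaxter, ← reassoc_of% (swapFirst_naturality B C s)]

theorem cons_tail_aux {A B L L' M M' : V} {p : L ⟶ L'} {s : L ⟶ A ⊗ M} {s' : L' ⟶ A ⊗ M'}
    {p' : M ⟶ M'} (h : p ≫ s' = s ≫ (A ◁ p')) :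
    (B ◁ p) ≫ (B ◁ s') ≫ swapFirst B A M' =
      ((B ◁ s) ≫ swapFirst B A M) ≫ (A ◁ (B ◁ p')) := by
  rw [← MonoidalCategory.whiskerLeft_comp_assoc, h, MonoidalCategory.whiskerLeft_comp,
    Category.assoc, Category.assoc, swapFirst_naturality]

/-- `ToFront a l l' s` says that `s` moves the first factor with the label `a` to the front. -/
inductive ToFront (a : ℕ × V) :
    ∀ l l' : List (ℕ × V), (tensorWord l ⟶ a.2 ⊗ tensorWord l') → Prop
  | head (l) : ToFront a (a :: l) l (𝟙 (a.2 ⊗ tensorWord l))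
  | tail (b : ℕ × V) (l l') (s : tensorWord l ⟶ a.2 ⊗ tensorWord l') : b ≠ a →
      ToFront a l l' s →
      ToFront a (b :: l) (b :: l') ((b.2 ◁ s) ≫ swapFirst b.2 a.2 (tensorWord l'))

namespace IsPermutation

/-- Moving the factor `a` to the front commutes with a permutation, up to a permutation of the
remaining factors. This cancels one factor at a time and so reduces coherence to shorter words. -/
theorem toFront {l l' : List (ℕ × V)} {p} (h : IsPermutation l l' p) (hn : l.Nodup) (a : ℕ × V) :
    ∀ m s, ToFront a l m s → ∃ m' s' p', ToFront a l' m' s' ∧ IsPermutation m m' p' ∧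
      p ≫ s' = s ≫ (a.2 ◁ p') := by
  induction h with
  | refl l =>
    intro m s hs
    exact ⟨m, s, 𝟙 _, hs, refl _, by
      rw [whiskerLeft_id]; exact (Category.id_comp _).trans (Category.comp_id _).symm⟩
  | @cons b l l' p hp ih =>
    intro m s hs
    cases hs with
    | head =>
      exact ⟨l', _, p, ToFront.head l', hp, (Category.comp_id _).trans (Category.id_comp _).symm⟩
    | tail _ _ m s hb hs =>
      obtain ⟨m', s', p', h1, h2, h3⟩ := ih (List.nodup_cons.1 hn).2 m s hs
      exact ⟨_, _, _, ToFront.tail b _ _ _ hb h1, cons b h2, cons_tail_aux h3⟩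
  | swap b c l =>
    intro m s hs
    cases hs with
    | head =>
      -- The factor at the head has become the second one, so it must be moved past `c`; that this
      -- is a legitimate move uses that the labels differ.
      refine ⟨_, _, _, ToFront.tail c _ _ _ ?_ (ToFront.head l), refl _, ?_⟩
      · rintro rfl
        exact (List.nodup_cons.1 hn).1 List.mem_cons_self
      · have : ∀ A B C : V, swapFirst A B C ≫ (B ◁ 𝟙 (A ⊗ C)) ≫ swapFirst B A C =
            𝟙 (A ⊗ (B ⊗ C)) ≫ (A ◁ 𝟙 (B ⊗ C)) := fun A B C => by
          rw [whiskerLeft_id, whiskerLeft_id, Category.id_comp, swapFirst_swapFirst,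
            Category.comp_id]
        exact this _ _ _
    | tail _ _ m s hb hs =>
      cases hs with
      | head =>
        refine ⟨_, _, _, ToFront.head _, refl _, ?_⟩
        have : ∀ A B C : V, swapFirst A B C ≫ 𝟙 _ =
            ((A ◁ 𝟙 (B ⊗ C)) ≫ swapFirst A B C) ≫ (B ◁ 𝟙 (A ⊗ C)) := fun A B C => by
          rw [whiskerLeft_id, whiskerLeft_id, Category.id_comp]
        exact this _ _ _
      | tail _ _ m s hc hs =>
        exact ⟨_, _, _, ToFront.tail c _ _ _ hc (ToFront.tail b _ _ _ hb hs), swap _ _ _,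
          swap_tail_aux s⟩
  | trans hp hq ih ih' =>
    intro m s hs
    obtain ⟨m', s', p', h1, h2, h3⟩ := ih hn m s hs
    obtain ⟨m'', s'', p'', h1', h2', h3'⟩ := ih' (hp.perm.nodup_iff.1 hn) m' s' h1
    refine ⟨m'', s'', _, h1', trans h2 h2', ?_⟩
    rw [Category.assoc, h3', reassoc_of% h3, MonoidalCategory.whiskerLeft_comp]

theorem eq_of_eq_nil {l l' : List (ℕ × V)} {p} (h : IsPermutation l l' p) (hl : l = []) :
    ∃ h' : l = l', p = eqToHom (congrArg tensorWord h') := by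
  induction h with
  | refl l => exact ⟨rfl, rfl⟩
  | cons => simp at hl
  | swap => simp at hl
  | trans hp hq ih ih' =>
    obtain ⟨h, rfl⟩ := ih hl
    obtain ⟨h', rfl⟩ := ih' (h ▸ hl)
    exact ⟨h.trans h', eqToHom_trans _ _⟩

/-- Coherence: the only structural automorphism of a product of factors with pairwise distinct
labels is the identity. -/
theorem eq_id : ∀ {l : List (ℕ × V)} {p}, IsPermutation l l p → l.Nodup → p = 𝟙 (tensorWord l)
  | [], _, h, _ => (h.eq_of_eq_nil rfl).2
  | a :: l, p, h, hn => by
    -- On the source the move of `a` to the front is the identity; on the target, again `a :: l`, it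
    -- can only be the identity too.
    obtain ⟨m, s, p', h1, h2, h3⟩ := h.toFront hn a _ _ (ToFront.head l)
    cases h1 with
    | head =>
      have h4 := eq_id h2 (List.nodup_cons.1 hn).2
      subst h4
      have : ∀ {A B : V} {p : A ⊗ B ⟶ A ⊗ B}, p ≫ 𝟙 _ = 𝟙 _ ≫ (A ◁ 𝟙 B) → p = 𝟙 _ := by
        intro A B p h
        rwa [whiskerLeft_id, Category.comp_id, Category.comp_id] at h
      exact this h3
    | tail _ _ _ _ ha => exact absurd rfl ha

end IsPermutation

/-! ### The functor of generalized elements -/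

/-- Generalized elements of `X` are morphisms to `X` from tensor products of labelled objects, up
to permutations of the factors. -/
instance genElemSetoid (X : V) : Setoid (Σ l : List (ℕ × V), tensorWord l ⟶ X) where
  r x y := ∃ p, IsPermutation x.1 y.1 p ∧ x.2 = p ≫ y.2
  iseqv :=
    { refl := fun x => ⟨_, IsPermutation.refl _, (Category.id_comp _).symm⟩
      symm := by
        rintro x y ⟨p, hp, h⟩
        obtain ⟨q, hq, -, h2⟩ := hp.exists_inverse
        exact ⟨q, hq, by rw [h, reassoc_of% h2]⟩
      trans := by
        rintro x y z ⟨p, hp, h⟩ ⟨q, hq, h'⟩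
        exact ⟨_, hp.trans hq, by rw [h, h', Category.assoc]⟩ }

/-- The set of generalized elements of an object. -/
def GenElem (X : V) := Quotient (genElemSetoid X)

namespace GenElem

/-- The generalized element given by a morphism. -/
def mk {X : V} (l : List (ℕ × V)) (f : tensorWord l ⟶ X) : GenElem X :=
  Quotient.mk (genElemSetoid X) ⟨l, f⟩

theorem ind {X : V} {p : GenElem X → Prop} (h : ∀ l f, p (mk l f)) (x : GenElem X) : p x :=
  Quotient.ind (fun x => h x.1 x.2) x

theorem mk_eq_of {X : V} {l l' : List (ℕ × V)} {f : tensorWord l ⟶ X} {f' : tensorWord l' ⟶ X}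
    {p} (hp : IsPermutation l l' p) (h : f = p ≫ f') : mk l f = mk l' f' :=
  Quotient.sound ⟨p, hp, h⟩

/-- Two representatives on one word differ by a structural automorphism of it, which coherence makes
trivial. -/
theorem mk_injective {X : V} {l : List (ℕ × V)} (hl : l.Nodup) {f f' : tensorWord l ⟶ X}
    (h : mk l f = mk l f') : f = f' := by
  obtain ⟨p, hp, h⟩ := Quotient.exact h
  have h1 := hp.eq_id hl
  dsimp only at p h h1
  rw [h, h1, Category.id_comp]

/-- The action of a morphism on generalized elements. -/
def map {X Y : V} (g : X ⟶ Y) : GenElem X → GenElem Y :=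
  Quotient.map (fun x => ⟨x.1, x.2 ≫ g⟩) (by
    rintro x y ⟨p, hp, h⟩
    exact ⟨p, hp, by dsimp only; rw [h, Category.assoc]⟩)

theorem map_mk {X Y : V} (g : X ⟶ Y) (l : List (ℕ × V)) (f : tensorWord l ⟶ X) :
    map g (mk l f) = mk l (f ≫ g) := rfl

theorem map_id {X : V} (x : GenElem X) : map (𝟙 X) x = x := by
  induction x using ind with | h l f => rw [map_mk, Category.comp_id]

theorem map_comp {X Y Z : V} (f : X ⟶ Y) (g : Y ⟶ Z) (x : GenElem X) :
    map (f ≫ g) x = map g (map f x) := by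
  induction x using ind with | h l f => rw [map_mk, map_mk, map_mk, Category.assoc]

/-- The unique generalized element of the unit object given by the identity. -/
def one : GenElem (𝟙_ V) := mk [] (𝟙 (𝟙_ V))

/-- The tensor product of generalized elements. -/
def tens {X Y : V} : GenElem X → GenElem Y → GenElem (X ⊗ Y) :=
  Quotient.map₂ (fun x y => ⟨x.1 ++ y.1, tensorWord.split x.1 y.1 ≫ (x.2 ⊗ₘ y.2)⟩) (by
    rintro ⟨l, f⟩ ⟨l', f'⟩ ⟨p, hp, h⟩ ⟨m, g⟩ ⟨m', g'⟩ ⟨q, hq, h'⟩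
    dsimp only at p hp h q hq h'
    obtain ⟨r, hr, h1⟩ := hp.append_right m
    obtain ⟨r', hr', h1'⟩ := hq.append_left l'
    refine ⟨_, hr.trans hr', ?_⟩
    dsimp only
    rw [h, h', Category.assoc, reassoc_of% h1', reassoc_of% h1, ← tensorHom_comp_tensorHom,
      ← tensorHom_def_assoc])

theorem tens_mk {X Y : V} (l m : List (ℕ × V)) (f : tensorWord l ⟶ X) (g : tensorWord m ⟶ Y) :
    tens (mk l f) (mk m g) = mk (l ++ m) (tensorWord.split l m ≫ (f ⊗ₘ g)) := rfl

theorem map_tensorHom {X Y X' Y' : V} (f : X ⟶ X') (g : Y ⟶ Y') (x : GenElem X) (y : GenElem Y) :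
    map (f ⊗ₘ g) (tens x y) = tens (map f x) (map g y) := by
  induction x using ind with | h l a =>
  induction y using ind with | h m b =>
  rw [map_mk, map_mk, tens_mk, tens_mk, map_mk, Category.assoc, tensorHom_comp_tensorHom]

theorem map_whiskerLeft {X Y Y' : V} (g : Y ⟶ Y') (x : GenElem X) (y : GenElem Y) :
    map (X ◁ g) (tens x y) = tens x (map g y) := by
  rw [← id_tensorHom, map_tensorHom, map_id]

theorem map_whiskerRight {X X' Y : V} (f : X ⟶ X') (x : GenElem X) (y : GenElem Y) :
    map (f ▷ Y) (tens x y) = tens (map f x) y := by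
  rw [← tensorHom_id, map_tensorHom, map_id]

theorem map_associator_hom {X Y Z : V} (x : GenElem X) (y : GenElem Y) (z : GenElem Z) :
    map (α_ X Y Z).hom (tens (tens x y) z) = tens x (tens y z) := by
  induction x using ind with | h l a =>
  induction y using ind with | h m b =>
  induction z using ind with | h n c =>
  simp only [tens_mk, map_mk]
  refine mk_eq_of (IsPermutation.of_eq (List.append_assoc l m n)) ?_
  have h := tensorWord.split_assoc l m n
  have h1 : (tensorWord.split l m ≫ (a ⊗ₘ b)) ⊗ₘ c =
    (tensorWord.split l m ▷ tensorWord n) ≫ ((a ⊗ₘ b) ⊗ₘ c) := by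
      rw [← tensorHom_id, tensorHom_comp_tensorHom, Category.id_comp]
  have h2 : a ⊗ₘ (tensorWord.split m n ≫ (b ⊗ₘ c)) =
    (tensorWord l ◁ tensorWord.split m n) ≫ (a ⊗ₘ (b ⊗ₘ c)) := by
      rw [← id_tensorHom, tensorHom_comp_tensorHom, Category.id_comp]
  rw [h1, h2, Category.assoc, Category.assoc, associator_naturality, ← reassoc_of% h]

theorem map_associator_inv {X Y Z : V} (x : GenElem X) (y : GenElem Y) (z : GenElem Z) :
    map (α_ X Y Z).inv (tens x (tens y z)) = tens (tens x y) z := by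
  rw [← map_associator_hom, ← map_comp, Iso.hom_inv_id, map_id]

theorem map_leftUnitor_hom {X : V} (x : GenElem X) : map (λ_ X).hom (tens one x) = x := by
  induction x using ind with | h l a =>
  change mk l (((λ_ (tensorWord l)).inv ≫ (𝟙 (𝟙_ V) ⊗ₘ a)) ≫ (λ_ X).hom) = mk l a
  congr 1
  rw [id_tensorHom]
  simp

theorem map_leftUnitor_inv {X : V} (x : GenElem X) : map (λ_ X).inv x = tens one x := by
  conv_lhs => rw [← map_leftUnitor_hom x]
  rw [← map_comp, Iso.hom_inv_id, map_id]

/-- Two generalized elements commute if the symmetry exchanges them. -/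
def Commute {X Y : V} (x : GenElem X) (y : GenElem Y) : Prop :=
  map (β_ X Y).hom (tens x y) = tens y x

theorem Commute.symm {X Y : V} {x : GenElem X} {y : GenElem Y} (h : Commute x y) :
    Commute y x := by
  unfold Commute at h ⊢
  rw [← h, ← map_comp, SymmetricCategory.symmetry, map_id]

theorem Commute.map_right {X Y Y' : V} {x : GenElem X} {y : GenElem Y} (h : Commute x y)
    (f : Y ⟶ Y') : Commute x (map f y) := by
  unfold Commute at h ⊢
  rw [← map_whiskerLeft, ← map_comp, BraidedCategory.braiding_naturality_right, map_comp, h,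
    map_whiskerRight]

theorem Commute.tens_right {X Y Z : V} {x : GenElem X} {y : GenElem Y} {z : GenElem Z}
    (h : Commute x y) (h' : Commute x z) : Commute x (tens y z) := by
  unfold Commute at h h' ⊢
  have h1 := BraidedCategory.hexagon_forward X Y Z
  have h2 : (β_ X (Y ⊗ Z)).hom = (α_ X Y Z).inv ≫ ((β_ X Y).hom ▷ Z) ≫ (α_ Y X Z).hom ≫
      (Y ◁ (β_ X Z).hom) ≫ (α_ Y Z X).inv := by
    simp
  rw [h2]
  simp only [map_comp]
  rw [map_associator_inv, map_whiskerRight, h, map_associator_hom, map_whiskerLeft, h',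
    map_associator_inv]

/-- The symmetry with the unit is a composite of unitors, so the claim is that splitting off the
empty word on the right is inverse to the right unitor. This is the auxiliary `hs`. -/
theorem Commute.one_right {X : V} (x : GenElem X) : Commute x one := by
  refine Commute.symm ?_
  unfold Commute
  induction x using ind with | h l a =>
  have hs : ∀ l : List (ℕ × V), tensorWord.split l [] ≫ (ρ_ (tensorWord l)).hom =
      eqToHom (congrArg tensorWord (List.append_nil l)) := by
    intro l
    induction l with
    | nil =>
      change (λ_ (𝟙_ V)).inv ≫ (ρ_ (𝟙_ V)).hom = 𝟙 _
      rw [unitors_inv_equal, Iso.inv_hom_id]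
    | cons b l ih =>
      have h : eqToHom (congrArg tensorWord (List.append_nil (b :: l))) =
          b.2 ◁ eqToHom (congrArg tensorWord (List.append_nil l)) := by
        have : ∀ {m m' : List (ℕ × V)} (e : m = m') (e' : tensorWord (b :: m) = tensorWord (b :: m')),
            eqToHom e' = b.2 ◁ eqToHom (congrArg tensorWord e) := by
          rintro m _ rfl _
          exact (whiskerLeft_id _ _).symm
        exact this (List.append_nil l) _
      have : ∀ {B L Q : V} {s : Q ⟶ L ⊗ 𝟙_ V} {r : Q ⟶ L}, s ≫ (ρ_ L).hom = r →
          ((B ◁ s) ≫ (α_ _ _ _).inv) ≫ (ρ_ (B ⊗ L)).hom = B ◁ r := by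
        rintro B L Q s _ rfl
        simp
      rw [h]
      exact this ih
  change mk l (((λ_ (tensorWord l)).inv ≫ (𝟙 (𝟙_ V) ⊗ₘ a)) ≫ (β_ (𝟙_ V) X).hom) =
    mk (l ++ []) (tensorWord.split l [] ≫ (a ⊗ₘ 𝟙 (𝟙_ V)))
  symm
  refine mk_eq_of (IsPermutation.of_eq (List.append_nil l)) ?_
  rw [← hs l]
  have : ∀ {L Q X : V} (s : Q ⟶ L ⊗ 𝟙_ V) (a : L ⟶ X), s ≫ (a ⊗ₘ 𝟙 (𝟙_ V)) =
      (s ≫ (ρ_ L).hom) ≫ ((λ_ L).inv ≫ (𝟙 (𝟙_ V) ⊗ₘ a)) ≫ (β_ (𝟙_ V) X).hom := by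
    intro L Q X s a
    rw [id_tensorHom, tensorHom_id, Category.assoc, Category.assoc,
      BraidedCategory.braiding_naturality_right]
    simp
  exact this _ a

/-- Presents a word by one-letter words, using only the operations under which commuting is closed.
-/
theorem mk_cons (a : ℕ × V) (l : List (ℕ × V)) :
    mk (a :: l) (𝟙 (tensorWord (a :: l))) =
      map ((ρ_ a.2).hom ▷ tensorWord l) (tens (mk [a] (𝟙 (tensorWord [a]))) (mk l (𝟙 _))) := by
  have : ∀ A L : V, 𝟙 (A ⊗ L) = (((A ◁ (λ_ L).inv) ≫ (α_ A (𝟙_ V) L).inv) ≫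
      (𝟙 (A ⊗ 𝟙_ V) ⊗ₘ 𝟙 L)) ≫ ((ρ_ A).hom ▷ L) := by
    intro A L
    simp
  exact congrArg (mk (a :: l)) (this _ _)

/-- The base case: up to unitors, the symmetry is here the generator `swap` of the equivalence
relation. -/
theorem Commute.mk_singleton (a b : ℕ × V) :
    Commute (mk [a] (𝟙 (tensorWord [a]))) (mk [b] (𝟙 (tensorWord [b]))) := by
  unfold Commute
  rw [tens_mk, tens_mk, map_mk]
  refine mk_eq_of (IsPermutation.swap a b []) ?_
  have : ∀ A B : V, (((A ◁ (λ_ (B ⊗ 𝟙_ V)).inv) ≫ (α_ A (𝟙_ V) (B ⊗ 𝟙_ V)).inv) ≫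
      (𝟙 (A ⊗ 𝟙_ V) ⊗ₘ 𝟙 (B ⊗ 𝟙_ V))) ≫ (β_ (A ⊗ 𝟙_ V) (B ⊗ 𝟙_ V)).hom =
      swapFirst A B (𝟙_ V) ≫ ((B ◁ (λ_ (A ⊗ 𝟙_ V)).inv) ≫ (α_ B (𝟙_ V) (A ⊗ 𝟙_ V)).inv) ≫
      (𝟙 (B ⊗ 𝟙_ V) ⊗ₘ 𝟙 (A ⊗ 𝟙_ V)) := by
    intro A B
    rw [id_tensorHom_id, id_tensorHom_id, Category.comp_id, Category.comp_id]
    have h := BraidedCategory.braiding_naturality (ρ_ A).hom (ρ_ B).hom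
    rw [← cancel_mono ((ρ_ B).hom ⊗ₘ (ρ_ A).hom), Category.assoc, ← h, swapFirst]
    have h1 : ∀ X Y : V, ((X ◁ (λ_ (Y ⊗ 𝟙_ V)).inv) ≫ (α_ X (𝟙_ V) (Y ⊗ 𝟙_ V)).inv) ≫
        ((ρ_ X).hom ⊗ₘ (ρ_ Y).hom) = (α_ X Y (𝟙_ V)).inv ≫ (ρ_ (X ⊗ Y)).hom := by
      intro X Y
      monoidal
    simp only [Category.assoc] at h1 ⊢
    rw [reassoc_of% h1, h1, Iso.hom_inv_id_assoc, rightUnitor_naturality]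
  exact this _ _

/-- Every generalized element is the image of the identity of a word, and words are tensor products
of letters. Commuting passes to tensor products and images, so letters suffice. -/
theorem commute {X Y : V} (x : GenElem X) (y : GenElem Y) : Commute x y := by
  have h1 : ∀ (a : ℕ × V) (l : List (ℕ × V)),
      Commute (mk [a] (𝟙 (tensorWord [a]))) (mk l (𝟙 (tensorWord l))) := by
    intro a l
    induction l with
    | nil => exact Commute.one_right _
    | cons b l ih =>
      rw [mk_cons b l]
      exact ((Commute.mk_singleton a b).tens_right ih).map_right _
  have h2 : ∀ (l m : List (ℕ × V)),
      Commute (mk l (𝟙 (tensorWord l))) (mk m (𝟙 (tensorWord m))) := by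
    intro l m
    induction l with
    | nil => exact (Commute.one_right _).symm
    | cons b l ih =>
      rw [mk_cons]
      exact ((((h1 b m).symm).tens_right ih.symm).map_right _).symm
  induction x using ind with | h l a =>
  induction y using ind with | h m b =>
  have h3 := ((((h2 l m).map_right b).symm).map_right a).symm
  rwa [map_mk, map_mk, Category.id_comp, Category.id_comp] at h3

theorem map_braiding_hom {X Y : V} (x : GenElem X) (y : GenElem Y) :
    map (β_ X Y).hom (tens x y) = tens y x := commute x y

theorem map_rightUnitor_inv {X : V} (x : GenElem X) : map (ρ_ X).inv x = tens x one := by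
  rw [← map_braiding_hom, ← map_leftUnitor_inv, ← map_comp]
  congr 1
  rw [braiding_tensorUnit_left]
  simp

theorem map_tensorμ {A B C D : V} (a : GenElem A) (b : GenElem B) (c : GenElem C)
    (d : GenElem D) :
    map (tensorμ A B C D) (tens (tens a b) (tens c d)) = tens (tens a c) (tens b d) := by
  unfold tensorμ
  simp only [map_comp]
  rw [map_associator_hom, map_whiskerLeft, map_associator_inv, map_whiskerLeft, map_whiskerRight,
    map_braiding_hom, map_whiskerLeft, map_associator_hom, map_associator_inv]

end GenElem

end Coherence

/-! ### Families of generalized elements under the canonical maps of tensor products -/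

section Tuples

variable {V : Type u'} [Category.{v'} V] [MonoidalCategory V] [SymmetricCategory V]

namespace GenElem

variable {ι κ : Type*}

/-- The generalized element of a tensor product given by a family of generalized elements. -/
def tuple {A : ι → V} (x : ∀ i, GenElem (A i)) : ∀ l : List ι, GenElem (tensorList A l)
  | [] => one
  | a :: l => tens (x a) (tuple x l)

theorem tuple_congr {A : ι → V} {x y : ∀ i, GenElem (A i)} :
    ∀ {l : List ι}, (∀ i ∈ l, x i = y i) → tuple x l = tuple y l
  | [], _ => rfl
  | a :: l, h => by
    change tens (x a) (tuple x l) = tens (y a) (tuple y l)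
    rw [h a List.mem_cons_self, tuple_congr fun i hi => h i (List.mem_cons_of_mem a hi)]

theorem map_tensorListMap {A B : ι → V} (φ : ∀ i, A i ⟶ B i) (x : ∀ i, GenElem (A i)) :
    ∀ l : List ι, map (tensorList.map φ l) (tuple x l) = tuple (fun i => map (φ i) (x i)) l
  | [] => map_id _
  | a :: l => by
    change map (φ a ⊗ₘ tensorList.map φ l) (tens (x a) (tuple x l)) = tens _ _
    rw [map_tensorHom, map_tensorListMap φ x l]

theorem map_append {A : ι → V} (x : ∀ i, GenElem (A i)) : ∀ l l' : List ι,
    map (tensorList.append A l l') (tens (tuple x l) (tuple x l')) = tuple x (l ++ l')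
  | [], l' => map_leftUnitor_hom _
  | a :: l, l' => by
    change map ((α_ (A a) (tensorList A l) (tensorList A l')).hom ≫
      (A a ◁ tensorList.append A l l')) (tens (tens (x a) (tuple x l)) (tuple x l')) =
      tens (x a) (tuple x (l ++ l'))
    rw [map_comp, map_associator_hom, map_whiskerLeft, map_append x l l']

theorem map_flatten {A : ι → V} (x : ∀ i, GenElem (A i)) (m : κ → List ι) : ∀ L : List κ,
    map (tensorList.flatten A m L) (tuple (fun k => tuple x (m k)) L) = tuple x (L.flatMap m)
  | [] => map_id _
  | k :: L => by
    change map ((tensorList A (m k) ◁ tensorList.flatten A m L) ≫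
      tensorList.append A (m k) (L.flatMap m)) (tens (tuple x (m k)) (tuple _ L)) = _
    rw [map_comp, map_whiskerLeft, map_flatten x m L, map_append]
    rfl

theorem map_reindex {A : ι → V} (x : ∀ i, GenElem (A i)) (e : κ → ι) : ∀ l : List κ,
    map (tensorList.reindex A e l) (tuple (fun k => x (e k)) l) = tuple x (l.map e)
  | [] => map_id _
  | k :: l => by
    change map (A (e k) ◁ tensorList.reindex A e l) (tens (x (e k)) (tuple _ l)) =
      tens (x (e k)) (tuple x (l.map e))
    rw [map_whiskerLeft, map_reindex x e l]

theorem map_zip {A B : ι → V} (x : ∀ i, GenElem (A i)) (y : ∀ i, GenElem (B i)) :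
    ∀ l : List ι, map (tensorList.zip A B l) (tens (tuple x l) (tuple y l)) =
      tuple (A := fun i => A i ⊗ B i) (fun i => tens (x i) (y i)) l
  | [] => map_leftUnitor_hom _
  | a :: l => by
    change map (tensorμ (A a) (tensorList A l) (B a) (tensorList B l) ≫
      ((A a ⊗ B a) ◁ tensorList.zip A B l)) (tens (tens (x a) (tuple x l))
        (tens (y a) (tuple y l))) = tens (tens (x a) (y a)) (tuple _ l)
    rw [map_comp, map_tensorμ, map_whiskerLeft, map_zip x y l]

theorem map_eqToHom_tuple {A : ι → V} (x : ∀ i, GenElem (A i)) {l l' : List ι} (h : l = l')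
    (h' : tensorList A l = tensorList A l') : map (eqToHom h') (tuple x l) = tuple x l' := by
  subst h
  exact map_id _

theorem map_eqToHom_tens_tuple {A : ι → V} (x : ∀ i, GenElem (A i)) (a : ι) {l l' : List ι}
    (h : l = l') (h' : A a ⊗ tensorList A l = A a ⊗ tensorList A l') :
    map (eqToHom h') (tens (x a) (tuple x l)) = tens (x a) (tuple x l') := by
  subst h
  exact map_id _

/-- Since the symmetry exchanges generalized elements, moving a factor has no effect on a tuple
other than the change of order. -/
theorem map_pull [DecidableEq ι] {A : ι → V} (x : ∀ i, GenElem (A i)) (i : ι) :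
    ∀ (l : List ι) (h : i ∈ l),
      map (tensorList.pull A i l h).hom (tuple x l) = tens (x i) (tuple x (l.erase i))
  | [], h => absurd h List.not_mem_nil
  | a :: l, h => by
    by_cases ha : a = i
    · subst ha
      unfold tensorList.pull
      rw [dif_pos rfl]
      exact map_eqToHom_tens_tuple x a (List.erase_cons_head a l).symm
        (by rw [List.erase_cons_head])
    · have ih := map_pull x i l ((List.mem_cons.1 h).resolve_left (Ne.symm ha))
      unfold tensorList.pull
      rw [dif_neg ha]
      change map ((A a ◁ (tensorList.pull A i l
          ((List.mem_cons.1 h).resolve_left (Ne.symm ha))).hom) ≫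
        (α_ (A a) (A i) (tensorList A (l.erase i))).inv ≫
        ((β_ (A a) (A i)).hom ▷ (tensorList A (l.erase i))) ≫
        (α_ (A i) (A a) (tensorList A (l.erase i))).hom ≫
        eqToHom (by rw [List.erase_cons_tail (by simpa using ha)]; rfl))
        (tens (x a) (tuple x l)) = _
      simp only [map_comp]
      rw [map_whiskerLeft, ih, map_associator_inv, map_whiskerRight, map_braiding_hom,
        map_associator_hom]
      exact map_eqToHom_tens_tuple x i (l := a :: l.erase i)
        (List.erase_cons_tail (by simpa using ha)).symm _

theorem map_pull_inv [DecidableEq ι] {A : ι → V} (x : ∀ i, GenElem (A i)) (i : ι)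
    (l : List ι) (h : i ∈ l) :
    map (tensorList.pull A i l h).inv (tens (x i) (tuple x (l.erase i))) = tuple x l := by
  rw [← map_pull x i l h, ← map_comp, Iso.hom_inv_id, map_id]

theorem map_reorder [DecidableEq ι] {A : ι → V} (x : ∀ i, GenElem (A i)) :
    ∀ (l l' : List ι) (h : l.Perm l'),
      map (tensorList.reorder A l l' h).hom (tuple x l) = tuple x l'
  | [], _, h => map_eqToHom_tuple x (List.nil_perm.1 h).symm (by rw [List.nil_perm.1 h])
  | a :: l, l', h => by
    change map ((A a ◁ (tensorList.reorder A l (l'.erase a) _).hom) ≫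
      (tensorList.pull A a l' _).inv) (tens (x a) (tuple x l)) = _
    rw [map_comp, map_whiskerLeft, map_reorder x l, map_pull_inv]

theorem map_ofUnits {A : ι → V} (x : ∀ i, GenElem (A i)) :
    ∀ (l : List ι) (e : ∀ j ∈ l, 𝟙_ V ⟶ A j), (∀ j hj, map (e j hj) one = x j) →
      map (tensorList.ofUnits A l e) one = tuple x l
  | [], _, _ => map_id _
  | a :: l, e, h => by
    change map ((λ_ (𝟙_ V)).inv ≫ (e a List.mem_cons_self ⊗ₘ tensorList.ofUnits A l _)) one =
      tens (x a) (tuple x l)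
    rw [map_comp, map_leftUnitor_inv, map_tensorHom, h, map_ofUnits x l]
    intro j hj
    exact h j _

theorem map_insertUnits [DecidableEq ι] {A : ι → V} (x : ∀ i, GenElem (A i)) (l : List ι)
    (hl : l.Nodup) (i : ι) (hi : i ∈ l) (e : ∀ j, j ≠ i → (𝟙_ V ⟶ A j))
    (h : ∀ j hj, map (e j hj) one = x j) :
    map (tensorList.insertUnits A l hl i hi e) (x i) = tuple x l := by
  unfold tensorList.insertUnits
  rw [map_comp, map_comp, map_rightUnitor_inv, map_whiskerLeft, map_ofUnits x, map_pull_inv]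
  intro j hj
  exact h j _

/-! ### Detection of morphisms -/

/-- A generalized element that is given by an isomorphism, with distinct labels in `[m, n)`. -/
def IsGeneric {X : V} (m n : ℕ) (x : GenElem X) : Prop :=
  ∃ (l : List (ℕ × V)) (f : tensorWord l ⟶ X), x = mk l f ∧ IsIso f ∧ l.Nodup ∧
    ∀ a ∈ l, m ≤ a.1 ∧ a.1 < n

/-- A generic element is a universal one: distinct labels recover the two composites, and the
isomorphism is cancelled. -/
theorem IsGeneric.eq_of_map_eq {X Y : V} {m n : ℕ} {x : GenElem X} (h : IsGeneric m n x)
    {f g : X ⟶ Y} (hfg : map f x = map g x) : f = g := by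
  obtain ⟨l, a, rfl, ha, hl, -⟩ := h
  rw [map_mk, map_mk] at hfg
  exact (cancel_epi a).1 (mk_injective hl hfg)

/-- Labels from the adjacent intervals `[m, n)` and `[n, k)` cannot collide, so the concatenated
word still has distinct labels. -/
theorem IsGeneric.tens {X Y : V} {m n k : ℕ} {x : GenElem X} {y : GenElem Y} (hmn : m ≤ n)
    (hnk : n ≤ k) (hx : IsGeneric m n x) (hy : IsGeneric n k y) : IsGeneric m k (tens x y) := by
  obtain ⟨l, a, rfl, ha, hl, hl'⟩ := hx
  obtain ⟨r, b, rfl, hb, hr, hr'⟩ := hy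
  have := tensorWord.isIso_split l r
  refine ⟨l ++ r, _, tens_mk _ _ _ _, inferInstance, List.nodup_append.2 ⟨hl, hr, ?_⟩, ?_⟩
  · rintro c hc _ hd rfl
    have := hl' c hc
    have := hr' c hd
    omega
  · intro c hc
    rcases List.mem_append.1 hc with hc | hc
    · have := hl' c hc
      omega
    · have := hr' c hc
      omega

/-- A set of generalized elements that contains sufficiently many generic ones to detect
equalities of morphisms, also after tensoring. -/
def Detects {X : V} (D : Set (GenElem X)) : Prop :=
  ∀ m, ∃ n, m ≤ n ∧ ∃ x ∈ D, IsGeneric m n x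

theorem Detects.hom_ext {X Y : V} {D : Set (GenElem X)} (hD : Detects D) {f g : X ⟶ Y}
    (h : ∀ x ∈ D, map f x = map g x) : f = g := by
  obtain ⟨n, -, x, hx, hx'⟩ := hD 0
  exact hx'.eq_of_map_eq (h x hx)

/-- The generic element is the one-letter word `X` with the label `m`. -/
theorem Detects.of_forall {X : V} {D : Set (GenElem X)} (hD : ∀ x, x ∈ D) : Detects D := by
  intro m
  refine ⟨m + 1, Nat.le_succ m, _, hD _, [(m, X)], (ρ_ X).hom, rfl,
    inferInstanceAs (IsIso (ρ_ X).hom), List.nodup_singleton _, ?_⟩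
  intro a ha
  rw [List.mem_singleton.1 ha]
  exact ⟨le_rfl, Nat.lt_succ_self m⟩

/-- If the unit is invertible, it is itself generic, on the empty word. This is how
`1`-connectedness permits discarding all other elements over local terminal objects. -/
theorem Detects.of_isIso {X : V} {D : Set (GenElem X)} (η : 𝟙_ V ⟶ X) [IsIso η]
    (hD : map η one ∈ D) : Detects D := by
  intro m
  exact ⟨m, le_rfl, _, hD, [], 𝟙 (𝟙_ V) ≫ η, rfl, inferInstanceAs (IsIso (𝟙 (𝟙_ V) ≫ η)),
    List.nodup_nil, by simp⟩

theorem Detects.tens {X Y : V} {D : Set (GenElem X)} {E : Set (GenElem Y)} (hD : Detects D)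
    (hE : Detects E) : Detects {z | ∃ x ∈ D, ∃ y ∈ E, z = GenElem.tens x y} := by
  intro m
  obtain ⟨n, hn, x, hx, hx'⟩ := hD m
  obtain ⟨k, hk, y, hy, hy'⟩ := hE n
  exact ⟨k, hn.trans hk, _, ⟨x, hx, y, hy, rfl⟩, hx'.tens hn hk hy'⟩

theorem Detects.tuple [DecidableEq ι] {A : ι → V} {D : ∀ i, Set (GenElem (A i))}
    (hD : ∀ i, Detects (D i)) : ∀ {l : List ι}, l.Nodup →
      Detects {z | ∃ x : ∀ i, GenElem (A i), (∀ i, x i ∈ D i) ∧ z = GenElem.tuple x l}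
  | [], _ => by
    intro m
    -- The family must have values at all indices, also outside the list, so each `D i` has to be
    -- inhabited.
    choose n hn x hx hx' using fun i => hD i 0
    exact ⟨m, le_rfl, _, ⟨x, hx, rfl⟩, [], 𝟙 (𝟙_ V), rfl, inferInstanceAs (IsIso (𝟙 (𝟙_ V))),
      List.nodup_nil, by simp⟩
  | a :: l, hl => by
    intro m
    obtain ⟨n, hn, y, hy, hy'⟩ := hD a m
    obtain ⟨k, hk, _, ⟨x, hx, rfl⟩, hx'⟩ := Detects.tuple hD (List.nodup_cons.1 hl).2 n
    -- As `a` does not occur in `l`, prescribing the entry at `a` leaves the rest of the tuple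
    -- unchanged.
    have h : GenElem.tuple (Function.update x a y) l = GenElem.tuple x l :=
      tuple_congr fun i hi => Function.update_of_ne
        (by rintro rfl; exact (List.nodup_cons.1 hl).1 hi) _ _
    refine ⟨k, hn.trans hk, _, ⟨Function.update x a y, ?_, rfl⟩, ?_⟩
    · intro i
      by_cases hi : i = a
      · subst hi; rwa [Function.update_self]
      · rw [Function.update_of_ne hi]; exact hx i
    · change IsGeneric m k (GenElem.tens (Function.update x a y a)
        (GenElem.tuple (Function.update x a y) l))
      rw [h, Function.update_self]
      exact hy'.tens hn hk hx'

theorem hom_ext {X Y : V} {f g : X ⟶ Y} (h : ∀ x, map f x = map g x) : f = g :=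
  (Detects.of_forall (D := Set.univ) fun _ => trivial).hom_ext fun x _ => h x

theorem hom_ext_one {X : V} {f g : 𝟙_ V ⟶ X} (h : map f one = map g one) : f = g :=
  (Detects.of_isIso (D := {one}) (𝟙 (𝟙_ V)) (map_id _)).hom_ext fun _ hx => by
    rw [Set.mem_singleton_iff.1 hx, h]

theorem hom_ext_tens {X Y Z : V} {f g : X ⊗ Y ⟶ Z}
    (h : ∀ x y, map f (tens x y) = map g (tens x y)) : f = g := by
  refine ((Detects.of_forall (D := Set.univ) fun _ => trivial).tens
    (Detects.of_forall (D := Set.univ) fun _ => trivial)).hom_ext ?_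
  rintro _ ⟨x, -, y, -, rfl⟩
  exact h x y

theorem hom_ext_tens₃ {X Y Z W : V} {f g : (X ⊗ Y) ⊗ Z ⟶ W}
    (h : ∀ x y z, map f (tens (tens x y) z) = map g (tens (tens x y) z)) : f = g := by
  have h1 : (α_ X Y Z).inv ≫ f = (α_ X Y Z).inv ≫ g := by
    refine ((Detects.of_forall (D := Set.univ) fun _ => trivial).tens
      ((Detects.of_forall (D := Set.univ) fun _ => trivial).tens
      (Detects.of_forall (D := Set.univ) fun _ => trivial))).hom_ext ?_
    rintro _ ⟨x, -, _, ⟨y, -, z, -, rfl⟩, rfl⟩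
    rw [map_comp, map_comp, map_associator_inv, h]
  exact (cancel_epi _).1 h1

end GenElem

end Tuples

/-! ### Families of sets with composition operations -/

section Compositions

variable {O : Type u}

/-- Transport of elements along an equality of objects. -/
def transport (X : O → Type w) {T S : O} (h : T = S) (x : X T) : X S := h ▸ x

variable {X : O → Type w}

theorem transport_heq {T S : O} (h : T = S) (x : X T) : HEq (transport X h x) x := by
  subst h
  rfl

@[simp]
theorem transport_rfl {T : O} (x : X T) : transport X rfl x = x := rfl

@[simp]
theorem transport_transport {T S R : O} (h : T = S) (h' : S = R) (x : X T) :
    transport X h' (transport X h x) = transport X (h.trans h') x := by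
  subst h h'
  rfl

variable [Category.{v} O] [OperadicCategory O]

/-- Both sides enumerate the same subset of `|S|` in increasing order, and such an enumeration is
unique. Positions are compared by value because the two fibers are equal only propositionally. -/
theorem incl_incl {S R Q : O} (g : S ⟶ R) (k : R ⟶ Q) (m : S ⟶ Q) (hm : g ≫ k = m)
    (q : Fin (card Q)) (r : Fin (card (fiber k q))) (s : Fin (card (fiber g (incl k q r))))
    (s' : Fin (card (fiber (fiberMap g k m hm q) r))) (hs : s.val = s'.val) :
    incl g (incl k q r) s = incl m q (incl (fiberMap g k m hm q) r s') := by
  have hc : card (fiber g (incl k q r)) = card (fiber (fiberMap g k m hm q) r) := by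
    rw [fiber_fiberMap g k m hm q r]
  have h := Finset.orderEmbOfFin_unique (card_fiber g (incl k q r))
    (f := fun s => incl m q (incl (fiberMap g k m hm q) r (Fin.cast hc s))) (by
      intro x
      rw [Finset.mem_filter]
      refine ⟨Finset.mem_univ _, ?_⟩
      rw [← incl_cardMap_fiberMap g k m hm, cardMap_incl]) (by
      intro x y hxy
      exact (incl m q).strictMono ((incl (fiberMap g k m hm q) r).strictMono hxy))
  have h1 := congrFun h s
  have h2 : s' = Fin.cast hc s := Fin.ext hs.symm
  rw [h2]
  exact h1.symm

/-- The restriction of a family indexed by the fibers of `f` to the fibers of `f_i`. -/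
noncomputable def restrict {T S R : O} (f : T ⟶ S) (g : S ⟶ R) (h : T ⟶ R) (w : f ≫ g = h)
    (x : ∀ j, X (fiber f j)) (i : Fin (card R)) (a : Fin (card (fiber g i))) :
    X (fiber (fiberMap f g h w i) a) :=
  transport X (fiber_fiberMap f g h w i a) (x (incl g i a))

/-- The fibers of `|g|` partition `|S|`, so families over the fibers of the various `f_i` glue to
one over the fibers of `f`. -/
theorem exists_restrict_eq {T S R : O} (f : T ⟶ S) (g : S ⟶ R) (h : T ⟶ R) (w : f ≫ g = h)
    (x' : ∀ i a, X (fiber (fiberMap f g h w i) a)) :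
    ∃ x : ∀ j, X (fiber f j), ∀ i, restrict f g h w x i = x' i := by
  choose a ha using exists_incl_eq g
  refine ⟨fun j => transport X ((fiber_fiberMap f g h w (cardMap g j) (a j)).symm.trans
    (congrArg (fiber f) (ha j))) (x' (cardMap g j) (a j)), fun i => ?_⟩
  have key : ∀ i i' b b', incl g i b = incl g i' b' → HEq (x' i b) (x' i' b') := by
    intro i i' b b' hb
    have h1 : i = i' := by rw [← cardMap_incl g i b, hb, cardMap_incl]
    subst h1
    have h2 := (incl g i).injective hb
    subst h2
    rfl
  funext b
  unfold restrict
  rw [transport_transport]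
  exact eq_of_heq ((transport_heq _ _).trans (key _ _ _ _ (ha _)))

variable (X) in
/-- Composition operations on a family of sets. -/
def SetComposition := ∀ ⦃T S : O⦄ (f : T ⟶ S), (∀ i, X (fiber f i)) → X S → X T

variable (γ : SetComposition X)

/-- The axiom `f_j = (f_i)_j` holds up to `eqToHom`; this lets `γ` be carried across it. -/
theorem SetComposition.heq_congr {T T' S S' : O} (hT : T = T') (hS : S = S') (f : T ⟶ S)
    (f' : T' ⟶ S') (hf : f = eqToHom hT ≫ f' ≫ eqToHom hS.symm) (x : ∀ i, X (fiber f i))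
    (x' : ∀ i, X (fiber f' i)) (hx : ∀ i i', i.val = i'.val → HEq (x i) (x' i')) (y : X S)
    (y' : X S') (hy : HEq y y') : HEq (γ f x y) (γ f' x' y') := by
  subst hT hS
  have hf' : f = f' := by simpa using hf
  subst hf'
  have hx' : x = x' := funext fun i => eq_of_heq (hx i i rfl)
  rw [hx', eq_of_heq hy]

/-- Associativity for a pair of composable morphisms. -/
def SetComposition.AssocAt {T S R : O} (f : T ⟶ S) (g : S ⟶ R) (h : T ⟶ R) (w : f ≫ g = h) : Prop :=
  ∀ x y z, γ f x (γ g y z) =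
    γ h (fun i => γ (fiberMap f g h w i) (restrict f g h w x i) (y i)) z

/-- Fiberwise composition commutes with passing to the fibers over a point of `|Q|`. The reasons are
`f_j = (f_i)_j` and the compatibility `incl_incl` of iterated fibers. -/
theorem SetComposition.restrict_comp {T S R Q : O} (f : T ⟶ S) (g : S ⟶ R) (k : R ⟶ Q)
    (h : T ⟶ R) (m : S ⟶ Q) (n : T ⟶ Q) (hh : f ≫ g = h) (hm : g ≫ k = m) (hn : h ≫ k = n)
    (hf : f ≫ m = n) (x : ∀ j, X (fiber f j)) (y : ∀ j, X (fiber g j)) (q : Fin (card Q)) :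
    restrict h k n hn (fun r => γ (fiberMap f g h hh r) (restrict f g h hh x r) (y r)) q =
      fun r => γ (fiberMap (fiberMap f m n hf q) (fiberMap g k m hm q) (fiberMap h k n hn q)
          (fiberMap_comp f g h k m n hh hm hn hf q) r)
        (restrict _ _ _ _ (restrict f m n hf x q) r) (restrict g k m hm y q r) := by
  funext r
  unfold restrict
  apply eq_of_heq
  refine (transport_heq _ _).trans ?_
  refine γ.heq_congr (fiber_fiberMap h k n hn q r) (fiber_fiberMap g k m hm q r) _ _
    (fiberMap_fiberMap f g h k m n hh hm hn hf q r) _ _ ?_ _ _ (transport_heq _ _).symm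
  intro i i' hi
  refine (transport_heq _ _).trans (HEq.trans ?_ (transport_heq _ _).symm)
  refine HEq.trans ?_ (transport_heq _ _).symm
  rw [incl_incl g k m hm q r i i' hi]

variable {γ}

/-- A pentagon argument. By `hs` every family over the fibers of `h` is a fiberwise composite, so a
composition along `h` may be expanded into one along `f` and `g`. Reassociating on the right and
then along `f` and `m` leaves a comparison over each point of `|Q|`, which is `h4`. -/
theorem SetComposition.AssocAt.comp_left {T S R Q : O} {f : T ⟶ S} {g : S ⟶ R} {k : R ⟶ Q}
    {h : T ⟶ R} {m : S ⟶ Q} {n : T ⟶ Q} {hh : f ≫ g = h} {hm : g ≫ k = m} {hn : h ≫ k = n}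
    {hf : f ≫ m = n} (h1 : γ.AssocAt f g h hh) (h2 : γ.AssocAt g k m hm)
    (h3 : γ.AssocAt f m n hf) (h4 : ∀ q, γ.AssocAt (fiberMap f m n hf q) (fiberMap g k m hm q)
      (fiberMap h k n hn q) (fiberMap_comp f g h k m n hh hm hn hf q))
    (hs : ∀ r (v : X (fiber h r)), ∃ x y, γ (fiberMap f g h hh r) x y = v) :
    γ.AssocAt h k n hn := by
  intro v u z
  choose x' y hx using fun r => hs r (v r)
  obtain ⟨x, hx'⟩ := exists_restrict_eq f g h hh x'
  have hv : v = fun r => γ (fiberMap f g h hh r) (restrict f g h hh x r) (y r) := by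
    funext r
    rw [hx', hx]
  rw [hv, ← h1, h2, h3]
  congr 1
  funext q
  rw [h4, γ.restrict_comp f g k h m n hh hm hn hf]

/-- The same pentagon, solved for the pair `(f, m)`; now the elements over the fibers of `m` are
decomposed along the maps induced by `g`. -/
theorem SetComposition.AssocAt.comp_right {T S R Q : O} {f : T ⟶ S} {g : S ⟶ R} {k : R ⟶ Q}
    {h : T ⟶ R} {m : S ⟶ Q} {n : T ⟶ Q} {hh : f ≫ g = h} {hm : g ≫ k = m} {hn : h ≫ k = n}
    {hf : f ≫ m = n} (h1 : γ.AssocAt f g h hh) (h2 : γ.AssocAt g k m hm)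
    (h3 : γ.AssocAt h k n hn) (h4 : ∀ q, γ.AssocAt (fiberMap f m n hf q) (fiberMap g k m hm q)
      (fiberMap h k n hn q) (fiberMap_comp f g h k m n hh hm hn hf q))
    (hs : ∀ q (v : X (fiber m q)), ∃ x y, γ (fiberMap g k m hm q) x y = v) :
    γ.AssocAt f m n hf := by
  intro x v z
  choose y' u hy using fun q => hs q (v q)
  obtain ⟨y, hy'⟩ := exists_restrict_eq g k m hm y'
  have hv : v = fun q => γ (fiberMap g k m hm q) (restrict g k m hm y q) (u q) := by
    funext q
    rw [hy', hy]
  rw [hv, ← h2, h1, h3]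
  congr 1
  funext q
  rw [h4, γ.restrict_comp f g k h m n hh hm hn hf]

end Compositions

/-! ### Factorizations in operadic categories -/

namespace OperadicCategory

section Factorizations

variable {O : Type u} [Category.{v} O] [OperadicCategory O]

theorem fiberMap_eq_of_eq {T S R : O} (f : T ⟶ S) (g : S ⟶ R) {h h' : T ⟶ R} (w : f ≫ g = h)
    (w' : f ≫ g = h') {i i' : Fin (card R)} (hi : i = i') :
    fiberMap f g h w i = eqToHom (by rw [← w, ← w', hi]) ≫ fiberMap f g h' w' i' ≫
      eqToHom (by rw [hi]) := by
  subst hi w w'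
  simp

theorem fiberMap_eqToHom {T S R : O} (e : T = S) (g : S ⟶ R) (h : T ⟶ R)
    (w : eqToHom e ≫ g = h) (i : Fin (card R)) :
    ∃ e', fiberMap (eqToHom e) g h w i = eqToHom e' := by
  subst e w
  have hw : eqToHom rfl ≫ g = g := by simp
  refine ⟨by rw [hw], ?_⟩
  rw [fiberMap_eq_of_eq (eqToHom rfl) g rfl hw rfl]
  have : fiberMap (𝟙 T) g g (Category.id_comp g) i = 𝟙 _ :=
    (congrArg _ (by ext; rfl)).trans ((fiberFunctor R i).map_id (Over.mk g))
  change eqToHom _ ≫ fiberMap (𝟙 T) g g _ i ≫ _ = _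
  rw [this]
  simp

instance isIso_fiberMap {T S R : O} (f : T ⟶ S) [IsIso f] (g : S ⟶ R) (h : T ⟶ R)
    (w : f ≫ g = h) (i : Fin (card R)) : IsIso (fiberMap f g h w i) :=
  inferInstanceAs (IsIso (fiberIso (asIso f) g h w i).hom)

theorem isTrivial_fiber_eqToHom {T S : O} (e : T = S) : IsQuasiBijection (eqToHom e) := by
  subst e
  exact isQuasiBijection_id T

omit [OperadicCategory O] in
theorem nonempty_iso_of_isLocalTerminal {T s t : O} (f : T ⟶ s) (g : T ⟶ t)
    (hs : IsLocalTerminal s) (ht : IsLocalTerminal t) : ∃ a : s ≅ t, f ≫ a.hom = g := by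
  obtain ⟨a⟩ := ht s ((Zigzag.of_inv f).trans (Zigzag.of_hom g))
  obtain ⟨b⟩ := hs t ((Zigzag.of_inv g).trans (Zigzag.of_hom f))
  obtain ⟨a'⟩ := ht t (Zigzag.refl _)
  obtain ⟨b'⟩ := hs s (Zigzag.refl _)
  obtain ⟨c⟩ := ht T (Zigzag.of_hom g)
  exact ⟨⟨a.default, b.default, (b'.uniq _).trans (b'.uniq _).symm,
    (a'.uniq _).trans (a'.uniq _).symm⟩, (c.uniq _).trans (c.uniq _).symm⟩

variable (O) in
/-- For each object a trivial object to which it maps. -/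
theorem exists_hom_trivial (T : O) : ∃ (U : O) (_ : T ⟶ U), IsTrivial U := by
  have hz : Zigzag T (chosen (component T)) :=
    Quotient.exact (s := Zigzag.setoid O) (component_chosen (component T)).symm
  obtain ⟨a⟩ := chosen_isLocalTerminal (component T) T hz
  exact ⟨_, a.default, _, rfl⟩

/-- The blow up axiom for `σ = 𝟙`: maps out of the fibers of an order preserving `h` are induced by
a factorization of `h`. -/
theorem blowUp_id_exists (hSBU : BlowUp O) {T R : O} (h : T ⟶ R) (hh : IsOrderPreserving h)
    (G : Fin (card R) → O) (p : ∀ k, fiber h k ⟶ G k) :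
    ∃ (S : O) (f : T ⟶ S) (g : S ⟶ R) (w : f ≫ g = h) (hG : ∀ k, fiber g k = G k),
      IsOrderPreserving g ∧ ∀ k, fiberMap f g h w k = p k ≫ eqToHom (hG k).symm := by
  obtain ⟨⟨S, f, g⟩, ⟨hg, w, hG, hp⟩, -⟩ := hSBU h (𝟙 R) hh (isQuasiBijection_id R) G
    (fun i => p i ≫ eqToHom (congrArg G (cardMap_id R i).symm))
  dsimp only at hg w hG hp
  have w' : f ≫ g = h := by rw [w, Category.comp_id]
  refine ⟨S, f, g, w', hG, hg, fun k => ?_⟩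
  have h1 := hp k
  unfold derived at h1
  rw [fiberMap_eq_of_eq f g w w' (cardMap_id R k)] at h1
  have h2 := congrArg (fun a => a ≫ eqToHom (congrArg G (cardMap_id R k)) ≫ eqToHom (hG k).symm) h1
  simpa using h2

theorem blowUp_id_unique (hSBU : BlowUp O) {T R : O} (h : T ⟶ R) (hh : IsOrderPreserving h)
    {S S' : O} (f : T ⟶ S) (g : S ⟶ R) (w : f ≫ g = h) (f' : T ⟶ S') (g' : S' ⟶ R)
    (w' : f' ≫ g' = h) (hg : IsOrderPreserving g) (hg' : IsOrderPreserving g')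
    (hG : ∀ k, fiber g k = fiber g' k)
    (hp : ∀ k, fiberMap f g h w k ≫ eqToHom (hG k) = fiberMap f' g' h w' k) :
    ∃ e : S = S', f ≫ eqToHom e = f' ∧ eqToHom e ≫ g' = g := by
  have hu := (hSBU h (𝟙 R) hh (isQuasiBijection_id R) (fiber g')
    (fun i => fiberMap f' g' h w' i ≫
      eqToHom (congrArg (fiber g') (cardMap_id R i).symm))).unique
    (y₁ := ⟨S, f, g⟩) (y₂ := ⟨S', f', g'⟩)
    ⟨hg, by rw [w, Category.comp_id], hG, fun i => ?_⟩
    ⟨hg', by rw [w', Category.comp_id], fun _ => rfl, fun i => ?_⟩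
  · cases hu
    exact ⟨rfl, by simp, by simp⟩
  · unfold derived
    dsimp only
    rw [fiberMap_eq_of_eq f g _ w (cardMap_id R i), ← hp]
    simp
  · unfold derived
    dsimp only
    rw [fiberMap_eq_of_eq f' g' _ w' (cardMap_id R i)]
    simp

variable {e : Grading O}

theorem Grading.grade_eq_of_iso {T S : O} (f : T ⟶ S) [IsIso f] : e.grade T = e.grade S :=
  le_antisymm (Grading.grade_le (inv f)) (Grading.grade_le f)

theorem Grading.grade_fiber_eq_zero {T S : O} (f : T ⟶ S) [IsIso f] (i : Fin (card S)) :
    e.grade (fiber f i) = 0 :=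
  Grading.grade_localTerminal (fiber_isLocalTerminal (asIso f) i)

theorem Grading.exists_fiber_of_lt {T S : O} (f : T ⟶ S) (h : e.grade S < e.grade T) :
    ∃ q, 1 ≤ e.grade (fiber f q) := by
  by_contra! hc
  have h1 := e.grade_add f
  rw [Finset.sum_eq_zero fun i _ => Nat.lt_one_iff.1 (hc i)] at h1
  omega

variable (he : ∀ {S T : O} (f : S ⟶ T), IsIso f ↔ e.gradeHom f = 0)

include he in
theorem isIso_of_grade_eq {T S : O} (f : T ⟶ S) (h : e.grade T = e.grade S) : IsIso f :=
  (he f).2 (by unfold Grading.gradeHom; omega)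

include he in
theorem isIso_of_grade_fiber {T S : O} (f : T ⟶ S) (h : ∀ i, e.grade (fiber f i) = 0) :
    IsIso f := by
  refine isIso_of_grade_eq he f ?_
  have h1 := e.grade_add f
  rw [Finset.sum_eq_zero fun i _ => h i] at h1
  omega

-- An object of grade `0` maps to a trivial one, also of grade `0`; by the hypothesis on the grading
-- this map is invertible.
include he in
theorem isLocalTerminal_of_grade {T : O} (h : e.grade T = 0) : IsLocalTerminal T := by
  obtain ⟨U, f, hU⟩ := exists_hom_trivial O T
  have := isIso_of_grade_eq he f (by rw [h, Grading.grade_trivial hU])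
  exact isLocalTerminal_of_iso (asIso f) hU.isLocalTerminal

/-- Any morphism factors through prescribed maps of its fibers. -/
theorem exists_factorization (hFac : Factorizable O) (hSBU : BlowUp O)
    (hQBI : QuasiBijectionsInvertible O) {T R : O} (h : T ⟶ R) (G : Fin (card R) → O)
    (p : ∀ k, fiber h k ⟶ G k) :
    ∃ (S : O) (f : T ⟶ S) (g : S ⟶ R) (w : f ≫ g = h) (hG : ∀ k, fiber g k = G k),
      IsOrderPreserving g ∧ ∀ k, fiberMap f g h w k = p k ≫ eqToHom (hG k).symm := by
  obtain ⟨X, σ, φ, hσ, hφ, rfl⟩ := hFac h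
  have := hQBI σ hσ
  obtain ⟨S, f, g, w, hG, hg, hp⟩ := blowUp_id_exists hSBU φ hφ G
    (fun k => inv (fiberMap σ φ _ rfl k) ≫ p k)
  refine ⟨S, σ ≫ f, g, by rw [Category.assoc, w], hG, hg, fun k => ?_⟩
  rw [← fiberMap_comp σ f (σ ≫ f) g φ (σ ≫ φ) rfl w (by rw [Category.assoc, w]) rfl k, hp]
  simp

include he in
/-- Factorizations of a morphism are determined up to isomorphism by the maps of fibers. -/
theorem factorization_unique (hFac : Factorizable O) (hSBU : BlowUp O)
    (hQBI : QuasiBijectionsInvertible O) {T S S' R : O} (f : T ⟶ S) (g : S ⟶ R) (f' : T ⟶ S')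
    (g' : S' ⟶ R) (h : T ⟶ R) (w : f ≫ g = h) (w' : f' ≫ g' = h)
    (hk : ∀ k, ∃ a : fiber g k ⟶ fiber g' k, IsIso a ∧
      fiberMap f g h w k ≫ a = fiberMap f' g' h w' k) :
    ∃ ω : S ⟶ S', IsIso ω ∧ f ≫ ω = f' ∧ ω ≫ g' = g := by
  choose a ha ha' using hk
  obtain ⟨T₁, σ, h₁, hσ, hh₁, wh⟩ := hFac h
  obtain ⟨S₁, τ, g₁, hτ, hg₁, wg⟩ := hFac g
  obtain ⟨S₁', τ', g₁', hτ', hg₁', wg'⟩ := hFac g'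
  have := hQBI σ hσ
  have := hQBI τ hτ
  have := hQBI τ' hτ'
  -- After reduction to order preserving morphisms, `g₁` is blown up along the given isomorphisms,
  -- so that its fibers become equal to those of `g₁'`. The grade does not change, hence `π` is
  -- invertible.
  obtain ⟨S₂, π, g₂, w₂, hG, hg₂, hp⟩ := blowUp_id_exists hSBU g₁ hg₁ (fiber g₁')
    (fun k => inv (fiberMap τ g₁ g wg k) ≫ a k ≫ fiberMap τ' g₁' g' wg' k)
  have hπ : IsIso π := by
    refine isIso_of_grade_eq he π ?_
    have h1 := e.grade_add g₁
    have h2 := e.grade_add g₂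
    have h3 : ∀ k, e.grade (fiber g₂ k) = e.grade (fiber g₁ k) := fun k => by
      rw [hG k]
      exact (Grading.grade_eq_of_iso
        (inv (fiberMap τ g₁ g wg k) ≫ a k ≫ fiberMap τ' g₁' g' wg' k)).symm
    simp only [h3] at h2
    omega
  have wf : (inv σ ≫ f ≫ τ) ≫ g₁ = h₁ := by
    rw [Category.assoc, Category.assoc, wg, w, ← wh, IsIso.inv_hom_id_assoc]
  have wf' : (inv σ ≫ f' ≫ τ') ≫ g₁' = h₁ := by
    rw [Category.assoc, Category.assoc, wg', w', ← wh, IsIso.inv_hom_id_assoc]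
  -- Both factorizations of `h₁` now have the same fibers and the same induced maps, so uniqueness
  -- of the blow up identifies them.
  obtain ⟨e', h1, h2⟩ := blowUp_id_unique hSBU h₁ hh₁ ((inv σ ≫ f ≫ τ) ≫ π) g₂
    (by rw [Category.assoc, w₂, wf]) (inv σ ≫ f' ≫ τ') g₁' wf' hg₂ hg₁' hG (fun k => by
      rw [← fiberMap_comp (inv σ ≫ f ≫ τ) π _ g₂ g₁ h₁ rfl w₂ _ wf k, hp,
        ← cancel_epi (fiberMap σ h₁ h wh k), fiberMap_comp σ (inv σ ≫ f' ≫ τ') (f' ≫ τ') g₁' h₁ h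
          (by simp) wf' (by rw [Category.assoc, wg', w']) wh k]
      have h3 := fiberMap_comp σ (inv σ ≫ f ≫ τ) (f ≫ τ) g₁ h₁ h
          (by simp) wf (by rw [Category.assoc, wg, w]) wh k
      have h4 := fiberMap_comp f τ (f ≫ τ) g₁ g h rfl wg (by rw [Category.assoc, wg, w]) w k
      have h5 := fiberMap_comp f' τ' (f' ≫ τ') g₁' g' h rfl wg' (by rw [Category.assoc, wg', w'])
        w' k
      simp only [Category.assoc, eqToHom_trans, eqToHom_refl, Category.comp_id]
      rw [reassoc_of% h3, ← h4, Category.assoc, IsIso.hom_inv_id_assoc, reassoc_of% (ha' k), h5])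
  refine ⟨τ ≫ π ≫ eqToHom e' ≫ inv τ', inferInstance, ?_, ?_⟩
  · rw [← cancel_epi (inv σ), ← cancel_mono τ']
    simpa using h1
  · rw [← wg', ← wg, ← w₂, ← h2]
    simp

/-! ### Splitting off a fiber -/

variable (e) in
/-- The morphisms with precisely one fiber of positive grade. -/
structure Grading.IsUnary {T S : O} (f : T ⟶ S) (q : Fin (card S)) : Prop where
  one_le : 1 ≤ e.grade (fiber f q)
  eq_zero (k : Fin (card S)) : k ≠ q → e.grade (fiber f k) = 0

theorem Grading.IsElementary.isUnary {T S : O} {f : T ⟶ S} {q : Fin (card S)}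
    (h : e.IsElementary f q) : e.IsUnary f q :=
  ⟨h.one_le, fun k hk => Grading.grade_trivial (h.trivial k hk)⟩

theorem Grading.IsUnary.grade_lt {T S : O} {f : T ⟶ S} {q : Fin (card S)}
    (h : e.IsUnary f q) : e.grade S < e.grade T := by
  have h1 := e.grade_add f
  rw [Finset.sum_eq_single q (fun k _ hk => h.eq_zero k hk) (by simp)] at h1
  have := h.one_le
  omega

theorem Grading.IsUnary.grade_eq {T S : O} {f : T ⟶ S} {q : Fin (card S)}
    (h : e.IsUnary f q) : e.grade S + e.grade (fiber f q) = e.grade T := by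
  have h1 := e.grade_add f
  rwa [Finset.sum_eq_single q (fun k _ hk => h.eq_zero k hk) (by simp)] at h1

theorem Grading.IsUnary.precomp {T' T S : O} {f : T ⟶ S} {q : Fin (card S)}
    (h : e.IsUnary f q) (ω : T' ⟶ T) [IsIso ω] (f' : T' ⟶ S) (w : ω ≫ f = f') :
    e.IsUnary f' q := by
  have h1 : ∀ k, e.grade (fiber f' k) = e.grade (fiber f k) := fun k =>
    Grading.grade_eq_of_iso (fiberMap ω f f' w k)
  exact ⟨by rw [h1]; exact h.one_le, fun k hk => by rw [h1]; exact h.eq_zero k hk⟩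

theorem Grading.IsUnary.eq_of_one_le {T S : O} {f : T ⟶ S} {q k : Fin (card S)}
    (h : e.IsUnary f q) (hk : 1 ≤ e.grade (fiber f k)) : k = q := by
  by_contra hc
  have := h.eq_zero k hc
  omega

theorem Grading.IsUnary.induced {T S R : O} {f : T ⟶ S} {g : S ⟶ R} {h : T ⟶ R}
    (w : f ≫ g = h) {q : Fin (card R)} {a : Fin (card (fiber g q))}
    (hf : e.IsUnary f (incl g q a)) : e.IsUnary (fiberMap f g h w q) a := by
  refine ⟨?_, fun k hk => ?_⟩
  · rw [← fiber_fiberMap]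
    exact hf.one_le
  · rw [← fiber_fiberMap]
    exact hf.eq_zero _ fun h => hk ((incl g q).injective h)

include he in
theorem isIso_fiberMap_of_grade {T S R : O} (f : T ⟶ S) (g : S ⟶ R) (h : T ⟶ R)
    (w : f ≫ g = h) (k : Fin (card R)) (hf : ∀ a, e.grade (fiber f (incl g k a)) = 0) :
    IsIso (fiberMap f g h w k) := by
  refine isIso_of_grade_fiber he _ fun a => ?_
  rw [← fiber_fiberMap]
  exact hf a

include he in
theorem Grading.IsUnary.isIso_fiberMap {T S R : O} {f : T ⟶ S} {g : S ⟶ R} {h : T ⟶ R}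
    (w : f ≫ g = h) {q k : Fin (card R)} {a : Fin (card (fiber g q))}
    (hf : e.IsUnary f (incl g q a)) (hk : k ≠ q) : IsIso (fiberMap f g h w k) := by
  refine isIso_fiberMap_of_grade he f g h w k fun b => hf.eq_zero _ fun hb => hk ?_
  rw [← cardMap_incl g k b, hb, cardMap_incl]

/-- The unique element over `q`, if the fiber over `q` is local terminal. -/
theorem incl_unique {S R : O} (g : S ⟶ R) (q : Fin (card R)) (ht : IsLocalTerminal (fiber g q))
    (a b : Fin (card (fiber g q))) : a = b := by
  have : Subsingleton (Fin (card (fiber g q))) := by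
    rw [Grading.card_localTerminal ht]
    infer_instance
  exact Subsingleton.elim a b

theorem exists_index {t : O} (ht : IsLocalTerminal t) : Nonempty (Fin (card t)) := by
  rw [Grading.card_localTerminal ht]
  exact ⟨0⟩

include he in
/-- Up to an isomorphism, every morphism is order preserving, with trivial fibers of grade `0`. -/
theorem exists_normalization (hFac : Factorizable O) (hSBU : BlowUp O)
    (hQBI : QuasiBijectionsInvertible O) {T S : O} (f : T ⟶ S) :
    ∃ (T' : O) (ω : T ⟶ T') (φ : T' ⟶ S), IsIso ω ∧ ω ≫ φ = f ∧ IsOrderPreserving φ ∧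
      ∀ k, e.grade (fiber φ k) = 0 → IsTrivial (fiber φ k) := by
  have hG : ∀ k, ∃ (G : O) (p : fiber f k ⟶ G), IsIso p ∧ (e.grade G = 0 → IsTrivial G) := by
    intro k
    by_cases hk : e.grade (fiber f k) = 0
    · obtain ⟨U, p, hU⟩ := exists_hom_trivial O (fiber f k)
      -- A fiber of grade `0` is exchanged for the trivial object to which it maps; equality of
      -- grades makes the map invertible.
      exact ⟨U, p, isIso_of_grade_eq he p (by rw [hk, Grading.grade_trivial hU]), fun _ => hU⟩
    · exact ⟨_, 𝟙 _, inferInstance, fun h => absurd h hk⟩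
  choose G p hp hG using hG
  obtain ⟨T', ω, φ, w, hF, hφ, hω⟩ := exists_factorization hFac hSBU hQBI f G p
  refine ⟨T', ω, φ, ?_, w, hφ, fun k hk => ?_⟩
  · refine isIso_of_grade_eq he ω ?_
    have h1 := e.grade_add f
    have h2 := e.grade_add φ
    have h3 : ∀ k, e.grade (fiber φ k) = e.grade (fiber f k) := fun k => by
      rw [hF k]
      exact (Grading.grade_eq_of_iso (p k)).symm
    simp only [h3] at h2
    omega
  · rw [hF] at hk ⊢
    exact hG k hk

/-- Splitting off a fiber of positive grade from an order preserving morphism. -/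
theorem exists_elementary_factor (hSBU : BlowUp O) {T S : O} (φ : T ⟶ S)
    (hφ : IsOrderPreserving φ) (q : Fin (card S)) (hq : 1 ≤ e.grade (fiber φ q)) :
    ∃ (Q : O) (π : T ⟶ Q) (ψ : Q ⟶ S) (a : Fin (card (fiber ψ q))), π ≫ ψ = φ ∧
      e.IsElementary π (incl ψ q a) ∧ IsOrderPreserving ψ ∧ IsTrivial (fiber ψ q) ∧
      ∀ k ≠ q, fiber ψ k = fiber φ k := by
  -- The fiber over `q` is collapsed to a trivial object, and the other fibers are kept with
  -- identity maps.
  have hG : ∀ k, ∃ (G : O) (p : fiber φ k ⟶ G), (k = q → IsTrivial G) ∧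
      (k ≠ q → ∃ h : fiber φ k = G, p = eqToHom h) := by
    intro k
    by_cases hk : k = q
    · obtain ⟨U, p, hU⟩ := exists_hom_trivial O (fiber φ k)
      exact ⟨U, p, fun _ => hU, fun h => absurd hk h⟩
    · exact ⟨_, 𝟙 _, fun h => absurd h hk, fun _ => ⟨rfl, rfl⟩⟩
  choose G p hp hG using hG
  obtain ⟨Q, π, ψ, w, hF, hψ, hπ⟩ := blowUp_id_exists hSBU φ hφ G p
  have ht : IsTrivial (fiber ψ q) := by
    rw [hF]
    exact hp q rfl
  obtain ⟨a⟩ := exists_index ht.isLocalTerminal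
  have hk : ∀ k ≠ q, ∃ h : fiber φ k = fiber ψ k, fiberMap π ψ φ w k = eqToHom h := by
    intro k hk
    obtain ⟨h, h'⟩ := hG k hk
    refine ⟨h.trans (hF k).symm, ?_⟩
    rw [hπ, h', eqToHom_trans]
  refine ⟨Q, π, ψ, a, w, ⟨?_, ?_, ?_⟩, hψ, ht, fun k hk' => (hk k hk').1.symm⟩
  · intro x y hxy
    by_contra hc
    rw [not_le] at hc
    have h1 : cardMap φ x = cardMap φ y := by
      refine le_antisymm (hφ hxy) ?_
      rw [← w, cardMap_comp, cardMap_comp]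
      exact hψ hc.le
    obtain ⟨x', hx⟩ := exists_incl_eq φ x
    obtain ⟨y', hy⟩ := exists_incl_eq φ y
    generalize cardMap φ x = k at x' hx h1
    subst h1
    have h2 : cardMap (fiberMap π ψ φ w _) x' ≤ cardMap (fiberMap π ψ φ w _) y' := by
      by_cases hkq : cardMap φ y = q
      · refine le_of_eq (incl_unique ψ _ ?_ _ _)
        rw [hkq]
        exact ht.isLocalTerminal
      · obtain ⟨h, h'⟩ := hk _ hkq
        rw [h']
        have : ∀ {A B : O} (h : A = B), Monotone (cardMap (eqToHom h)) := by
          rintro A _ rfl x y hxy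
          simpa [cardMap_id] using hxy
        refine this h ?_
        rw [← (incl φ _).le_iff_le, hx, hy]
        exact hxy
    rw [← (incl ψ _).le_iff_le, incl_cardMap_fiberMap, incl_cardMap_fiberMap, hx, hy] at h2
    exact absurd h2 (not_le.2 hc)
  · rw [fiber_fiberMap π ψ φ w q a, ht.fiber_eq]
    exact hq
  · intro j hj
    obtain ⟨b, hb⟩ := exists_incl_eq ψ j
    rw [← hb, fiber_fiberMap π ψ φ w _ b]
    have hkq : cardMap ψ j ≠ q := by
      intro hkq
      apply hj
      rw [← hb]
      subst hkq
      rw [incl_unique ψ _ ht.isLocalTerminal a b]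
    obtain ⟨h, h'⟩ := hk _ hkq
    rw [h']
    exact isTrivial_fiber_eqToHom h b

variable (e) in
/-- A presentation of `f` as an isomorphism, followed by an elementary morphism and a morphism
with fewer fibers of positive grade. -/
structure Splitting {T S : O} (f : T ⟶ S) where
  T' : O
  Q : O
  ω : T ⟶ T'
  π : T' ⟶ Q
  ψ : Q ⟶ S
  q : Fin (card S)
  a : Fin (card (fiber ψ q))
  isIso : IsIso ω
  elementary : e.IsElementary π (incl ψ q a)
  orderPreserving : IsOrderPreserving ψ
  trivial_q : IsTrivial (fiber ψ q)
  trivial (k : Fin (card S)) : e.grade (fiber ψ k) = 0 → IsTrivial (fiber ψ k)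
  w : ω ≫ π ≫ ψ = f

include he in
theorem nonempty_splitting (hFac : Factorizable O) (hSBU : BlowUp O)
    (hQBI : QuasiBijectionsInvertible O) {T S : O} (f : T ⟶ S) (hf : e.grade S < e.grade T) :
    Nonempty (Splitting e f) := by
  obtain ⟨T', ω, φ, hω, w, hφ, ht⟩ := exists_normalization he hFac hSBU hQBI f
  obtain ⟨q, hq⟩ := Grading.exists_fiber_of_lt φ
    (by rw [← Grading.grade_eq_of_iso (e := e) ω]; exact hf)
  obtain ⟨Q, π, ψ, a, w', hπ, hψ, hq', hk⟩ := exists_elementary_factor hSBU φ hφ q hq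
  refine ⟨⟨T', Q, ω, π, ψ, q, a, hω, hπ, hψ, hq', fun k h => ?_, by rw [w', w]⟩⟩
  by_cases hkq : k = q
  · rw [hkq]
    exact hq'
  · rw [hk k hkq] at h ⊢
    exact ht k h

end Factorizations

end OperadicCategory

/-! ### Composition operations from circle products, for families of sets -/

section SetMarkl

variable {O : Type u} [Category.{v} O] [OperadicCategory O]

/-- A Markl's operad in sets, with a unique element over each local terminal object. -/
structure SetMarkl (e : Grading O) (X : O → Type w) where
  act {S T : O} (f : S ⟶ T) [IsIso f] : X T → X S
  circ {T S : O} (φ : T ⟶ S) (i : Fin (card S)) (hφ : e.IsElementary φ i) :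
    X S → X (fiber φ i) → X T
  η (t : O) (ht : IsLocalTerminal t) : X t
  eq_η {t : O} (ht : IsLocalTerminal t) (x : X t) : x = η t ht
  act_id {T : O} (x : X T) : act (𝟙 T) x = x
  act_comp {T S R : O} (f : T ⟶ S) (g : S ⟶ R) [IsIso f] [IsIso g] (x : X R) :
    act (f ≫ g) x = act f (act g x)
  joint {T S P : O} (φ : T ⟶ S) (ψ : S ⟶ P) (ξ : T ⟶ P) (w : φ ≫ ψ = ξ) (i : Fin (card P))
    (a : Fin (card (fiber ψ i))) (hφ : e.IsElementary φ (incl ψ i a))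
    (hψ : e.IsElementary ψ i) (z : X P) (y : X (fiber ψ i)) (x : X (fiber φ (incl ψ i a))) :
    circ φ (incl ψ i a) hφ (circ ψ i hψ z y) x =
      circ ξ i (hφ.comp w hψ) z (circ (fiberMap φ ψ ξ w i) a (hφ.fiberMap w) y
        (transport X (fiber_fiberMap φ ψ ξ w i a) x))
  disjoint {T P' P'' S : O} (φ' : T ⟶ P') (ψ' : P' ⟶ S) (φ'' : T ⟶ P'') (ψ'' : P'' ⟶ S)
    (ξ : T ⟶ S) (w' : φ' ≫ ψ' = ξ) (w'' : φ'' ≫ ψ'' = ξ)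
    (i k : Fin (card S)) (hik : i ≠ k) (j : Fin (card P')) (l : Fin (card P''))
    (hj : cardMap ψ' j = k) (hl : cardMap ψ'' l = i)
    (hφ' : e.IsElementary φ' j) (hψ' : e.IsElementary ψ' i)
    (hφ'' : e.IsElementary φ'' l) (hψ'' : e.IsElementary ψ'' k)
    [IsIso (fiberMap φ'' ψ'' ξ w'' k)] [IsIso (fiberMap φ' ψ' ξ w' i)]
    (z : X S) (a'' : X (fiber ψ'' k)) (b'' : X (fiber φ'' l)) (a' : X (fiber φ' j))
    (b' : X (fiber ψ' i))
    (_ : transport X (fiber_eq_of_trivial φ' ψ' ξ w' j k hj (hψ'.trivial k hik.symm)) a' =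
      act (fiberMap φ'' ψ'' ξ w'' k) a'')
    (_ : transport X (fiber_eq_of_trivial φ'' ψ'' ξ w'' l i hl (hψ''.trivial i hik)) b'' =
      act (fiberMap φ' ψ' ξ w' i) b') :
    circ φ'' l hφ'' (circ ψ'' k hψ'' z a'') b'' = circ φ' j hφ' (circ ψ' i hψ' z b') a'
  unital {T U : O} (f : T ⟶ U) (hU : IsTrivial U) (hT : 1 ≤ e.grade T) (i : Fin (card U))
    (x : X (fiber f i)) :
    circ f i (Grading.isElementary_of_isLocalTerminal f hU.isLocalTerminal hT i)
      (η U hU.isLocalTerminal) x = transport X (hU.fiber_eq f i) x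
  equivariant {T' T'' S' S'' : O} (ω : T' ⟶ T'') (σ : S' ⟶ S'') [IsIso ω] [IsIso σ]
    (φ' : T' ⟶ S') (φ'' : T'' ⟶ S'') (φ : T' ⟶ S'') (w' : φ' ≫ σ = φ) (w'' : ω ≫ φ'' = φ)
    (j : Fin (card S'')) (a : Fin (card (fiber σ j)))
    (hφ' : e.IsElementary φ' (incl σ j a)) (hφ'' : e.IsElementary φ'' j)
    (z : X S'') (x : X (fiber φ' (incl σ j a))) (y : X (fiber φ'' j))
    (_ : act (fiberMap ω φ'' φ w'' j) y =
      circ (fiberMap φ' σ φ w' j) a (Grading.isElementary_of_isLocalTerminal _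
        (fiber_isLocalTerminal (asIso σ) j) (hφ'.one_le_comp w') a)
        (η _ (fiber_isLocalTerminal (asIso σ) j))
        (transport X (fiber_fiberMap φ' σ φ w' j a) x)) :
    act ω (circ φ'' j hφ'' z y) = circ φ' (incl σ j a) hφ' (act σ z) x

variable {e : Grading O} {X : O → Type w}

namespace SetMarkl

variable (D : SetMarkl e X)

theorem act_congr {S T : O} {f g : S ⟶ T} [IsIso f] [IsIso g] (h : f = g) (x : X T) :
    D.act f x = D.act g x := by
  subst h
  rfl

theorem act_inv_act {S T : O} (f : S ⟶ T) [IsIso f] (x : X T) :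
    D.act (inv f) (D.act f x) = x := by
  rw [← D.act_comp, D.act_congr (IsIso.inv_hom_id f), D.act_id]

theorem act_act_inv {S T : O} (f : S ⟶ T) [IsIso f] (x : X S) :
    D.act f (D.act (inv f) x) = x := by
  rw [← D.act_comp, D.act_congr (IsIso.hom_inv_id f), D.act_id]

theorem act_injective {S T : O} (f : S ⟶ T) [IsIso f] : Function.Injective (D.act f) :=
  Function.LeftInverse.injective (D.act_inv_act f)

theorem act_surjective {S T : O} (f : S ⟶ T) [IsIso f] : Function.Surjective (D.act f) :=
  Function.RightInverse.surjective (D.act_act_inv f)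

theorem act_eqToHom {S T : O} (h : S = T) (x : X T) :
    D.act (eqToHom h) x = transport X h.symm x := by
  subst h
  exact D.act_id x

include D in
theorem eq_of_isLocalTerminal {t : O} (ht : IsLocalTerminal t) (x y : X t) : x = y :=
  (D.eq_η ht x).trans (D.eq_η ht y).symm

/-- Passage to iterated fibers is compatible with the action: this is `f_j = (f_i)_j` seen through
`act`. -/
theorem act_fiberMap {T S R Q : O} (f : T ⟶ S) (g : S ⟶ R) (k : R ⟶ Q)
    (h : T ⟶ R) (m : S ⟶ Q) (n : T ⟶ Q) (hh : f ≫ g = h) (hm : g ≫ k = m) (hn : h ≫ k = n)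
    (hf : f ≫ m = n) (q : Fin (card Q)) (r : Fin (card (fiber k q))) [IsIso f]
    (x : X (fiber g (incl k q r))) :
    transport X (fiber_fiberMap h k n hn q r) (D.act (fiberMap f g h hh (incl k q r)) x) =
      D.act (fiberMap (fiberMap f m n hf q) (fiberMap g k m hm q) (fiberMap h k n hn q)
          (fiberMap_comp f g h k m n hh hm hn hf q) r)
        (transport X (fiber_fiberMap g k m hm q r) x) := by
  have h1 := fiberMap_fiberMap f g h k m n hh hm hn hf q r
  rw [D.act_congr h1, D.act_comp, D.act_comp, D.act_eqToHom, D.act_eqToHom,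
    transport_transport, transport_rfl]

/-- The composition is obtained by splitting off a fiber. -/
def SplitsAlong (γ : SetComposition X) {T S : O} {f : T ⟶ S} (p : Splitting e f) : Prop :=
  ∀ (x : ∀ k, X (fiber f k)) (y : ∀ k, X (fiber p.ψ k)) (u : X (fiber p.π (incl p.ψ p.q p.a)))
    (z : X S),
    (∀ k, k ≠ p.q → ∀ [IsIso (fiberMap (p.ω ≫ p.π) p.ψ f
      ((Category.assoc _ _ _).trans p.w) k)], x k = D.act (fiberMap (p.ω ≫ p.π) p.ψ f
      ((Category.assoc _ _ _).trans p.w) k) (y k)) →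
    (∀ [IsIso p.ω], x p.q = D.act (fiberMap p.ω (p.π ≫ p.ψ) f p.w p.q)
      (transport X ((fiber_fiberMap p.π p.ψ _ rfl p.q p.a).trans (p.trivial_q.fiber_eq _ p.a)) u)) →
    γ f x z = @SetMarkl.act _ _ _ _ _ D _ _ p.ω p.isIso
      (D.circ p.π (incl p.ψ p.q p.a) p.elementary (γ p.ψ y z) u)

/-- The composition operations are built from the action of the isomorphisms and the circle
products. -/
structure IsGenerated (γ : SetComposition X) : Prop where
  iso {T S : O} (f : T ⟶ S) [IsIso f] (x : ∀ k, X (fiber f k)) (z : X S) : γ f x z = D.act f z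
  split {T S : O} (f : T ⟶ S) (_ : e.grade S < e.grade T) :
    ∃ p : Splitting e f, D.SplitsAlong γ p

end SetMarkl

end SetMarkl

/-! ### Morphisms with one fiber of positive grade -/

namespace OperadicCategory

section Unary

variable {O : Type u} [Category.{v} O] [OperadicCategory O] {e : Grading O}

theorem Grading.grade_fiber_comp {T S R : O} (f : T ⟶ S) (g : S ⟶ R) (h : T ⟶ R) (w : f ≫ g = h)
    (k : Fin (card R)) :
    e.grade (fiber h k) = e.grade (fiber g k) + ∑ a, e.grade (fiber f (incl g k a)) := by
  rw [← e.grade_add (fiberMap f g h w k)]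
  congr 1
  refine Finset.sum_congr rfl fun a _ => ?_
  rw [← fiber_fiberMap]

theorem Grading.IsUnary.comp_of_eq_zero {T S R : O} {f : T ⟶ S} {g : S ⟶ R} {h : T ⟶ R}
    (w : f ≫ g = h) {s : Fin (card S)} (hf : e.IsUnary f s)
    (hg : ∀ k ≠ cardMap g s, e.grade (fiber g k) = 0) : e.IsUnary h (cardMap g s) := by
  refine ⟨?_, fun k hk => ?_⟩
  · obtain ⟨a, ha⟩ := exists_incl_eq g s
    rw [Grading.grade_fiber_comp f g h w]
    have h1 := Finset.single_le_sum (f := fun a => e.grade (fiber f (incl g (cardMap g s) a)))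
      (fun _ _ => Nat.zero_le _) (Finset.mem_univ a)
    rw [ha] at h1
    have := hf.one_le
    omega
  · have h1 : ∑ a, e.grade (fiber f (incl g k a)) = 0 := Finset.sum_eq_zero fun a _ =>
      hf.eq_zero _ fun hs => hk (by rw [← hs, cardMap_incl])
    rw [Grading.grade_fiber_comp f g h w, hg k hk, h1]

theorem Grading.IsUnary.induced' {T S R : O} {f : T ⟶ S} {g : S ⟶ R} {h : T ⟶ R}
    (w : f ≫ g = h) {s : Fin (card S)} (hf : e.IsUnary f s) {q : Fin (card R)}
    (hq : cardMap g s = q) :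
    ∃ a, incl g q a = s ∧ e.IsUnary (fiberMap f g h w q) a := by
  subst hq
  obtain ⟨a, ha⟩ := exists_incl_eq g s
  rw [← ha] at hf
  exact ⟨a, ha, hf.induced w⟩

variable (he : ∀ {S T : O} (f : S ⟶ T), IsIso f ↔ e.gradeHom f = 0)

include he in
theorem Grading.IsUnary.isIso_fiberMap' {T S R : O} {f : T ⟶ S} {g : S ⟶ R} {h : T ⟶ R}
    (w : f ≫ g = h) {s : Fin (card S)} (hf : e.IsUnary f s) {k : Fin (card R)}
    (hk : k ≠ cardMap g s) : IsIso (fiberMap f g h w k) := by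
  refine isIso_fiberMap_of_grade he f g h w k fun b => hf.eq_zero _ fun hb => hk ?_
  rw [← hb, cardMap_incl]

variable (hFac : Factorizable O) (hSBU : BlowUp O) (hQBI : QuasiBijectionsInvertible O)
include he hFac hSBU hQBI

theorem Grading.IsUnary.exists_elementary {T S : O} {f : T ⟶ S} {q : Fin (card S)}
    (hf : e.IsUnary f q) :
    ∃ (T' : O) (ω : T ⟶ T') (φ : T' ⟶ S), IsIso ω ∧ ω ≫ φ = f ∧ e.IsElementary φ q := by
  obtain ⟨T', ω, φ, hω, w, hφ, ht⟩ := exists_normalization he hFac hSBU hQBI f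
  have h1 : ∀ k, e.grade (fiber φ k) = e.grade (fiber f k) := fun k =>
    (Grading.grade_eq_of_iso (fiberMap ω φ f w k)).symm
  exact ⟨T', ω, φ, hω, w, hφ, by rw [h1]; exact hf.one_le,
    fun k hk => ht k (by rw [h1]; exact hf.eq_zero k hk)⟩

/-- Elementary splitting freed from order conditions: the fiber over `q` is absorbed by the unary
first factor, and the grades of the other fibers stay with the second. -/
theorem exists_unary_factor {T S : O} (f : T ⟶ S) (q : Fin (card S))
    (hq : 1 ≤ e.grade (fiber f q)) :
    ∃ (Q : O) (g : T ⟶ Q) (h : Q ⟶ S) (t : Fin (card Q)), g ≫ h = f ∧ cardMap h t = q ∧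
      e.IsUnary g t ∧ IsTrivial (fiber h q) ∧
      ∀ k ≠ q, e.grade (fiber h k) = e.grade (fiber f k) := by
  obtain ⟨T', ω, φ, hω, w, hφ, ht⟩ := exists_normalization he hFac hSBU hQBI f
  have h1 : ∀ k, e.grade (fiber φ k) = e.grade (fiber f k) := fun k =>
    (Grading.grade_eq_of_iso (fiberMap ω φ f w k)).symm
  obtain ⟨Q, π, ψ, a, w', hπ, hψ, hq', hk⟩ :=
    exists_elementary_factor hSBU φ hφ q (by rw [h1]; exact hq)
  refine ⟨Q, ω ≫ π, ψ, _, by rw [Category.assoc, w', w], cardMap_incl ψ q a,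
    hπ.isUnary.precomp ω _ rfl, hq', fun k hkq => ?_⟩
  rw [hk k hkq, h1]

end Unary

end OperadicCategory

/-! ### Independence of the splitting for unary morphisms -/

namespace SetMarkl.IsGenerated

variable {O : Type u} [Category.{v} O] [OperadicCategory O]
variable {e : Grading O} {X : O → Type w} {D : SetMarkl e X} {γ : SetComposition X}
variable (he : ∀ {S T : O} (f : S ⟶ T), IsIso f ↔ e.gradeHom f = 0)
  (hFac : Factorizable O) (hSBU : BlowUp O) (hQBI : QuasiBijectionsInvertible O)
  (hγ : D.IsGenerated γ)

include he hγ

/-- Evaluation of the composition along an isomorphism followed by an elementary morphism. -/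
theorem eval_unary {T T' S : O} (ω : T ⟶ T') [IsIso ω] (φ : T' ⟶ S) (f : T ⟶ S) (w : ω ≫ φ = f)
    (q : Fin (card S)) (hφ : e.IsElementary φ q) (x : ∀ k, X (fiber f k)) (u : X (fiber φ q))
    (z : X S) (hx : x q = D.act (fiberMap ω φ f w q) u) :
    γ f x z = D.act ω (D.circ φ q hφ z u) := by
  have hf : e.IsUnary f q := hφ.isUnary.precomp ω f w
  obtain ⟨⟨T₁, Q, ω₁, π, ψ, q₁, a, hω₁, hπ, hψ, hq, ht, w₁⟩, hp⟩ := hγ.split f hf.grade_lt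
  dsimp only [SplitsAlong] at hp
  have hqT : fiber π (incl ψ q₁ a) = fiber (π ≫ ψ) q₁ :=
    (fiber_fiberMap π ψ _ rfl q₁ a).trans (hq.fiber_eq _ a)
  have hg : e.grade (fiber f q₁) = e.grade (fiber π (incl ψ q₁ a)) := by
    rw [hqT]
    exact Grading.grade_eq_of_iso (fiberMap ω₁ (π ≫ ψ) f w₁ q₁)
  -- Only one fiber has positive grade, so the splitting had no choice of position; by grades its
  -- last factor `ψ` is then invertible.
  obtain rfl : q₁ = q := hf.eq_of_one_le (by rw [hg]; exact hπ.one_le)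
  have hψi : IsIso ψ := by
    refine isIso_of_grade_eq he ψ ?_
    have h1 := hπ.isUnary.grade_eq
    have h2 := hf.grade_eq
    have h3 := Grading.grade_eq_of_iso (e := e) ω₁
    omega
  have hy : ∀ k, ∃ y : X (fiber ψ k), k ≠ q₁ → ∀ [IsIso (fiberMap (ω₁ ≫ π) ψ f
      ((Category.assoc _ _ _).trans w₁) k)], x k = D.act (fiberMap (ω₁ ≫ π) ψ f
      ((Category.assoc _ _ _).trans w₁) k) y := by
    intro k
    by_cases hk : k = q₁
    · subst hk
      exact ⟨D.η _ hq.isLocalTerminal, fun h => absurd rfl h⟩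
    · have : IsIso (fiberMap (ω₁ ≫ π) ψ f ((Category.assoc _ _ _).trans w₁) k) :=
        isIso_fiberMap_of_grade he _ _ _ _ _ fun b =>
          (hπ.isUnary.precomp ω₁ _ rfl).eq_zero _ fun hb => hk (by
            rw [← cardMap_incl ψ k b, hb, cardMap_incl])
      obtain ⟨y, hy⟩ := D.act_surjective (fiberMap (ω₁ ≫ π) ψ f
        ((Category.assoc _ _ _).trans w₁) k) (x k)
      exact ⟨y, fun _ _ => hy.symm⟩
  choose y hy using hy
  obtain ⟨u₂, hu₂⟩ := D.act_surjective (fiberMap ω₁ (π ≫ ψ) f w₁ q₁) (x q₁)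
  have hu₁ : transport X hqT (transport X hqT.symm u₂) = u₂ := by
    rw [transport_transport, transport_rfl]
  rw [hp x y (transport X hqT.symm u₂) z hy (by intro _; rw [hu₁, hu₂]), hγ.iso ψ]
  -- Equivariance over the isomorphism `ψ` compares the elementary part of the splitting with the
  -- given one. The correction by the fiber of `ψ` disappears by unitality, since that fiber is
  -- trivial.
  rw [← D.equivariant (inv ω₁ ≫ ω) ψ π φ (π ≫ ψ) rfl
    (by rw [Category.assoc, w, ← w₁, IsIso.inv_hom_id_assoc]) q₁ a hπ hφ z _ u ?_, ← D.act_comp]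
  · exact D.act_congr (by simp) _
  · have h1 := D.unital (fiberMap π ψ (π ≫ ψ) rfl q₁) hq (hπ.one_le_comp rfl) a
      (transport X (fiber_fiberMap π ψ _ rfl q₁ a) (transport X hqT.symm u₂))
    refine Eq.trans ?_ h1.symm
    rw [transport_transport, transport_transport, transport_rfl]
    apply D.act_injective (fiberMap ω₁ (π ≫ ψ) f w₁ q₁)
    rw [hu₂, hx, ← D.act_comp]
    exact D.act_congr (fiberMap_comp _ _ _ _ _ _ (by simp) _ _ _ _) _

theorem eval_elementary {T S : O} (φ : T ⟶ S) (q : Fin (card S)) (hφ : e.IsElementary φ q)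
    (x : ∀ k, X (fiber φ k)) (z : X S) : γ φ x z = D.circ φ q hφ z (x q) := by
  have h := hγ.eval_unary he (𝟙 T) φ φ (Category.id_comp φ) q hφ x
    (D.act (inv (fiberMap (𝟙 T) φ φ (Category.id_comp φ) q)) (x q)) z (by rw [D.act_act_inv])
  have h1 : fiberMap (𝟙 T) φ φ (Category.id_comp φ) q = 𝟙 _ := by
    obtain ⟨e', h⟩ := fiberMap_eqToHom rfl φ φ (Category.id_comp φ) q
    exact h
  rw [h, D.act_id]
  congr 1
  rw [D.act_congr (g := 𝟙 _) (by simp only [h1, IsIso.inv_id]), D.act_id]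

end SetMarkl.IsGenerated

/-! ### Associativity for isomorphisms and unary morphisms -/

namespace SetMarkl.IsGenerated

section Unary

variable {O : Type u} [Category.{v} O] [OperadicCategory O]
variable {e : Grading O} {X : O → Type w} {D : SetMarkl e X} {γ : SetComposition X}
variable (hγ : D.IsGenerated γ)

include hγ

theorem assoc_iso_iso {T S R : O} (f : T ⟶ S) (g : S ⟶ R) (h : T ⟶ R) (w : f ≫ g = h)
    [IsIso f] [IsIso g] : γ.AssocAt f g h w := by
  intro x y z
  subst w
  rw [hγ.iso f, hγ.iso g, hγ.iso (f ≫ g), D.act_comp]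

theorem surjective_of_isIso {T S : O} (f : T ⟶ S) [IsIso f] (v : X T) :
    ∃ x y, γ f x y = v :=
  ⟨fun k => D.η _ (fiber_isLocalTerminal (asIso f) k), D.act (inv f) v, by
    rw [hγ.iso f, D.act_act_inv]⟩

variable (he : ∀ {S T : O} (f : S ⟶ T), IsIso f ↔ e.gradeHom f = 0)
include he

theorem surjective_of_isTrivial {T U : O} (f : T ⟶ U) (hU : IsTrivial U) (v : X T) :
    ∃ x y, γ f x y = v := by
  refine ⟨fun k => transport X (hU.fiber_eq f k).symm v, D.η U hU.isLocalTerminal, ?_⟩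
  by_cases hT : 1 ≤ e.grade T
  · obtain ⟨i⟩ := exists_index hU.isLocalTerminal
    rw [hγ.eval_elementary he f i
      (Grading.isElementary_of_isLocalTerminal f hU.isLocalTerminal hT i),
      D.unital f hU hT i, transport_transport, transport_rfl]
  · exact D.eq_of_isLocalTerminal (isLocalTerminal_of_grade he (by omega)) _ _

/-- Supplies the surjectivity needed in the pentagon arguments: each induced map of fibers is
invertible or has a trivial target, and in both cases `γ` reaches every element. -/
theorem surjective_of_isUnary {T S R : O} (f : T ⟶ S) (g : S ⟶ R) (h : T ⟶ R) (w : f ≫ g = h)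
    {s : Fin (card S)} (hf : e.IsUnary f s) (ht : IsTrivial (fiber g (cardMap g s)))
    (q : Fin (card R)) (v : X (fiber h q)) : ∃ x y, γ (fiberMap f g h w q) x y = v := by
  by_cases hq : q = cardMap g s
  · subst hq
    exact hγ.surjective_of_isTrivial he _ ht v
  · have := hf.isIso_fiberMap' he w hq
    exact hγ.surjective_of_isIso _ v

variable (hFac : Factorizable O) (hSBU : BlowUp O) (hQBI : QuasiBijectionsInvertible O)
include hFac hSBU hQBI

/-- An isomorphism in front is absorbed into the isomorphism of a presentation of `g`, along which
`eval_unary` computes both sides. -/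
theorem assoc_iso_unary {T S R : O} (f : T ⟶ S) (g : S ⟶ R) (h : T ⟶ R) (w : f ≫ g = h)
    [IsIso f] {q : Fin (card R)} (hg : e.IsUnary g q) : γ.AssocAt f g h w := by
  intro x y z
  obtain ⟨T', ω, φ, hω, wg, hφ⟩ := hg.exists_elementary he hFac hSBU hQBI
  obtain ⟨u, hu⟩ := D.act_surjective (fiberMap ω φ g wg q) (y q)
  rw [hγ.iso f, hγ.eval_unary he ω φ g wg q hφ y u z hu.symm,
    hγ.eval_unary he (f ≫ ω) φ h (by rw [Category.assoc, wg, w]) q hφ _ u z ?_, D.act_comp]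
  rw [hγ.iso (fiberMap f g h w q), ← hu, ← D.act_comp]
  exact D.act_congr (fiberMap_comp f ω (f ≫ ω) φ g h rfl wg _ w q) _

/-- Elementary presentations of `f` and of `h` form a square over `g`, and the claim is equivariance
for that square. As `g` need not be a quasibijection, the form with extended units at its local
terminal fibers is needed. -/
theorem assoc_unary_iso {T S R : O} (f : T ⟶ S) (g : S ⟶ R) (h : T ⟶ R) (w : f ≫ g = h)
    [IsIso g] {s : Fin (card S)} (hf : e.IsUnary f s) : γ.AssocAt f g h w := by
  intro x y z
  obtain ⟨a, ha⟩ := exists_incl_eq g s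
  have hh : e.IsUnary h (cardMap g s) :=
    hf.comp_of_eq_zero w fun k _ => Grading.grade_fiber_eq_zero g k
  generalize cardMap g s = q at a ha hh
  subst ha
  obtain ⟨T₁, ω, φ, hω, wf, hφ⟩ := hf.exists_elementary he hFac hSBU hQBI
  obtain ⟨T₂, ω', φ', hω', wh, hφ'⟩ := hh.exists_elementary he hFac hSBU hQBI
  obtain ⟨u, hu⟩ := D.act_surjective (fiberMap ω φ f wf (incl g q a)) (x (incl g q a))
  obtain ⟨u', hu'⟩ := D.act_surjective (fiberMap ω' φ' h wh q)
    (γ (fiberMap f g h w q) (restrict f g h w x q) (y q))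
  rw [hγ.iso g, hγ.eval_unary he ω φ f wf _ hφ x u _ hu.symm,
    hγ.eval_unary he ω' φ' h wh q hφ' _ u' z hu'.symm]
  rw [← D.equivariant (inv ω ≫ ω') g φ φ' (φ ≫ g) rfl
    (by rw [Category.assoc, wh, ← w, ← wf, Category.assoc, IsIso.inv_hom_id_assoc]) q a hφ hφ' z
      u u' ?_, ← D.act_comp]
  · exact D.act_congr (by simp) _
  · have wφ : ω ≫ φ ≫ g = h := by rw [← Category.assoc, wf, w]
    apply D.act_injective (fiberMap ω (φ ≫ g) h wφ q)
    rw [← D.act_comp, D.act_congr (fiberMap_comp ω (inv ω ≫ ω') ω' φ' (φ ≫ g) h (by simp)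
      (by rw [Category.assoc, wh, ← w, ← wf, Category.assoc, IsIso.inv_hom_id_assoc]) wh wφ q),
      hu', hγ.eval_unary he (fiberMap ω (φ ≫ g) h wφ q) (fiberMap φ g (φ ≫ g) rfl q)
      (fiberMap f g h w q) (fiberMap_comp ω φ f g (φ ≫ g) h wf rfl w wφ q) a
      (Grading.isElementary_of_isLocalTerminal _ (fiber_isLocalTerminal (asIso g) q)
        (hφ.one_le_comp rfl) a) _ (transport X (fiber_fiberMap φ g (φ ≫ g) rfl q a) u) _ ?_]
    · congr 2
      exact D.eq_η _ _
    · unfold restrict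
      rw [← hu]
      exact D.act_fiberMap ω φ g f (φ ≫ g) h wf rfl w wφ q a u

/-- A pentagon argument removes the isomorphism from `f`; for elementary morphisms the claim is the
joint axiom. -/
theorem assoc_unary_unary_of_elementary {T S R : O} (f : T ⟶ S) (g : S ⟶ R) (h : T ⟶ R)
    (w : f ≫ g = h) {s : Fin (card S)} (hf : e.IsUnary f s)
    (hg : e.IsElementary g (cardMap g s)) : γ.AssocAt f g h w := by
  obtain ⟨T₁, ω, φ, hω, wf, hφ⟩ := hf.exists_elementary he hFac hSBU hQBI
  refine SetComposition.AssocAt.comp_left (f := ω) (g := φ) (k := g) (m := φ ≫ g) (hh := wf)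
    (hm := rfl) (hf := by rw [← Category.assoc, wf, w])
    (hγ.assoc_iso_unary he hFac hSBU hQBI _ _ _ _ hφ.isUnary) ?_
    (hγ.assoc_iso_unary he hFac hSBU hQBI _ _ _ _
      (hφ.isUnary.comp_of_eq_zero rfl hg.isUnary.eq_zero)) (fun q => ?_)
    (fun r v => hγ.surjective_of_isIso _ v)
  · intro x y z
    obtain ⟨a, ha⟩ := exists_incl_eq g s
    generalize cardMap g s = q at a ha hg
    subst ha
    rw [hγ.eval_elementary he φ _ hφ, hγ.eval_elementary he g _ hg,
      hγ.eval_elementary he (φ ≫ g) _ (hφ.comp rfl hg), D.joint φ g (φ ≫ g) rfl,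
      hγ.eval_elementary he (fiberMap φ g (φ ≫ g) rfl q) _ (hφ.fiberMap rfl)]
    rfl
  · by_cases hq : q = cardMap g s
    · obtain ⟨a, -, ha⟩ := hφ.isUnary.induced' (g := g) (h := φ ≫ g) rfl hq.symm
      exact hγ.assoc_iso_unary he hFac hSBU hQBI _ _ _ _ ha
    · have := hφ.isUnary.isIso_fiberMap' he (g := g) (h := φ ≫ g) rfl hq
      exact hγ.assoc_iso_iso _ _ _ _

theorem assoc_unary_unary {T S R : O} (f : T ⟶ S) (g : S ⟶ R) (h : T ⟶ R)
    (w : f ≫ g = h) {s : Fin (card S)} (hf : e.IsUnary f s)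
    (hg : e.IsUnary g (cardMap g s)) : γ.AssocAt f g h w := by
  obtain ⟨S₁, ω, φ, hω, rfl, hφ⟩ := hg.exists_elementary he hFac hSBU hQBI
  have hfω : e.IsUnary (f ≫ ω) (cardMap ω s) :=
    hf.comp_of_eq_zero rfl fun k _ => Grading.grade_fiber_eq_zero ω k
  refine SetComposition.AssocAt.comp_right (f := f) (g := ω) (k := φ) (h := f ≫ ω) (hh := rfl)
    (hm := rfl) (hn := by rw [Category.assoc, w])
    (hγ.assoc_unary_iso he hFac hSBU hQBI _ _ _ _ hf)
    (hγ.assoc_iso_unary he hFac hSBU hQBI _ _ _ _ hφ.isUnary)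
    (hγ.assoc_unary_unary_of_elementary he hFac hSBU hQBI _ _ _ _ hfω
      (by rw [← cardMap_comp]; exact hφ)) (fun q => ?_)
    (fun r v => hγ.surjective_of_isIso _ v)
  by_cases hq : q = cardMap (ω ≫ φ) s
  · obtain ⟨a, -, ha⟩ := hf.induced' w hq.symm
    exact hγ.assoc_unary_iso he hFac hSBU hQBI _ _ _ _ ha
  · have := hf.isIso_fiberMap' he w hq
    exact hγ.assoc_iso_iso _ _ _ _

/-- Associativity for the maps of fibers of two morphisms with different positions. -/
theorem assoc_fiberMap_of_ne {T S R Q : O} (f : T ⟶ S) (g : S ⟶ R) (k : R ⟶ Q)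
    (h : T ⟶ R) (m : S ⟶ Q) (n : T ⟶ Q) (hh : f ≫ g = h) (hm : g ≫ k = m) (hn : h ≫ k = n)
    (hf : f ≫ m = n) {s : Fin (card S)} {t : Fin (card R)} (hfs : e.IsUnary f s)
    (hgt : e.IsUnary g t) (hne : cardMap m s ≠ cardMap k t) (q : Fin (card Q)) :
    γ.AssocAt (fiberMap f m n hf q) (fiberMap g k m hm q) (fiberMap h k n hn q)
      (fiberMap_comp f g h k m n hh hm hn hf q) := by
  by_cases hq : q = cardMap m s
  · obtain ⟨a, -, ha⟩ := hfs.induced' hf hq.symm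
    have := hgt.isIso_fiberMap' he hm (k := q) (by rw [hq]; exact hne)
    exact hγ.assoc_unary_iso he hFac hSBU hQBI _ _ _ _ ha
  · have := hfs.isIso_fiberMap' he hf hq
    by_cases hq' : q = cardMap k t
    · obtain ⟨a, -, ha⟩ := hgt.induced' hm hq'.symm
      exact hγ.assoc_iso_unary he hFac hSBU hQBI _ _ _ _ ha
    · have := hgt.isIso_fiberMap' he hm hq'
      exact hγ.assoc_iso_iso _ _ _ _

/-- Associativity for the maps of fibers of a unary morphism and an isomorphism. -/
theorem assoc_fiberMap_of_isIso {T S R Q : O} (f : T ⟶ S) (g : S ⟶ R) [IsIso g] (k : R ⟶ Q)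
    (h : T ⟶ R) (m : S ⟶ Q) (n : T ⟶ Q) (hh : f ≫ g = h) (hm : g ≫ k = m) (hn : h ≫ k = n)
    (hf : f ≫ m = n) {s : Fin (card S)} (hfs : e.IsUnary f s) (q : Fin (card Q)) :
    γ.AssocAt (fiberMap f m n hf q) (fiberMap g k m hm q) (fiberMap h k n hn q)
      (fiberMap_comp f g h k m n hh hm hn hf q) := by
  by_cases hq : q = cardMap m s
  · obtain ⟨a, -, ha⟩ := hfs.induced' hf hq.symm
    exact hγ.assoc_unary_iso he hFac hSBU hQBI _ _ _ _ ha
  · have := hfs.isIso_fiberMap' he hf hq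
    exact hγ.assoc_iso_iso _ _ _ _

-- The rule defining `γ` by a splitting is itself an instance of associativity. The fiber over `p.q`
-- is trivial in the last factor, so the composite there is the split-off element by unitality.
omit hFac hSBU hQBI in
theorem assoc_splitting {T S : O} {f : T ⟶ S} (p : Splitting e f) (hp : D.SplitsAlong γ p) :
    γ.AssocAt (p.ω ≫ p.π) p.ψ f ((Category.assoc _ _ _).trans p.w) := by
  obtain ⟨T₁, Q, ω, π, ψ, q, a, hω, hπ, hψ, hq, ht, w⟩ := p
  dsimp only [SplitsAlong] at hp ⊢
  intro x y z
  obtain ⟨u, hu⟩ := D.act_surjective (fiberMap ω π (ω ≫ π) rfl (incl ψ q a)) (x (incl ψ q a))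
  rw [hγ.eval_unary he ω π (ω ≫ π) rfl _ hπ x u _ hu.symm]
  symm
  refine hp _ y u z ?_ ?_
  · intro k hk _
    exact hγ.iso _ _ _
  · intro _
    rw [hγ.eval_unary he (fiberMap ω (π ≫ ψ) f w q) (fiberMap π ψ (π ≫ ψ) rfl q)
      (fiberMap (ω ≫ π) ψ f ((Category.assoc _ _ _).trans w) q)
      (fiberMap_comp ω π (ω ≫ π) ψ (π ≫ ψ) f rfl rfl ((Category.assoc _ _ _).trans w) w q) a
      (Grading.isElementary_of_isLocalTerminal _ hq.isLocalTerminal (hπ.one_le_comp rfl) a) _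
      (transport X (fiber_fiberMap π ψ (π ≫ ψ) rfl q a) u) _ ?_]
    · rw [D.eq_η hq.isLocalTerminal (y q), D.unital _ hq (hπ.one_le_comp rfl) a,
        transport_transport]
    · unfold restrict
      rw [← hu]
      exact D.act_fiberMap ω π ψ (ω ≫ π) (π ≫ ψ) f rfl rfl ((Category.assoc _ _ _).trans w) w q a u

end Unary

end SetMarkl.IsGenerated

/-! ### Associativity by induction on the grade -/

namespace SetMarkl.IsGenerated

section Associativity

variable {O : Type u} [Category.{v} O] [OperadicCategory O]
variable {e : Grading O} {X : O → Type w} {D : SetMarkl e X} {γ : SetComposition X}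

variable (e γ) in
/-- Associativity for unary morphisms that become the only contribution to a fiber of the
composite, up to a given grade of the source. -/
def AssocBelow (n : ℕ) : Prop :=
  ∀ ⦃T S R : O⦄ (f : T ⟶ S) (g : S ⟶ R) (h : T ⟶ R) (w : f ≫ g = h) (s : Fin (card S)),
    e.grade T < n → e.IsUnary f s → IsLocalTerminal (fiber g (cardMap g s)) → γ.AssocAt f g h w

variable (hγ : D.IsGenerated γ)
  (he : ∀ {S T : O} (f : S ⟶ T), IsIso f ↔ e.gradeHom f = 0)
  (hFac : Factorizable O) (hSBU : BlowUp O) (hQBI : QuasiBijectionsInvertible O)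

include hγ he hFac hSBU hQBI

/-- Splitting `g` gives three pairs: `f` with the unary part, the splitting itself, and the
lengthened unary part with the rest. The last one is an instance of `hW`. -/
theorem assoc_iso_of_assocBelow {n : ℕ} (hW : AssocBelow e γ n) {T S R : O} (f : T ⟶ S)
    (g : S ⟶ R) (h : T ⟶ R) (w : f ≫ g = h) [IsIso f] (hn : e.grade T < n) :
    γ.AssocAt f g h w := by
  by_cases hg : e.grade R < e.grade S
  · obtain ⟨p, hp⟩ := hγ.split g hg
    have hκ : e.IsUnary (p.ω ≫ p.π) (incl p.ψ p.q p.a) := by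
      have := p.isIso
      exact p.elementary.isUnary.precomp p.ω _ rfl
    have ht : IsTrivial (fiber p.ψ (cardMap p.ψ (incl p.ψ p.q p.a))) := by
      rw [cardMap_incl]
      exact p.trivial_q
    refine SetComposition.AssocAt.comp_right (f := f) (g := p.ω ≫ p.π) (k := p.ψ) (hh := rfl)
      (hm := (Category.assoc _ _ _).trans p.w)
      (hn := by rw [Category.assoc, Category.assoc, p.w, w])
      (hγ.assoc_iso_unary he hFac hSBU hQBI _ _ _ _ hκ) (hγ.assoc_splitting he p hp)
      (hW _ _ _ _ _ hn (hκ.precomp f _ rfl) ht.isLocalTerminal) (fun q => ?_)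
      (hγ.surjective_of_isUnary he _ _ _ _ hκ ht)
    by_cases hq : q = cardMap p.ψ (incl p.ψ p.q p.a)
    · obtain ⟨a, -, ha⟩ := hκ.induced' (h := g) ((Category.assoc _ _ _).trans p.w) hq.symm
      exact hγ.assoc_iso_unary he hFac hSBU hQBI _ _ _ _ ha
    · have := hκ.isIso_fiberMap' he (h := g) ((Category.assoc _ _ _).trans p.w) hq
      exact hγ.assoc_iso_iso _ _ _ _
  · have := isIso_of_grade_eq he g (le_antisymm (not_lt.1 hg) (Grading.grade_le g))
    exact hγ.assoc_iso_iso _ _ _ _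

/-- Associativity does not depend on the factorization. -/
theorem assoc_transfer {T S S' R : O} (f : T ⟶ S) (g : S ⟶ R) (f' : T ⟶ S') (g' : S' ⟶ R)
    (h : T ⟶ R) (w : f ≫ g = h) (w' : f' ≫ g' = h) {s : Fin (card S)} {s' : Fin (card S')}
    (hf : e.IsUnary f s) (hf' : e.IsUnary f' s') (hs : cardMap g' s' = cardMap g s)
    (hg : IsLocalTerminal (fiber g (cardMap g s)))
    (hg' : IsLocalTerminal (fiber g' (cardMap g' s')))
    (hI : ∀ (ω : S ⟶ S') [IsIso ω] (w : ω ≫ g' = g), γ.AssocAt ω g' g w)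
    (h' : γ.AssocAt f' g' h w') : γ.AssocAt f g h w := by
  -- Over the common position both induced maps go to local terminal objects, and elsewhere both are
  -- invertible. Hence they agree up to isomorphism.
  obtain ⟨ω, hω, rfl, wω⟩ := factorization_unique he hFac hSBU hQBI f g f' g' h w w' (fun k => by
    by_cases hk : k = cardMap g s
    · subst hk
      obtain ⟨a, ha⟩ := nonempty_iso_of_isLocalTerminal (fiberMap f g h w (cardMap g s))
        (fiberMap f' g' h w' (cardMap g s)) hg (by rw [← hs]; exact hg')
      exact ⟨a.hom, inferInstance, ha⟩
    · have := hf.isIso_fiberMap' he w hk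
      have := hf'.isIso_fiberMap' he w' (k := k) (by rw [hs]; exact hk)
      exact ⟨inv (fiberMap f g h w k) ≫ fiberMap f' g' h w' k, inferInstance, by simp⟩)
  exact SetComposition.AssocAt.comp_right (hm := wω)
    (hγ.assoc_unary_iso he hFac hSBU hQBI f ω _ rfl hf) (hI ω wω) h'
    (hγ.assoc_fiberMap_of_isIso he hFac hSBU hQBI f ω g' _ g h rfl wω w' w hf)
    (fun _ v => hγ.surjective_of_isIso _ v)

/-- If `f` collapses the fiber chosen by the splitting, the two factorizations differ by an
isomorphism out of `S`. Its grade is below that of `T`, so `hW` covers this isomorphism. -/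
theorem assoc_of_splitting {n : ℕ} (hW : AssocBelow e γ n) {T S R : O} (f : T ⟶ S)
    (g : S ⟶ R) (h : T ⟶ R) (w : f ≫ g = h) {s : Fin (card S)} (hn : e.grade T ≤ n)
    (hf : e.IsUnary f s) (hg : IsLocalTerminal (fiber g (cardMap g s))) (p : Splitting e h)
    (hp : D.SplitsAlong γ p) (hpq : p.q = cardMap g s) : γ.AssocAt f g h w := by
  have hκ : e.IsUnary (p.ω ≫ p.π) (incl p.ψ p.q p.a) := by
    have := p.isIso
    exact p.elementary.isUnary.precomp p.ω _ rfl
  refine hγ.assoc_transfer he hFac hSBU hQBI f g (p.ω ≫ p.π) p.ψ h w _ hf hκ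
    (by rw [cardMap_incl, hpq]) hg (by rw [cardMap_incl]; exact p.trivial_q.isLocalTerminal)
    (fun ω _ wω => ?_) (hγ.assoc_splitting he p hp)
  exact hγ.assoc_iso_of_assocBelow he hFac hSBU hQBI hW ω _ _ wω (hf.grade_lt.trans_le hn)

omit hγ hFac hSBU hQBI in
theorem grade_fiber_comp_eq_zero {T S R : O} (f : T ⟶ S) (g : S ⟶ R) (h : T ⟶ R) (w : f ≫ g = h)
    {s : Fin (card S)} {t : Fin (card R)} (hf : e.IsUnary f s) (hg : e.IsUnary g t)
    (k : Fin (card R)) (hk : k ≠ t) (hk' : k ≠ cardMap g s) :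
    e.grade (fiber h k) = 0 := by
  have := hf.isIso_fiberMap' he w hk'
  rw [Grading.grade_eq_of_iso (fiberMap f g h w k)]
  exact hg.eq_zero k hk

/-- Associativity for two unary morphisms with disjoint fibers. -/
theorem assoc_disjoint {n : ℕ} (hW : AssocBelow e γ n) {T S R : O} (f : T ⟶ S)
    (g : S ⟶ R) (h : T ⟶ R) (w : f ≫ g = h) {s : Fin (card S)} {t : Fin (card R)}
    (hn : e.grade T ≤ n) (hf : e.IsUnary f s) (hg : e.IsUnary g t) (hst : cardMap g s ≠ t) :
    γ.AssocAt f g h w := by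
  have hgt : IsLocalTerminal (fiber g (cardMap g s)) :=
    isLocalTerminal_of_grade he (hg.eq_zero _ hst)
  have hgr : e.grade R < e.grade T := hg.grade_lt.trans hf.grade_lt
  have hzero := grade_fiber_comp_eq_zero he f g h w hf hg
  obtain ⟨p, hp⟩ := hγ.split h hgr
  by_cases hpq : p.q = cardMap g s
  · exact hγ.assoc_of_splitting he hFac hSBU hQBI hW f g h w hn hf hgt p hp hpq
  obtain ⟨T₁, Q, ω, π, ψ, q, a, hω, hπ, hψ, hq, ht, w₁⟩ := p
  dsimp only at hpq
  have hqT : fiber π (incl ψ q a) = fiber (π ≫ ψ) q :=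
    (fiber_fiberMap π ψ _ rfl q a).trans (hq.fiber_eq _ a)
  have hgrade : ∀ k, e.grade (fiber (π ≫ ψ) k) = e.grade (fiber h k) := fun k =>
    (Grading.grade_eq_of_iso (fiberMap ω (π ≫ ψ) h w₁ k)).symm
  -- Only the fibers of `h` over `|g|(s)` and `t` can have positive grade; the chosen splitting thus
  -- takes the one over `t`, and `ψ` is elementary at `|g|(s)`.
  obtain rfl : q = t := by
    by_contra hqt
    have h1 := hzero q hqt hpq
    rw [← hgrade, ← hqT] at h1
    have := hπ.one_le
    omega
  have hs1 : 1 ≤ e.grade (fiber (π ≫ ψ) (cardMap g s)) := by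
    rw [hgrade, Grading.grade_fiber_comp f g h w]
    obtain ⟨b, hb⟩ := exists_incl_eq g s
    have h1 := Finset.single_le_sum (f := fun b => e.grade (fiber f (incl g (cardMap g s) b)))
      (fun _ _ => Nat.zero_le _) (Finset.mem_univ b)
    rw [hb] at h1
    have := hf.one_le
    omega
  have hg' : ∀ k, k ≠ q → e.grade (fiber ψ k) = e.grade (fiber h k) := fun k hk => by
    have := hπ.isUnary.isIso_fiberMap he (q := q) (a := a) (g := ψ) (h := π ≫ ψ) rfl hk
    rw [← hgrade, Grading.grade_eq_of_iso (fiberMap π ψ (π ≫ ψ) rfl k)]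
  have hord : IsOrderPreserving (π ≫ ψ) := by
    intro x y hxy
    rw [cardMap_comp, cardMap_comp]
    exact hψ (hπ.orderPreserving hxy)
  have hψe : e.IsElementary ψ (cardMap g s) := by
    refine ⟨hψ, ?_, fun k hk => ht k ?_⟩
    · rw [hg' _ hst, ← hgrade]
      exact hs1
    · by_cases hkq : k = q
      · rw [hkq]
        exact Grading.grade_trivial hq
      · rw [hg' k hkq]
        exact hzero k hkq hk
  -- The same morphism is dismantled in the opposite order. Both factors are elementary, as the
  -- disjoint axiom requires, and by transfer the claim may be checked for this factorization
  -- instead of `f`, `g`.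
  obtain ⟨Q₂, π₂, ψ₂, a₂, w₂, hπ₂, hψ₂, hq₂, hk₂⟩ := exists_elementary_factor hSBU (π ≫ ψ) hord
    (cardMap g s) hs1
  have hψ₂e : e.IsElementary ψ₂ q := by
    refine ⟨hψ₂, ?_, fun k hk => ?_⟩
    · rw [hk₂ q (Ne.symm hst), ← hqT]
      exact hπ.one_le
    · by_cases hks : k = cardMap g s
      · rw [hks]
        exact hq₂
      · rw [hk₂ k hks]
        obtain ⟨b⟩ := exists_index (hψe.trivial k hks).isLocalTerminal
        rw [← (fiber_fiberMap π ψ _ rfl k b).trans ((hψe.trivial k hks).fiber_eq _ b)]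
        refine hπ.trivial _ fun hb => hk ?_
        rw [← cardMap_incl ψ k b, hb, cardMap_incl]
  have hw₂ : (ω ≫ π₂) ≫ ψ₂ = h := by rw [Category.assoc, w₂, w₁]
  refine hγ.assoc_transfer he hFac hSBU hQBI f g (ω ≫ π₂) ψ₂ h w hw₂ hf
    (hπ₂.isUnary.precomp ω _ rfl) (cardMap_incl _ _ _) hgt
    (by rw [cardMap_incl]; exact hq₂.isLocalTerminal)
    (fun ω' _ wω => hγ.assoc_iso_of_assocBelow he hFac hSBU hQBI hW ω' _ _ wω
      (hf.grade_lt.trans_le hn)) ?_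
  intro x y z
  have hi₂ : IsIso (fiberMap π₂ ψ₂ (π ≫ ψ) w₂ q) :=
    hπ₂.isUnary.isIso_fiberMap he w₂ (Ne.symm hst)
  have hi : IsIso (fiberMap π ψ (π ≫ ψ) rfl (cardMap g s)) :=
    hπ.isUnary.isIso_fiberMap he rfl hst
  obtain ⟨u, hu⟩ := D.act_surjective (fiberMap ω π₂ (ω ≫ π₂) rfl (incl ψ₂ (cardMap g s) a₂))
    (x (incl ψ₂ (cardMap g s) a₂))
  obtain ⟨b', hb'⟩ := D.act_surjective (fiberMap π ψ (π ≫ ψ) rfl (cardMap g s))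
    (transport X (fiber_eq_of_trivial π₂ ψ₂ (π ≫ ψ) w₂ _ _ (cardMap_incl _ _ _) hq₂) u)
  have ha : transport X hqT (transport X hqT.symm (D.act (fiberMap π₂ ψ₂ (π ≫ ψ) w₂ q) (y q))) =
      D.act (fiberMap π₂ ψ₂ (π ≫ ψ) w₂ q) (y q) := by
    rw [transport_transport, transport_rfl]
  rw [hγ.eval_unary he ω π₂ (ω ≫ π₂) rfl _ hπ₂ x u _ hu.symm, hγ.eval_elementary he ψ₂ q hψ₂e,
    D.disjoint π ψ π₂ ψ₂ (π ≫ ψ) rfl w₂ (cardMap g s) q hst (incl ψ q a)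
      (incl ψ₂ (cardMap g s) a₂) (cardMap_incl _ _ _) (cardMap_incl _ _ _) hπ hψe hπ₂ hψ₂e z (y q) u
      (transport X hqT.symm (D.act (fiberMap π₂ ψ₂ (π ≫ ψ) w₂ q) (y q))) b' ha hb'.symm]
  have hfib : ∀ k, fiberMap ω (π ≫ ψ) h w₁ k ≫ fiberMap π₂ ψ₂ (π ≫ ψ) w₂ k =
      fiberMap (ω ≫ π₂) ψ₂ h hw₂ k := fun k => fiberMap_comp ω π₂ (ω ≫ π₂) ψ₂ (π ≫ ψ) h rfl w₂ hw₂ w₁ k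
  have hfib' : ∀ k, fiberMap ω (π ≫ ψ) h w₁ k ≫ fiberMap π ψ (π ≫ ψ) rfl k =
      fiberMap (ω ≫ π) ψ h ((Category.assoc _ _ _).trans w₁) k := fun k =>
    fiberMap_comp ω π (ω ≫ π) ψ (π ≫ ψ) h rfl rfl ((Category.assoc _ _ _).trans w₁) w₁ k
  have hs : γ (fiberMap (ω ≫ π₂) ψ₂ h hw₂ (cardMap g s))
      (restrict (ω ≫ π₂) ψ₂ h hw₂ x (cardMap g s)) (y (cardMap g s)) =
      D.act (fiberMap ω (π ≫ ψ) h w₁ (cardMap g s))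
        (D.act (fiberMap π ψ (π ≫ ψ) rfl (cardMap g s)) b') := by
    rw [hγ.eval_unary he (fiberMap ω (π ≫ ψ) h w₁ (cardMap g s))
      (fiberMap π₂ ψ₂ (π ≫ ψ) w₂ (cardMap g s)) _ (hfib _) a₂
      (Grading.isElementary_of_isLocalTerminal _ hq₂.isLocalTerminal (hπ₂.one_le_comp w₂) a₂) _
      (transport X (fiber_fiberMap π₂ ψ₂ (π ≫ ψ) w₂ _ a₂) u) _ ?_]
    · rw [D.eq_η hq₂.isLocalTerminal (y _), D.unital _ hq₂ (hπ₂.one_le_comp w₂) a₂, hb',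
        transport_transport]
    · unfold restrict
      rw [← hu]
      exact D.act_fiberMap ω π₂ ψ₂ (ω ≫ π₂) (π ≫ ψ) h rfl w₂ hw₂ w₁ _ a₂ u
  -- The data for the chosen splitting: `b'` over `|g|(s)` and units over the local terminal fibers.
  -- With these its formula becomes the other side of the disjoint axiom.
  obtain ⟨y', hy'⟩ : ∃ y' : ∀ k, X (fiber ψ k), y' (cardMap g s) = b' :=
    ⟨fun k => if hk : k = cardMap g s then transport X (by rw [hk]) b' else
      D.η (fiber ψ k) (hψe.trivial k hk).isLocalTerminal, by dsimp only; rw [dif_pos rfl, transport_rfl]⟩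
  have hsplit := hp (fun k => γ (fiberMap (ω ≫ π₂) ψ₂ h hw₂ k)
    (restrict (ω ≫ π₂) ψ₂ h hw₂ x k) (y k)) y'
    (transport X hqT.symm (D.act (fiberMap π₂ ψ₂ (π ≫ ψ) w₂ q) (y q))) z
  rw [hsplit ?_ ?_, hγ.eval_elementary he ψ _ hψe, hy']
  · intro k hk _
    by_cases hks : k = cardMap g s
    · subst hks
      rw [hs, ← D.act_comp, hy']
      exact D.act_congr (hfib' _) _
    · exact D.eq_of_isLocalTerminal (isLocalTerminal_of_grade he (hzero k hk hks)) _ _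
  · intro _
    dsimp only
    have : IsIso (fiberMap (ω ≫ π₂) ψ₂ h hw₂ q) := by
      rw [← hfib]
      infer_instance
    rw [hγ.iso, ha, ← D.act_comp]
    exact (D.act_congr (hfib q) _).symm

/-- Associativity for unary morphisms that become the only contribution to a fiber of the
composite. -/
theorem assocBelow (n : ℕ) : AssocBelow e γ n := by
  induction n with
  | zero => intro T S R f g h w s hn; omega
  | succ n hW =>
    intro T S R f g h w s hn hf hg
    have hn' : e.grade T ≤ n := by omega
    by_cases hgr : e.grade R < e.grade S
    swap
    · have := isIso_of_grade_eq he g (le_antisymm (not_lt.1 hgr) (Grading.grade_le g))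
      exact hγ.assoc_unary_iso he hFac hSBU hQBI _ _ _ _ hf
    obtain ⟨p, hp⟩ := hγ.split h (hgr.trans hf.grade_lt)
    by_cases hpq : p.q = cardMap g s
    · exact hγ.assoc_of_splitting he hFac hSBU hQBI hW f g h w hn' hf hg p hp hpq
    -- The splitting collapses another fiber than `f`. That fiber is inherited from `g`, so it can
    -- be taken out of `g` as `g₁`, and exchanged with the fiber of `f`.
    have hpos : 1 ≤ e.grade (fiber g p.q) := by
      have := p.isIso
      have := hf.isIso_fiberMap' he w hpq
      rw [← Grading.grade_eq_of_iso (fiberMap f g h w p.q),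
        Grading.grade_eq_of_iso (fiberMap p.ω (p.π ≫ p.ψ) h p.w p.q),
        ← (fiber_fiberMap p.π p.ψ _ rfl p.q p.a).trans (p.trivial_q.fiber_eq _ p.a)]
      exact p.elementary.one_le
    obtain ⟨S₂, g₁, g₂, t, wg, ht, hg₁, hg₂t, hg₂⟩ :=
      exists_unary_factor he hFac hSBU hQBI g p.q hpos
    have hgs : cardMap g₂ (cardMap g₁ s) = cardMap g s := by rw [← cardMap_comp, wg]
    have hst : cardMap g₁ s ≠ t := by
      intro hst
      apply hpq
      rw [← hgs, hst, ht]
    have hts : t ≠ cardMap g₁ s := Ne.symm hst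
    have hpos' : 1 ≤ e.grade (fiber (f ≫ g₁) t) := by
      have := hf.isIso_fiberMap' he (g := g₁) (h := f ≫ g₁) rfl hts
      rw [Grading.grade_eq_of_iso (fiberMap f g₁ (f ≫ g₁) rfl t)]
      exact hg₁.one_le
    -- `f ≫ g₁` is rewritten in the opposite order: `μ` removes the fiber over `t`, as the chosen
    -- splitting does, and `χ` the one over `|g₁|(s)`.
    obtain ⟨S₃, μ, χ, m, wμ, hm, hμ, hχt, hχ⟩ :=
      exists_unary_factor he hFac hSBU hQBI (f ≫ g₁) t hpos'
    have hχs : e.IsUnary χ (cardMap g₁ s) := by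
      refine ⟨?_, fun k hk => ?_⟩
      · rw [hχ _ hst, Grading.grade_fiber_comp f g₁ _ rfl]
        obtain ⟨b, hb⟩ := exists_incl_eq g₁ s
        have h1 := Finset.single_le_sum (f := fun b => e.grade (fiber f (incl g₁ (cardMap g₁ s) b)))
          (fun _ _ => Nat.zero_le _) (Finset.mem_univ b)
        rw [hb] at h1
        have := hf.one_le
        omega
      · by_cases hkt : k = t
        · rw [hkt]
          exact Grading.grade_trivial hχt
        · rw [hχ k hkt]
          exact grade_fiber_comp_eq_zero he f g₁ _ rfl hf hg₁ k hkt hk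
    have hg₂s : IsLocalTerminal (fiber g₂ (cardMap g₂ (cardMap g₁ s))) := by
      apply isLocalTerminal_of_grade (e := e) he
      rw [hg₂ _ (by rw [hgs]; exact Ne.symm hpq), hgs]
      exact Grading.grade_localTerminal hg
    have hg₂t' : IsTrivial (fiber g₂ (cardMap g₂ t)) := by
      rw [ht]
      exact hg₂t
    have hne : cardMap g₂ (cardMap g₁ s) ≠ cardMap g₂ t := by
      rw [hgs, ht]
      exact Ne.symm hpq
    have wn : (f ≫ g₁) ≫ g₂ = h := by rw [Category.assoc, wg, w]
    have wμ' : μ ≫ χ ≫ g₂ = h := by rw [← Category.assoc, wμ, wn]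
    -- In the pentagon for `f`, `g₁`, `g₂` the first pair is disjoint and the second starts in
    -- smaller grade; the pair `(f ≫ g₁, g₂)` is left.
    refine SetComposition.AssocAt.comp_right (hm := wg) (hn := wn)
      (hγ.assoc_disjoint he hFac hSBU hQBI hW f g₁ _ rfl hn' hf hg₁ hst)
      (hW g₁ g₂ g wg t (hf.grade_lt.trans_le hn') hg₁ hg₂t'.isLocalTerminal) ?_
      (hγ.assoc_fiberMap_of_ne he hFac hSBU hQBI f g₁ g₂ _ g h rfl wg wn w hf hg₁
        (by rw [← hgs]; exact hne))
      (hγ.surjective_of_isUnary he _ _ _ _ hg₁ hg₂t')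
    -- The remaining pair is reached from `μ`, `χ`, `g₂`. The outer pair `(μ, χ ≫ g₂)` collapses the
    -- fiber chosen by `p`, so `assoc_of_splitting` applies.
    refine SetComposition.AssocAt.comp_left (hh := wμ) (hm := rfl) (hf := wμ')
      (hγ.assoc_disjoint he hFac hSBU hQBI hW μ χ _ wμ hn' hμ hχs (by rw [hm]; exact hts))
      (hW χ g₂ _ rfl _ (hμ.grade_lt.trans_le hn') hχs hg₂s)
      (hγ.assoc_of_splitting he hFac hSBU hQBI hW μ (χ ≫ g₂) h wμ' hn' hμ ?_ p hp
        (by rw [cardMap_comp, hm, ht]))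
      (hγ.assoc_fiberMap_of_ne he hFac hSBU hQBI μ χ g₂ (f ≫ g₁) _ h wμ rfl wn wμ' hμ hχs
        (by rw [cardMap_comp, hm]; exact Ne.symm hne))
      (hγ.surjective_of_isUnary he _ _ _ _ hμ (by rw [hm]; exact hχt))
    apply isLocalTerminal_of_grade (e := e) he
    rw [Grading.grade_fiber_comp χ g₂ _ rfl, cardMap_comp, hm, Grading.grade_trivial hg₂t', zero_add]
    refine Finset.sum_eq_zero fun b _ => ?_
    obtain ⟨c, hc⟩ := exists_incl_eq g₂ t
    rw [incl_unique g₂ _ hg₂t'.isLocalTerminal b c, hc]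
    exact Grading.grade_trivial hχt

theorem assoc_iso {T S R : O} (f : T ⟶ S) (g : S ⟶ R) (h : T ⟶ R) (w : f ≫ g = h) [IsIso f] :
    γ.AssocAt f g h w :=
  hγ.assoc_iso_of_assocBelow he hFac hSBU hQBI (hγ.assocBelow he hFac hSBU hQBI _) f g h w
    (Nat.lt_succ_self _)

/-- If the fiber of `g` under that of `f` has positive grade, it is taken out of `g` as `g₁`. Then
`f` and `g₁` have joint fibers, and what remains of `g` is trivial at this position, where
`assocBelow` applies. -/
theorem assoc_unary {T S R : O} (f : T ⟶ S) (g : S ⟶ R) (h : T ⟶ R) (w : f ≫ g = h)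
    {s : Fin (card S)} (hf : e.IsUnary f s) : γ.AssocAt f g h w := by
  have hW := fun n => hγ.assocBelow he hFac hSBU hQBI n
  by_cases hg : 1 ≤ e.grade (fiber g (cardMap g s))
  swap
  · exact hW _ f g h w s (Nat.lt_succ_self _) hf (isLocalTerminal_of_grade he (by omega))
  obtain ⟨S₂, g₁, g₂, t, wg, ht, hg₁, hg₂t, hg₂⟩ :=
    exists_unary_factor he hFac hSBU hQBI g _ hg
  have hgs : cardMap g₂ (cardMap g₁ s) = cardMap g s := by rw [← cardMap_comp, wg]
  have hst : t = cardMap g₁ s := by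
    obtain ⟨c, hc⟩ := exists_incl_eq g₂ t
    obtain ⟨d, hd⟩ := exists_incl_eq g₂ (cardMap g₁ s)
    rw [← hc, ← hd]
    generalize cardMap g₂ t = q at c ht
    generalize cardMap g₂ (cardMap g₁ s) = q' at d hgs
    subst hgs ht
    rw [incl_unique g₂ _ hg₂t.isLocalTerminal c d]
  subst hst
  have hg₂t' : IsTrivial (fiber g₂ (cardMap g₂ (cardMap g₁ s))) := by
    rw [ht]
    exact hg₂t
  have wn : (f ≫ g₁) ≫ g₂ = h := by rw [Category.assoc, wg, w]
  refine SetComposition.AssocAt.comp_right (hh := rfl) (hm := wg) (hn := wn)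
    (hγ.assoc_unary_unary he hFac hSBU hQBI f g₁ _ rfl hf hg₁)
    (hW _ g₁ g₂ g wg _ (Nat.lt_succ_self _) hg₁ hg₂t'.isLocalTerminal)
    (hW _ _ g₂ h wn _ (Nat.lt_succ_self _) (hf.comp_of_eq_zero rfl hg₁.eq_zero)
      hg₂t'.isLocalTerminal) (fun q => ?_)
    (hγ.surjective_of_isUnary he _ _ _ _ hg₁ hg₂t')
  by_cases hq : q = cardMap g s
  · obtain ⟨a, -, ha⟩ := hf.induced' w hq.symm
    obtain ⟨b, -, hb⟩ := hg₁.induced' wg (ht.trans hq.symm)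
    refine hγ.assoc_unary_unary he hFac hSBU hQBI _ _ _ _ ha ?_
    rw [incl_unique g₂ q (by rw [hq]; exact hg₂t.isLocalTerminal) (cardMap _ a) b]
    exact hb
  · have := hf.isIso_fiberMap' he w hq
    have := hg₁.isIso_fiberMap' he wg (k := q) (by rw [ht]; exact hq)
    exact hγ.assoc_iso_iso _ _ _ _

/-- Associativity of the composition operations. -/
theorem assoc {T S R : O} (f : T ⟶ S) (g : S ⟶ R) (h : T ⟶ R) (w : f ≫ g = h) :
    γ.AssocAt f g h w := by
  induction hn : e.grade T using Nat.strong_induction_on generalizing T S with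
  | _ n ih =>
    by_cases hfr : e.grade S < e.grade T
    swap
    · have := isIso_of_grade_eq he f (le_antisymm (not_lt.1 hfr) (Grading.grade_le f))
      exact hγ.assoc_iso he hFac hSBU hQBI _ _ _ _
    obtain ⟨p, hp⟩ := hγ.split f hfr
    have hκ : e.IsUnary (p.ω ≫ p.π) (incl p.ψ p.q p.a) := by
      have := p.isIso
      exact p.elementary.isUnary.precomp p.ω _ rfl
    have wf : (p.ω ≫ p.π) ≫ p.ψ = f := (Category.assoc _ _ _).trans p.w
    have wh : (p.ω ≫ p.π) ≫ p.ψ ≫ g = h := by rw [← Category.assoc, wf, w]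
    -- One fiber is peeled off `f`. Its last factor has a source of smaller grade, and on fibers the
    -- peeled part is unary or invertible.
    refine SetComposition.AssocAt.comp_left (hh := wf) (hm := rfl) (hf := wh)
      (hγ.assoc_splitting he p hp)
      (ih _ (by rw [← hn]; exact hκ.grade_lt) _ _ _ rfl rfl)
      (hγ.assoc_unary he hFac hSBU hQBI _ _ _ _ hκ) (fun q => ?_)
      (hγ.surjective_of_isUnary he _ _ _ _ hκ (by rw [cardMap_incl]; exact p.trivial_q))
    by_cases hq : q = cardMap (p.ψ ≫ g) (incl p.ψ p.q p.a)
    · obtain ⟨a, -, ha⟩ := hκ.induced' wh hq.symm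
      exact hγ.assoc_unary he hFac hSBU hQBI _ _ _ _ ha
    · have := hκ.isIso_fiberMap' he wh hq
      exact hγ.assoc_iso he hFac hSBU hQBI _ _ _ _

end Associativity

end SetMarkl.IsGenerated

/-! ### Maps of families of sets with composition operations -/

section Commutes

variable {O : Type u} {X : O → Type w} {X' : O → Type*}

theorem apply_transport (τ : ∀ T, X T → X' T) {T S : O} (h : T = S) (x : X T) :
    τ S (transport X h x) = transport X' h (τ T x) := by
  subst h
  rfl

variable [Category.{v} O] [OperadicCategory O]

/-- Compatibility of a family of maps with the composition operations along `f`. -/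
def SetComposition.CommutesAt (γ : SetComposition X) (γ' : SetComposition X')
    (τ : ∀ T, X T → X' T) {T S : O} (f : T ⟶ S) : Prop :=
  ∀ x z, τ T (γ f x z) = γ' f (fun i => τ _ (x i)) (τ S z)

/-- Associativity on both sides turns compatibility for the factors, and on fibers, into
compatibility for the composite. Surjectivity again allows the arguments to be decomposed. -/
theorem SetComposition.CommutesAt.comp {γ : SetComposition X} {γ' : SetComposition X'}
    {τ : ∀ T, X T → X' T} {T S R : O} {f : T ⟶ S} {g : S ⟶ R} {h : T ⟶ R} (w : f ≫ g = h)
    (hγ : γ.AssocAt f g h w) (hγ' : γ'.AssocAt f g h w) (hf : γ.CommutesAt γ' τ f)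
    (hg : γ.CommutesAt γ' τ g) (hi : ∀ i, γ.CommutesAt γ' τ (fiberMap f g h w i))
    (hs : ∀ r (v : X (fiber h r)), ∃ x y, γ (fiberMap f g h w r) x y = v) :
    γ.CommutesAt γ' τ h := by
  intro v z
  choose x' y hx using fun r => hs r (v r)
  obtain ⟨x, hx'⟩ := exists_restrict_eq f g h w x'
  have hv : v = fun r => γ (fiberMap f g h w r) (restrict f g h w x r) (y r) := by
    funext r
    rw [hx', hx]
  rw [hv, ← hγ, hf, hg, hγ']
  congr 1
  funext i
  rw [hi]
  congr 1
  funext a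
  exact (apply_transport τ _ _).symm

variable {e : Grading O} {D : SetMarkl e X} {γ : SetComposition X} {γ' : SetComposition X'}
  {τ : ∀ T, X T → X' T}

/-- Maps that are compatible with the composition along isomorphisms and elementary morphisms are
compatible with all compositions. -/
theorem SetMarkl.IsGenerated.commutesAt
    (he : ∀ {S T : O} (f : S ⟶ T), IsIso f ↔ e.gradeHom f = 0)
    (hFac : Factorizable O) (hSBU : BlowUp O) (hQBI : QuasiBijectionsInvertible O)
    (hγ : D.IsGenerated γ)
    (hγ' : ∀ {T S R : O} (f : T ⟶ S) (g : S ⟶ R) (h : T ⟶ R) (w : f ≫ g = h),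
      γ'.AssocAt f g h w)
    (hiso : ∀ {T S : O} (f : T ⟶ S) [IsIso f], γ.CommutesAt γ' τ f)
    (helem : ∀ {T S : O} (f : T ⟶ S) (i), e.IsElementary f i → γ.CommutesAt γ' τ f)
    {T S : O} (f : T ⟶ S) : γ.CommutesAt γ' τ f := by
  have hun : ∀ {T S : O} (f : T ⟶ S) (i), e.IsUnary f i → γ.CommutesAt γ' τ f := by
    intro T S f i hf
    obtain ⟨T', ω, φ, hω, w, hφ⟩ := hf.exists_elementary he hFac hSBU hQBI
    exact .comp w (hγ.assoc he hFac hSBU hQBI _ _ _ _) (hγ' _ _ _ _) (hiso ω) (helem φ i hφ)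
      (fun _ => hiso _) fun r v => hγ.surjective_of_isIso _ v
  induction hn : e.grade T using Nat.strong_induction_on generalizing T S with
  | _ n ih =>
    by_cases hf : e.grade S < e.grade T
    swap
    · have := isIso_of_grade_eq he f (le_antisymm (not_lt.1 hf) (Grading.grade_le f))
      exact hiso f
    -- The unary part of a splitting is covered by `hun`, the last factor by induction on the grade.
    obtain ⟨p⟩ := nonempty_splitting he hFac hSBU hQBI f hf
    have hκ : e.IsUnary (p.ω ≫ p.π) (incl p.ψ p.q p.a) := by
      have := p.isIso
      exact p.elementary.isUnary.precomp p.ω _ rfl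
    have wf : (p.ω ≫ p.π) ≫ p.ψ = f := (Category.assoc _ _ _).trans p.w
    refine .comp wf (hγ.assoc he hFac hSBU hQBI _ _ _ _) (hγ' _ _ _ _) (hun _ _ hκ)
      (ih _ (by rw [← hn]; exact hκ.grade_lt) _ rfl) (fun q => ?_)
      (hγ.surjective_of_isUnary he _ _ _ _ hκ (by rw [cardMap_incl]; exact p.trivial_q))
    by_cases hq : q = cardMap p.ψ (incl p.ψ p.q p.a)
    · obtain ⟨a, -, ha⟩ := hκ.induced' wf hq.symm
      exact hun _ _ ha
    · have := hκ.isIso_fiberMap' he wf hq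
      exact hiso _

end Commutes

/-! ### Compositions of generalized elements -/

section Evaluation

variable {O : Type u} {V : Type u'} [Category.{v'} V] [MonoidalCategory V] [SymmetricCategory V]

theorem transport_eq_map (E : O → V) {T S : O} (h : T = S) (x : GenElem (E T)) :
    transport (fun T => GenElem (E T)) h x = GenElem.map (eqToHom (congrArg E h)) x := by
  subst h
  exact (GenElem.map_id x).symm

variable [Category.{v} O] [OperadicCategory O]

namespace GenElem

/-- The composition operations on generalized elements induced by composition morphisms. -/
def composition {E : O → V}
    (γ : ∀ {T S : O} (f : T ⟶ S), tensorFibers E f ⊗ E S ⟶ E T) :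
    SetComposition fun T => GenElem (E T) :=
  fun _ S f x z => map (γ f) (tens (tuple (A := fun i => E (fiber f i)) x
    (List.finRange (card S))) z)

/-- `regroup` only renames, concatenates and reorders factors, so on elements it reassembles a
family from its restrictions. -/
theorem map_regroup {E : O → V} {T S R : O} (f : T ⟶ S) (g : S ⟶ R) (h : T ⟶ R)
    (w : f ≫ g = h) (x : ∀ j, GenElem (E (fiber f j))) :
    map (regroup E f g h w)
      (tuple (A := fun i => tensorFibers E (fiberMap f g h w i))
        (fun i => tuple (A := fun a => E (fiber (fiberMap f g h w i) a))
          (restrict (X := fun T => GenElem (E T)) f g h w x i) (List.finRange (card (fiber g i))))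
        (List.finRange (card R))) =
      tuple (A := fun j => E (fiber f j)) x (List.finRange (card S)) := by
  unfold regroup
  rw [map_comp, map_comp, map_tensorListMap]
  have h1 : ∀ i, map (tensorList.map (fun a => eqToHom (congrArg E
        (fiber_fiberMap f g h w i a).symm)) (List.finRange (card (fiber g i))) ≫
      tensorList.reindex (fun j => E (fiber f j)) (incl g i)
        (List.finRange (card (fiber g i))))
      (tuple (A := fun a => E (fiber (fiberMap f g h w i) a))
        (restrict (X := fun T => GenElem (E T)) f g h w x i) (List.finRange (card (fiber g i)))) =
      tuple (A := fun j => E (fiber f j)) x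
        ((List.finRange (card (fiber g i))).map (incl g i)) := by
    intro i
    rw [map_comp, map_tensorListMap, ← map_reindex]
    refine congrArg _ (tuple_congr fun a _ => ?_)
    refine (transport_eq_map E (fiber_fiberMap f g h w i a).symm _).symm.trans ?_
    unfold restrict
    rw [transport_transport, transport_rfl]
  rw [tuple_congr fun i _ => h1 i, map_flatten, map_reorder]

variable {E : O → V} (γ : ∀ {T S : O} (f : T ⟶ S), tensorFibers E f ⊗ E S ⟶ E T)

/-- This and `map_composite'` translate the two sides of the associativity diagram in `V` into the
two sides of `AssocAt`. -/
theorem map_composite {T S R : O} (f : T ⟶ S) (g : S ⟶ R) (h : T ⟶ R)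
    (w : f ≫ g = h) (x : ∀ j, GenElem (E (fiber f j))) (y : ∀ i, GenElem (E (fiber g i)))
    (z : GenElem (E R)) :
    map ((tensorList (fun i => tensorFibers E (fiberMap f g h w i)) (List.finRange (card R)) ◁
        γ g) ≫ (regroup E f g h w ▷ E S) ≫ γ f)
      (tens (tuple (A := fun i => tensorFibers E (fiberMap f g h w i))
        (fun i => tuple (A := fun a => E (fiber (fiberMap f g h w i) a))
          (restrict (X := fun T => GenElem (E T)) f g h w x i) (List.finRange (card (fiber g i))))
        (List.finRange (card R))) (tens (tuple (A := fun i => E (fiber g i)) y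
          (List.finRange (card R))) z)) = composition γ f x (composition γ g y z) := by
  rw [map_comp, map_comp, map_whiskerLeft, map_whiskerRight, map_regroup]
  rfl

theorem map_composite' {T S R : O} (f : T ⟶ S) (g : S ⟶ R) (h : T ⟶ R)
    (w : f ≫ g = h) (x : ∀ j, GenElem (E (fiber f j))) (y : ∀ i, GenElem (E (fiber g i)))
    (z : GenElem (E R)) :
    map ((α_ _ (tensorFibers E g) (E R)).inv ≫
        (tensorList.zip (fun i => tensorFibers E (fiberMap f g h w i))
            (fun i => E (fiber g i)) (List.finRange (card R)) ▷ E R) ≫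
        (tensorList.map (fun i => γ (fiberMap f g h w i)) (List.finRange (card R)) ▷ E R) ≫ γ h)
      (tens (tuple (A := fun i => tensorFibers E (fiberMap f g h w i))
        (fun i => tuple (A := fun a => E (fiber (fiberMap f g h w i) a))
          (restrict (X := fun T => GenElem (E T)) f g h w x i) (List.finRange (card (fiber g i))))
        (List.finRange (card R))) (tens (tuple (A := fun i => E (fiber g i)) y
          (List.finRange (card R))) z)) =
      composition γ h (fun i => composition γ (fiberMap f g h w i)
        (restrict (X := fun T => GenElem (E T)) f g h w x i) (y i)) z := by
  rw [map_comp, map_comp, map_comp, map_associator_inv, map_whiskerRight, map_zip,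
    map_whiskerRight, map_tensorListMap]
  rfl

end GenElem

open GenElem

theorem Operad.assocAt (P : Operad O V) {T S R : O} (f : T ⟶ S) (g : S ⟶ R) (h : T ⟶ R)
    (w : f ≫ g = h) : (composition P.γ).AssocAt f g h w := by
  intro x y z
  rw [← map_composite P.γ f g h w, P.assoc, map_composite']

end Evaluation

/-! ### Circle products from composition operations, for families of sets -/

section SetOperad

variable {O : Type u} [Category.{v} O] [OperadicCategory O]

/-- Operads in sets, with extended units. -/
structure SetOperad (X : O → Type w) where
  γ : SetComposition X
  η (t : O) (ht : IsLocalTerminal t) : X t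
  assoc {T S R : O} (f : T ⟶ S) (g : S ⟶ R) (h : T ⟶ R) (w : f ≫ g = h) : γ.AssocAt f g h w
  id_γ {T : O} (x : ∀ i, X (fiber (𝟙 T) i)) (hx : ∀ i (hi : IsLocalTerminal _), x i = η _ hi)
    (z : X T) : γ (𝟙 T) x z = z
  γ_unit {T U : O} (hU : IsTrivial U) (f : T ⟶ U) (x : ∀ i, X (fiber f i)) (i : Fin (card U)) :
    γ f x (η U hU.isLocalTerminal) = transport X (hU.fiber_eq f i) (x i)
  η_γ {s t : O} (f : s ⟶ t) (hs : IsLocalTerminal s) (ht : IsLocalTerminal t)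
    (x : ∀ i, X (fiber f i)) (hx : ∀ i (hi : IsLocalTerminal _), x i = η _ hi) :
    γ f x (η t ht) = η s hs

namespace SetOperad

variable {X : O → Type w} (P : SetOperad X)

open scoped Classical in
/-- The family with the element `u` at the index `i` and extended units elsewhere. -/
noncomputable def insert {T S : O} (f : T ⟶ S) (i : Fin (card S))
    (hf : ∀ j, j ≠ i → IsLocalTerminal (fiber f j)) (u : X (fiber f i)) (j : Fin (card S)) :
    X (fiber f j) :=
  if h : i = j then transport X (by rw [h]) u else P.η _ (hf j (Ne.symm h))

theorem insert_self {T S : O} (f : T ⟶ S) (i : Fin (card S))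
    (hf : ∀ j, j ≠ i → IsLocalTerminal (fiber f j)) (u : X (fiber f i)) :
    P.insert f i hf u i = u := dif_pos rfl

theorem insert_ne {T S : O} (f : T ⟶ S) (i : Fin (card S))
    (hf : ∀ j, j ≠ i → IsLocalTerminal (fiber f j)) (u : X (fiber f i)) (j : Fin (card S))
    (hj : j ≠ i) : P.insert f i hf u j = P.η _ (hf j hj) := dif_neg (Ne.symm hj)

theorem transport_η {s t : O} (h : s = t) (hs : IsLocalTerminal s) (ht : IsLocalTerminal t) :
    transport X h (P.η s hs) = P.η t ht := by
  subst h
  rfl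

theorem restrict_insert {T S R : O} (f : T ⟶ S) (g : S ⟶ R) (h : T ⟶ R) (w : f ≫ g = h)
    (i : Fin (card R)) (a : Fin (card (fiber g i)))
    (hf : ∀ j, j ≠ incl g i a → IsLocalTerminal (fiber f j)) (u : X (fiber f (incl g i a)))
    (hf' : ∀ b, b ≠ a → IsLocalTerminal (fiber (fiberMap f g h w i) b)) :
    restrict f g h w (P.insert f (incl g i a) hf u) i =
      P.insert (fiberMap f g h w i) a hf' (transport X (fiber_fiberMap f g h w i a) u) := by
  funext b
  unfold restrict
  by_cases hb : b = a
  · subst hb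
    rw [P.insert_self, P.insert_self]
  · rw [P.insert_ne _ _ _ _ _ hb, P.insert_ne _ _ _ _ _ fun h => hb ((incl g i).injective h)]
    exact P.transport_η _ _ _

theorem restrict_insert_ne {T S R : O} (f : T ⟶ S) (g : S ⟶ R) (h : T ⟶ R) (w : f ≫ g = h)
    (j : Fin (card S)) (hf : ∀ k, k ≠ j → IsLocalTerminal (fiber f k)) (u : X (fiber f j))
    (i : Fin (card R)) (hi : i ≠ cardMap g j) (b : Fin (card (fiber g i)))
    (hb : IsLocalTerminal (fiber (fiberMap f g h w i) b)) :
    restrict f g h w (P.insert f j hf u) i b = P.η _ hb := by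
  unfold restrict
  rw [P.insert_ne _ _ _ _ _ fun hj => hi (by rw [← hj, cardMap_incl])]
  exact P.transport_η _ _ _

/-- The action of isomorphisms. -/
def act {S T : O} (f : S ⟶ T) [IsIso f] (z : X T) : X S :=
  P.γ f (fun i => P.η _ (fiber_isLocalTerminal (asIso f) i)) z

/-- The circle products. -/
noncomputable def circ {e : Grading O} {T S : O} (φ : T ⟶ S) (i : Fin (card S))
    (hφ : e.IsElementary φ i) (z : X S) (u : X (fiber φ i)) : X T :=
  P.γ φ (P.insert φ i (fun j hj => (hφ.trivial j hj).isLocalTerminal) u) z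

theorem act_id {T : O} (x : X T) : P.act (𝟙 T) x = x :=
  P.id_γ _ (fun _ _ => rfl) x

theorem γ_γ {T S R : O} (f : T ⟶ S) (g : S ⟶ R) (h : T ⟶ R) (w : f ≫ g = h)
    (x : ∀ i, X (fiber f i)) (y : ∀ i, X (fiber g i)) (z : X R) (v : ∀ i, X (fiber h i))
    (hv : ∀ i, P.γ (fiberMap f g h w i) (restrict f g h w x i) (y i) = v i) :
    P.γ f x (P.γ g y z) = P.γ h v z := by
  rw [P.assoc f g h w]
  congr 1
  exact funext hv

theorem act_comp {T S R : O} (f : T ⟶ S) (g : S ⟶ R) [IsIso f] [IsIso g] (x : X R) :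
    P.act (f ≫ g) x = P.act f (P.act g x) :=
  (P.γ_γ f g _ rfl _ _ _ _ fun _ =>
    P.η_γ _ _ _ _ fun _ _ => by unfold restrict; exact P.transport_η _ _ _).symm

theorem act_congr {S T : O} {f g : S ⟶ T} [IsIso f] [IsIso g] (h : f = g) (x : X T) :
    P.act f x = P.act g x := by
  subst h
  rfl

theorem act_eqToHom {S T : O} (h : S = T) (x : X T) :
    P.act (eqToHom h) x = transport X h.symm x := by
  subst h
  exact P.act_id x

theorem act_η {s t : O} (f : s ⟶ t) [IsIso f] (hs : IsLocalTerminal s) (ht : IsLocalTerminal t) :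
    P.act f (P.η t ht) = P.η s hs :=
  P.η_γ f hs ht _ fun _ _ => rfl

variable {e : Grading O}

theorem joint {T S R : O} (φ : T ⟶ S) (ψ : S ⟶ R) (ξ : T ⟶ R) (w : φ ≫ ψ = ξ) (i : Fin (card R))
    (a : Fin (card (fiber ψ i))) (hφ : e.IsElementary φ (incl ψ i a))
    (hψ : e.IsElementary ψ i) (z : X R) (y : X (fiber ψ i)) (x : X (fiber φ (incl ψ i a))) :
    P.circ φ (incl ψ i a) hφ (P.circ ψ i hψ z y) x =
      P.circ ξ i (hφ.comp w hψ) z (P.circ (fiberMap φ ψ ξ w i) a (hφ.fiberMap w) y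
        (transport X (fiber_fiberMap φ ψ ξ w i a) x)) := by
  refine P.γ_γ φ ψ ξ w _ _ z _ fun k => ?_
  -- Away from `i` only extended units are composed, which gives an extended unit; at `i` the joint
  -- circle product remains.
  by_cases hk : k = i
  · subst hk
    rw [P.insert_self, P.insert_self, P.restrict_insert]
    rfl
  · rw [P.insert_ne _ _ _ _ _ hk, P.insert_ne _ _ _ _ _ hk]
    exact P.η_γ _ _ _ _ fun b hb => P.restrict_insert_ne _ _ _ _ _ _ _ _
      (by rw [cardMap_incl]; exact hk) _ _

theorem unital {T U : O} (f : T ⟶ U) (hU : IsTrivial U) (i : Fin (card U))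
    (hf : e.IsElementary f i) (x : X (fiber f i)) :
    P.circ f i hf (P.η U hU.isLocalTerminal) x = transport X (hU.fiber_eq f i) x := by
  refine (P.γ_unit hU f _ i).trans ?_
  rw [P.insert_self]

/-- The element `a` lives over `k`. Over `i` it leaves only units behind, and composing with units
along an isomorphism is the action. -/
theorem γ_insert_of_ne {T P' S : O} (φ : T ⟶ P') (ψ : P' ⟶ S) (ξ : T ⟶ S) (w : φ ≫ ψ = ξ)
    {i k : Fin (card S)} (hik : i ≠ k) {j : Fin (card P')} (hj : cardMap ψ j = k)
    (hφ : e.IsElementary φ j) [IsIso (fiberMap φ ψ ξ w i)] (a : X (fiber φ j))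
    (b : X (fiber ψ i)) :
    P.γ (fiberMap φ ψ ξ w i) (restrict φ ψ ξ w (P.insert φ j
      (fun l hl => (hφ.trivial l hl).isLocalTerminal) a) i) b = P.act (fiberMap φ ψ ξ w i) b := by
  unfold act
  congr 1
  funext c
  exact P.restrict_insert_ne _ _ _ _ _ _ _ _ (by rw [hj]; exact hik) _ _

theorem γ_insert_unit {T P' S : O} (φ : T ⟶ P') (ψ : P' ⟶ S) (ξ : T ⟶ S) (w : φ ≫ ψ = ξ)
    {k : Fin (card S)} {j : Fin (card P')} (hj : cardMap ψ j = k) (ht : IsTrivial (fiber ψ k))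
    (hφ : e.IsElementary φ j) (a : X (fiber φ j)) :
    P.γ (fiberMap φ ψ ξ w k) (restrict φ ψ ξ w (P.insert φ j
      (fun l hl => (hφ.trivial l hl).isLocalTerminal) a) k) (P.η _ ht.isLocalTerminal) =
      transport X (fiber_eq_of_trivial φ ψ ξ w j k hj ht) a := by
  obtain ⟨c, hc⟩ : ∃ c, incl ψ k c = j := by
    subst hj
    exact exists_incl_eq ψ j
  subst hc
  rw [P.γ_unit ht _ _ c]
  unfold restrict
  rw [P.insert_self, transport_transport]

/-- By associativity both iterated products are compositions along `ξ` of families of elements over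
its fibers, and the two families agree: over `i` and `k` by `h₂` and `h₁`, elsewhere because both
entries are extended units. -/
theorem disjoint {T P' P'' S : O} (φ' : T ⟶ P') (ψ' : P' ⟶ S) (φ'' : T ⟶ P'') (ψ'' : P'' ⟶ S)
    (ξ : T ⟶ S) (w' : φ' ≫ ψ' = ξ) (w'' : φ'' ≫ ψ'' = ξ)
    (i k : Fin (card S)) (hik : i ≠ k) (j : Fin (card P')) (l : Fin (card P''))
    (hj : cardMap ψ' j = k) (hl : cardMap ψ'' l = i)
    (hφ' : e.IsElementary φ' j) (hψ' : e.IsElementary ψ' i)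
    (hφ'' : e.IsElementary φ'' l) (hψ'' : e.IsElementary ψ'' k)
    [IsIso (fiberMap φ'' ψ'' ξ w'' k)] [IsIso (fiberMap φ' ψ' ξ w' i)]
    (z : X S) (a'' : X (fiber ψ'' k)) (b'' : X (fiber φ'' l)) (a' : X (fiber φ' j))
    (b' : X (fiber ψ' i))
    (h₁ : transport X (fiber_eq_of_trivial φ' ψ' ξ w' j k hj (hψ'.trivial k hik.symm)) a' =
      P.act (fiberMap φ'' ψ'' ξ w'' k) a'')
    (h₂ : transport X (fiber_eq_of_trivial φ'' ψ'' ξ w'' l i hl (hψ''.trivial i hik)) b'' =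
      P.act (fiberMap φ' ψ' ξ w' i) b') :
    P.circ φ'' l hφ'' (P.circ ψ'' k hψ'' z a'') b'' =
      P.circ φ' j hφ' (P.circ ψ' i hψ' z b') a' := by
  unfold circ
  rw [P.assoc φ'' ψ'' ξ w'', P.assoc φ' ψ' ξ w']
  congr 1
  funext r
  by_cases hri : r = i
  · subst hri
    rw [P.insert_ne _ _ _ _ _ hik, P.γ_insert_unit _ _ _ _ hl (hψ''.trivial _ hik) hφ'', h₂,
      P.insert_self, P.γ_insert_of_ne _ _ _ _ hik hj hφ']
  by_cases hrk : r = k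
  · subst hrk
    rw [P.insert_ne ψ' _ _ _ _ hri, P.γ_insert_unit _ _ _ _ hj (hψ'.trivial _ hri) hφ', h₁,
      P.insert_self, P.γ_insert_of_ne _ _ _ _ hri hl hφ'']
  rw [P.insert_ne _ _ _ _ _ hri, P.insert_ne _ _ _ _ _ hrk]
  have ht : IsLocalTerminal (fiber ξ r) := by
    obtain ⟨c⟩ := exists_index (hψ'.trivial r hri).isLocalTerminal
    rw [← fiber_eq_of_trivial φ' ψ' ξ w' _ r (cardMap_incl ψ' r c) (hψ'.trivial r hri)]
    refine (hφ'.trivial _ fun hc => hrk ?_).isLocalTerminal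
    rw [← hj, ← hc, cardMap_incl]
  rw [P.η_γ _ ht _ _ fun b hb => P.restrict_insert_ne _ _ _ _ _ _ _ _ (by rw [hl]; exact hri) _ _,
    P.η_γ _ ht _ _ fun b hb => P.restrict_insert_ne _ _ _ _ _ _ _ _ (by rw [hj]; exact hrk) _ _]

/-- Both sides are compositions along `φ`. Over `j` the entries agree by `h`; over any other point
both are the extended unit of a local terminal fiber. -/
theorem equivariant {T' T'' S' S'' : O} (ω : T' ⟶ T'') (σ : S' ⟶ S'') [IsIso ω] [IsIso σ]
    (φ' : T' ⟶ S') (φ'' : T'' ⟶ S'') (φ : T' ⟶ S'') (w' : φ' ≫ σ = φ) (w'' : ω ≫ φ'' = φ)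
    (j : Fin (card S'')) (a : Fin (card (fiber σ j)))
    (hφ' : e.IsElementary φ' (incl σ j a)) (hφ'' : e.IsElementary φ'' j)
    (z : X S'') (x : X (fiber φ' (incl σ j a))) (y : X (fiber φ'' j))
    (h : P.act (fiberMap ω φ'' φ w'' j) y =
      P.circ (fiberMap φ' σ φ w' j) a (Grading.isElementary_of_isLocalTerminal _
        (fiber_isLocalTerminal (asIso σ) j) (hφ'.one_le_comp w') a)
        (P.η _ (fiber_isLocalTerminal (asIso σ) j))
        (transport X (fiber_fiberMap φ' σ φ w' j a) x)) :
    P.act ω (P.circ φ'' j hφ'' z y) = P.circ φ' (incl σ j a) hφ' (P.act σ z) x := by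
  unfold circ act
  rw [P.assoc ω φ'' φ w'', P.assoc φ' σ φ w']
  congr 1
  funext r
  have h1 : ∀ r, restrict ω φ'' φ w'' (fun i => P.η _ (fiber_isLocalTerminal (asIso ω) i)) r =
      fun b => P.η (fiber (fiberMap ω φ'' φ w'' r) b)
        (fiber_isLocalTerminal (asIso (fiberMap ω φ'' φ w'' r)) b) :=
    fun r => funext fun b => P.transport_η _ _ _
  rw [h1]
  by_cases hr : r = j
  · subst hr
    rw [P.insert_self, P.restrict_insert]
    exact h
  · rw [P.insert_ne _ _ _ _ _ hr]
    have ht : IsLocalTerminal (fiber φ r) := isLocalTerminal_of_iso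
      (asIso (fiberMap ω φ'' φ w'' r)) (hφ''.trivial r hr).isLocalTerminal
    exact (P.η_γ _ ht _ _ fun _ _ => rfl).trans (P.η_γ _ ht _ _ fun b hb =>
      P.restrict_insert_ne _ _ _ _ _ _ _ _ (by rw [cardMap_incl]; exact hr) _ _).symm

end SetOperad

end SetOperad

/-! ### The Markl's operad of an operad -/

section OperadToMarkl

theorem isIso_of_isLocalTerminal {O : Type u} [Category.{v} O] {s t : O} (f : s ⟶ t)
    (hs : IsLocalTerminal s) (ht : IsLocalTerminal t) : IsIso f := by
  obtain ⟨a⟩ := hs t (Zigzag.of_inv f)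
  obtain ⟨b⟩ := hs s (Zigzag.refl s)
  obtain ⟨c⟩ := ht t (Zigzag.refl t)
  exact ⟨a.default, (b.uniq _).trans (b.uniq _).symm, (c.uniq _).trans (c.uniq _).symm⟩

variable {O : Type u} [Category.{v} O] [OperadicCategory O]
  {V : Type u'} [Category.{v'} V] [MonoidalCategory V] [SymmetricCategory V]

open GenElem

namespace ExtUnitalOperad

variable (P : ExtUnitalOperad O V)

theorem map_eqToHom_η {s t : O} (h : s = t) (hs : IsLocalTerminal s) (ht : IsLocalTerminal t) :
    GenElem.map (eqToHom (congrArg P.obj h)) (GenElem.map (P.η s hs) one) = GenElem.map (P.η t ht) one := by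
  subst h
  exact map_id _

/-- The operad in sets given by the generalized elements. -/
def elements : SetOperad fun T => GenElem (P.obj T) where
  γ := composition P.γ
  η t ht := GenElem.map (P.η t ht) one
  assoc f g h w := P.assocAt f g h w
  id_γ {T} x hx z := by
    have h : GenElem.map _ z = GenElem.map _ z := congrArg (fun a => GenElem.map a z) (P.id_γ T)
    rw [map_comp, map_comp, map_leftUnitor_inv, map_whiskerRight, map_id,
      map_ofUnits (A := fun i => P.obj (fiber (𝟙 T) i)) x] at h
    · exact h
    · intro i _
      rw [hx i (isQuasiBijection_id T i).isLocalTerminal, map_comp, ← P.η_chosen]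
      exact P.map_eqToHom_η (isQuasiBijection_id T i).eq_chosen _ _
  γ_unit {T U} hU f x i := by
    obtain ⟨c, rfl⟩ := hU
    have h : GenElem.map _ (transport (fun T => GenElem (P.obj T))
        (IsTrivial.fiber_eq ⟨c, rfl⟩ f i) (x i)) = GenElem.map _ _ :=
      congrArg (fun a => GenElem.map a _) (P.γ_unit c f i)
    rw [map_comp, map_comp, map_comp, map_rightUnitor_inv, map_whiskerLeft, map_whiskerRight,
      map_comp, map_id, ← transport_eq_map P.obj (IsTrivial.fiber_eq ⟨c, rfl⟩ f i).symm, transport_transport, transport_rfl,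
      map_insertUnits (A := fun j => P.obj (fiber f j)) x, ← P.η_chosen] at h
    · exact h
    · intro j hj
      exact absurd (Fin.ext (by have := card_chosen c; omega)) hj
  η_γ {s t} f hs ht x hx := by
    have := isIso_of_isLocalTerminal f hs ht
    have hf : ∀ i, IsLocalTerminal (fiber f i) := fun i => fiber_isLocalTerminal (asIso f) i
    have h : GenElem.map _ one = GenElem.map _ one := congrArg (fun a => GenElem.map a one)
      (P.η_γ f hs ht hf)
    rw [map_comp, map_comp, map_leftUnitor_inv, map_tensorHom,
      map_ofUnits (A := fun i => P.obj (fiber f i)) x] at h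
    · exact h
    · exact fun i _ => (hx i _).symm

variable (e : Grading O)

theorem map_toMarklData_map {S T : O} (ω : S ≅ T) (z : GenElem (P.obj T)) :
    GenElem.map ((P.toMarklData e).map ω) z = P.elements.act ω.hom z := by
  dsimp only [toMarklData]
  rw [map_comp, map_comp, map_leftUnitor_inv, map_whiskerRight,
    map_ofUnits (A := fun i => P.obj (fiber ω.hom i))
      (fun i => GenElem.map (P.η _ (fiber_isLocalTerminal ω i)) one) _ _ fun _ _ => rfl]
  rfl

variable {e}

theorem map_toMarklData_circ {T S : O} (φ : T ⟶ S) (i : Fin (card S))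
    (hφ : e.IsElementary φ i) (z : GenElem (P.obj S)) (u : GenElem (P.obj (fiber φ i))) :
    GenElem.map ((P.toMarklData e).circ φ i hφ) (tens z u) = P.elements.circ φ i hφ z u := by
  dsimp only [toMarklData]
  rw [map_comp, map_comp, map_braiding_hom, map_whiskerRight]
  have h := P.elements.insert_self φ i (fun j hj => (hφ.trivial j hj).isLocalTerminal) u
  conv_lhs => rw [← h]
  rw [map_insertUnits (A := fun j => P.obj (fiber φ j))
    (P.elements.insert φ i (fun j hj => (hφ.trivial j hj).isLocalTerminal) u)]
  · rfl
  · intro j hj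
    exact (P.elements.insert_ne φ i _ u j hj).symm

end ExtUnitalOperad

namespace MarklData

variable {e : Grading O} (M : MarklData V e) (Q : SetOperad fun T => GenElem (M.obj T))

/-- The operad in sets `Q` induces the Markl's data on generalized elements. -/
structure IsInducedBy : Prop where
  map {S T : O} (ω : S ≅ T) (z : GenElem (M.obj T)) : GenElem.map (M.map ω) z = Q.act ω.hom z
  circ {T S : O} (φ : T ⟶ S) (i : Fin (card S)) (hφ : e.IsElementary φ i) (z : GenElem (M.obj S))
    (u : GenElem (M.obj (fiber φ i))) :
    GenElem.map (M.circ φ i hφ) (tens z u) = Q.circ φ i hφ z u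
  η (t : O) (ht : IsLocalTerminal t) : GenElem.map (M.η t ht) one = Q.η t ht

theorem map_θ {T t : O} (f : T ⟶ t) (ht : IsLocalTerminal t) (hT : 1 ≤ e.grade T)
    (i : Fin (card t)) (u : GenElem (M.obj (fiber f i))) :
    GenElem.map (M.θ f ht hT i) u =
      GenElem.map (M.circ f i (Grading.isElementary_of_isLocalTerminal f ht hT i))
        (tens (GenElem.map (M.η t ht) one) u) := by
  unfold θ
  rw [map_comp, map_comp, map_leftUnitor_inv, map_whiskerRight]

namespace IsInducedBy

variable {M Q} (h : M.IsInducedBy Q)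
include h

/-- Generalized elements detect morphisms out of tensor products, so each axiom reduces to the
corresponding identity of the operad in sets `Q`. -/
theorem isMarkl : M.IsMarkl where
  map_id T := hom_ext fun z => by
    rw [map_id, h.map]
    exact Q.act_id z
  map_comp ω ω' := hom_ext fun z => by
    rw [map_comp, h.map, h.map, h.map]
    exact Q.act_comp _ _ z
  joint φ ψ ξ w i a hφ hψ := hom_ext_tens₃ fun z y x => by
    rw [map_comp, map_comp, map_comp, map_whiskerRight, map_associator_hom, map_whiskerLeft,
      map_comp, map_whiskerLeft, h.circ, h.circ, h.circ, h.circ, ← transport_eq_map M.obj]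
    exact Q.joint φ ψ ξ w i a hφ hψ z y x
  disjoint φ' ψ' φ'' ψ'' ξ w' w'' i k hik j l hj hl hφ' hψ' hφ'' hψ'' s' s'' hs' hs'' :=
    hom_ext_tens₃ fun z a'' b'' => by
    rw [map_comp, map_comp, map_comp, map_comp, map_comp, map_comp, map_whiskerRight,
      map_associator_hom, map_whiskerLeft, map_braiding_hom, map_whiskerLeft, map_tensorHom,
      map_associator_inv, map_whiskerRight, h.circ, h.circ, h.circ, h.circ, h.map, h.map]
    have h1 : IsIso (fiberMap φ'' ψ'' ξ w'' k) := by
      rw [(eqToHom_comp_iff _ _ _).1 hs'.symm]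
      infer_instance
    have h2 : IsIso (fiberMap φ' ψ' ξ w' i) := by
      rw [(eqToHom_comp_iff _ _ _).1 hs''.symm]
      infer_instance
    refine Q.disjoint φ' ψ' φ'' ψ'' ξ w' w'' i k hik j l hj hl hφ' hψ' hφ'' hψ'' z a'' b'' _ _ ?_ ?_
    · rw [Q.act_congr hs', Q.act_comp, Q.act_eqToHom, transport_transport, transport_rfl]
    · rw [Q.act_congr ((eqToHom_comp_iff _ _ _).1 hs''.symm), Q.act_comp, Q.act_eqToHom,
        ← Q.act_comp, Q.act_congr (show s''.hom ≫ s''.symm.hom = 𝟙 _ from s''.hom_inv_id), Q.act_id]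
  equivariant {T' T'' S' S''} ω σ φ' φ'' φ w' w'' hσ i j hij hφ' hφ'' := hom_ext_tens fun z y => by
    rw [map_comp, map_comp, map_tensorHom, map_comp, h.circ, h.circ, h.map, h.map, h.map,
      ← transport_eq_map M.obj (fiber_eq_of_trivial φ' σ.hom φ w' i j hij (hσ j)).symm]
    obtain ⟨a, ha⟩ : ∃ a, incl σ.hom j a = i := by
      subst hij
      exact exists_incl_eq σ.hom i
    subst ha
    refine Q.equivariant ω.hom σ.hom φ' φ'' φ w' w'' j a hφ' hφ'' z _ y ?_
    refine Eq.trans ?_ (Q.unital _ (hσ j) a _ _).symm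
    rw [transport_transport, transport_transport, transport_rfl]
    rfl

theorem isExtUnital : M.IsExtUnital where
  toIsMarkl := h.isMarkl
  unital f hU hT i := hom_ext fun u => by
    rw [M.map_θ, h.circ, h.η, ← transport_eq_map M.obj]
    exact Q.unital f hU i _ u
  natural ω hs ht := hom_ext_one (by
    rw [map_comp, h.η, h.η, h.map]
    exact Q.act_η _ _ _)
  equivariant' ω σ φ' φ'' φ w' w'' j a hφ' hφ'' := hom_ext_tens fun z x => by
    rw [map_comp, map_comp, map_comp, map_whiskerLeft, map_whiskerRight, map_comp, map_comp,
      M.map_θ, h.circ, h.circ, h.circ, h.map, h.map, h.map, h.η,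
      ← transport_eq_map M.obj (fiber_fiberMap φ' σ.hom φ w' j a)]
    refine Q.equivariant ω.hom σ.hom φ' φ'' φ w' w'' j a hφ' hφ'' z x _ ?_
    refine (Q.act_comp _ _ _).symm.trans ((Q.act_congr (g := 𝟙 _)
      (fiberIso ω φ'' φ w'' j).hom_inv_id _).trans (Q.act_id _))

end IsInducedBy

end MarklData

end OperadToMarkl

/-! ### The functor from operads to Markl's operads -/

section OperadToMarklFunctor

variable {O : Type u} [Category.{v} O] [OperadicCategory O]

namespace SetOperad

variable {X : O → Type w} {X' : O → Type*} {P : SetOperad X} {P' : SetOperad X'}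
  {τ : ∀ T, X T → X' T}

theorem apply_act {S T : O} (f : S ⟶ T) [IsIso f] (hf : P.γ.CommutesAt P'.γ τ f)
    (hη : ∀ t ht, τ t (P.η t ht) = P'.η t ht) (z : X T) :
    τ S (P.act f z) = P'.act f (τ T z) := by
  unfold act
  rw [hf]
  congr 1
  exact funext fun i => hη _ _

theorem apply_circ {e : Grading O} {S T : O} (f : T ⟶ S) (i : Fin (card S))
    (hf : e.IsElementary f i) (hγ : P.γ.CommutesAt P'.γ τ f)
    (hη : ∀ t ht, τ t (P.η t ht) = P'.η t ht) (z : X S) (u : X (fiber f i)) :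
    τ T (P.circ f i hf z u) = P'.circ f i hf (τ S z) (τ _ u) := by
  unfold circ
  rw [hγ]
  congr 1
  funext j
  by_cases hj : j = i
  · subst hj
    rw [P.insert_self, P'.insert_self]
  · rw [P.insert_ne _ _ _ _ _ hj, P'.insert_ne _ _ _ _ _ hj, hη]

end SetOperad

variable {V : Type u'} [Category.{v'} V] [MonoidalCategory V] [SymmetricCategory V]

open GenElem

theorem GenElem.composition_commutesAt {E E' : O → V}
    {γ : ∀ {T S : O} (f : T ⟶ S), tensorFibers E f ⊗ E S ⟶ E T}
    {γ' : ∀ {T S : O} (f : T ⟶ S), tensorFibers E' f ⊗ E' S ⟶ E' T} (α : ∀ T, E T ⟶ E' T)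
    {T S : O} (f : T ⟶ S)
    (h : γ f ≫ α T = (tensorList.map (fun i => α (fiber f i)) (List.finRange (card S)) ⊗ₘ α S) ≫
      γ' f) :
    (composition γ).CommutesAt (composition γ') (fun T => GenElem.map (α T)) f := by
  intro x z
  change GenElem.map (α T) (GenElem.map (γ f) _) = GenElem.map (γ' f) _
  rw [← GenElem.map_comp, h, GenElem.map_comp, map_tensorHom, map_tensorListMap]

namespace ExtUnitalOperad

variable (P : ExtUnitalOperad O V) (e : Grading O)

theorem isInducedBy : (P.toMarklData e).IsInducedBy P.elements where
  map := P.map_toMarklData_map e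
  circ := P.map_toMarklData_circ
  η _ _ := rfl

variable {e}

theorem map_θ {T t : O} (f : T ⟶ t) (ht : IsLocalTerminal t) (i : Fin (card t))
    (x : ∀ j, GenElem (P.obj (fiber f j))) :
    GenElem.map (P.θ f ht i) (x i) = P.elements.γ f x (P.elements.η t ht) := by
  unfold θ
  rw [map_comp, map_comp, map_comp, map_rightUnitor_inv, map_whiskerLeft, map_whiskerRight,
    map_insertUnits (A := fun j => P.obj (fiber f j)) x]
  · rfl
  · intro j hj
    exact absurd (Fin.ext (by have := Grading.card_localTerminal ht; omega)) hj

/-- The two versions of `ϑ` differ only by the order of the tensor factors; their equality transfers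
strictness. -/
theorem toMarklData_θ {T t : O} (f : T ⟶ t) (ht : IsLocalTerminal t) (hT : 1 ≤ e.grade T)
    (i : Fin (card t)) : (P.toMarklData e).θ f ht hT i = P.θ f ht i := by
  refine hom_ext fun (u : GenElem (P.obj (fiber f i))) => (MarklData.map_θ (P.toMarklData e) f ht hT i u).trans ?_
  refine (P.map_toMarklData_circ _ _ _ _ _).trans ?_
  have h := P.map_θ f ht i (P.elements.insert f i (fun j hj => ((Grading.isElementary_of_isLocalTerminal
    f ht hT i).trivial j hj).isLocalTerminal) u)
  rw [P.elements.insert_self] at h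
  exact h.symm

end ExtUnitalOperad

/-- The Markl's operad of an operad. -/
def StrictOperad.toStrictMarkl {e : Grading O} (P : StrictOperad V e) : StrictMarkl V e where
  toMarklData := P.toExtUnitalOperad.toMarklData e
  isExtUnital := (P.isInducedBy e).isExtUnital
  isStrict f ht hT i := by
    rw [P.toMarklData_θ]
    exact P.strict f ht hT i

theorem StrictOperad.Hom.commutesAt {e : Grading O} {P Q : StrictOperad V e} (φ : P.Hom Q) {T S : O}
    (f : T ⟶ S) : P.elements.γ.CommutesAt Q.elements.γ (fun T => GenElem.map (φ.app T)) f :=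
  composition_commutesAt φ.app f (φ.app_γ f)

theorem StrictOperad.Hom.map_app_η {e : Grading O} {P Q : StrictOperad V e} (φ : P.Hom Q) (t : O)
    (ht : IsLocalTerminal t) :
    GenElem.map (φ.app t) (P.elements.η t ht) = Q.elements.η t ht := by
  change GenElem.map (φ.app t) (GenElem.map (P.η t ht) one) = GenElem.map (Q.η t ht) one
  rw [← GenElem.map_comp, φ.app_η]

/-- The morphism of Markl's operads given by a morphism of operads. -/
def StrictOperad.Hom.toStrictMarkl {e : Grading O} {P Q : StrictOperad V e} (φ : P.Hom Q) :
    P.toStrictMarkl.Hom Q.toStrictMarkl where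
  app := φ.app
  app_map {S T} ω := hom_ext fun (z : GenElem (P.obj T)) => by
    refine (GenElem.map_comp _ _ _).trans (Eq.trans ?_ (GenElem.map_comp _ _ _).symm)
    refine (congrArg (GenElem.map (φ.app S)) (P.map_toMarklData_map e ω z)).trans ?_
    exact (SetOperad.apply_act ω.hom (φ.commutesAt _) φ.map_app_η z).trans
      (Q.map_toMarklData_map e ω _).symm
  app_circ {T S} f i hf := hom_ext_tens fun (z : GenElem (P.obj S)) u => by
    refine (GenElem.map_comp _ _ _).trans (Eq.trans ?_ (GenElem.map_comp _ _ _).symm)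
    refine (congrArg (GenElem.map (φ.app T)) (P.map_toMarklData_circ f i hf z u)).trans ?_
    refine (SetOperad.apply_circ f i hf (φ.commutesAt _) φ.map_app_η z u).trans ?_
    refine (Q.map_toMarklData_circ f i hf _ _).symm.trans (congrArg _ ?_)
    exact (map_tensorHom _ _ _ _).symm
  app_η := φ.app_η

/-- The functor from operads to Markl's operads. -/
def StrictOperad.marklFunctor (V : Type u') [Category.{v'} V] [MonoidalCategory V]
    [SymmetricCategory V] (e : Grading O) : StrictOperad V e ⥤ StrictMarkl V e where
  obj P := P.toStrictMarkl
  map φ := StrictOperad.Hom.toStrictMarkl φ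
  map_id _ := rfl
  map_comp _ _ := rfl

end OperadToMarklFunctor

/-! ### The Markl's operad in sets of a Markl's operad -/

section MarklElements

variable {O : Type u} [Category.{v} O] [OperadicCategory O]
  {V : Type u'} [Category.{v'} V] [MonoidalCategory V] [SymmetricCategory V] {e : Grading O}

open GenElem

namespace MarklData

variable (M : MarklData V e)

/-- The generalized elements of a Markl's operad; the only ones over local terminal objects are
the extended units. -/
def Elements (T : O) := {x : GenElem (M.obj T) // ∀ ht : IsLocalTerminal T,
  x = GenElem.map (M.η T ht) one}

variable {M}

theorem Elements.ext {T : O} {x y : M.Elements T} (h : x.1 = y.1) : x = y := Subtype.ext h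

theorem Elements.val_transport {T S : O} (h : T = S) (x : M.Elements T) :
    (transport M.Elements h x).1 = GenElem.map (eqToHom (congrArg M.obj h)) x.1 := by
  subst h
  exact (GenElem.map_id _).symm

/-- Over a local terminal object the single remaining element is generic because the extended unit
is invertible; over other objects no element has been discarded. -/
theorem Elements.detects (hη : ∀ t ht, IsIso (M.η t ht)) (T : O) :
    Detects (Set.range (Subtype.val : M.Elements T → GenElem (M.obj T))) := by
  by_cases hT : IsLocalTerminal T
  · have := hη T hT
    exact Detects.of_isIso (M.η T hT) ⟨⟨_, fun _ => rfl⟩, rfl⟩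
  · exact Detects.of_forall fun x => ⟨⟨x, fun h => absurd h hT⟩, rfl⟩

/-- The extended units. -/
def elementsη (t : O) (ht : IsLocalTerminal t) : M.Elements t :=
  ⟨GenElem.map (M.η t ht) one, fun _ => rfl⟩

theorem eq_elementsη {t : O} (ht : IsLocalTerminal t) (x : M.Elements t) :
    x = elementsη t ht := Elements.ext (x.2 ht)

/-- The circle products. -/
def elementsCirc {T S : O} (φ : T ⟶ S) (i : Fin (card S)) (hφ : e.IsElementary φ i)
    (z : M.Elements S) (u : M.Elements (fiber φ i)) : M.Elements T :=
  ⟨GenElem.map (M.circ φ i hφ) (tens z.1 u.1), fun hT => by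
    -- The target of a circle product is never local terminal, since it has at least the positive
    -- grade of the nontrivial fiber; the restriction on elements is vacuous here.
    have h1 := Grading.grade_localTerminal (e := e) hT
    have h2 := e.grade_fiber_le φ i
    have h3 := hφ.one_le
    omega⟩

namespace IsExtUnital

variable (h : M.IsExtUnital)
include h

/-- The action of isomorphisms. -/
noncomputable def elementsAct {S T : O} (f : S ⟶ T) [IsIso f] (x : M.Elements T) : M.Elements S :=
  ⟨GenElem.map (M.map (asIso f)) x.1, fun hS => by
    have hT := isLocalTerminal_of_iso (asIso f).symm hS
    rw [x.2 hT, ← GenElem.map_comp, h.natural (asIso f) hS hT]⟩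

theorem map_map_val {S T : O} (ω : S ≅ T) (x : M.Elements T) :
    GenElem.map (M.map ω) x.1 = (h.elementsAct ω.hom x).1 := by
  change _ = GenElem.map (M.map (asIso ω.hom)) x.1
  rw [show asIso ω.hom = ω from Iso.ext rfl]

theorem elementsAct_congr {S T : O} {f g : S ⟶ T} [IsIso f] [IsIso g] (hfg : f = g)
    (x : M.Elements T) : h.elementsAct f x = h.elementsAct g x := by
  subst hfg
  rfl

theorem elementsAct_id {T : O} (x : M.Elements T) : h.elementsAct (𝟙 T) x = x := by
  refine Elements.ext ((h.map_map_val (Iso.refl T) x).symm.trans ?_)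
  rw [h.map_id, GenElem.map_id]

theorem elementsAct_comp {T S R : O} (f : T ⟶ S) (g : S ⟶ R) [IsIso f] [IsIso g]
    (x : M.Elements R) : h.elementsAct (f ≫ g) x = h.elementsAct f (h.elementsAct g x) := by
  refine Elements.ext ((h.map_map_val (asIso f ≪≫ asIso g) x).symm.trans ?_)
  rw [h.map_comp, GenElem.map_comp]
  rfl

theorem elementsAct_eqToHom {S T : O} (hST : S = T) (x : M.Elements T) :
    h.elementsAct (eqToHom hST) x = transport M.Elements hST.symm x := by
  subst hST
  exact h.elementsAct_id x

theorem elements_equivariant {T' T'' S' S'' : O} (ω : T' ≅ T'') (σ : S' ≅ S'')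
    (φ' : T' ⟶ S') (φ'' : T'' ⟶ S'') (φ : T' ⟶ S'') (w' : φ' ≫ σ.hom = φ) (w'' : ω.hom ≫ φ'' = φ)
    (j : Fin (card S'')) (a : Fin (card (fiber σ.hom j)))
    (hφ' : e.IsElementary φ' (incl σ.hom j a)) (hφ'' : e.IsElementary φ'' j)
    (z : M.Elements S'') (x : M.Elements (fiber φ' (incl σ.hom j a)))
    (y : M.Elements (fiber φ'' j))
    (hy : h.elementsAct (fiberMap ω.hom φ'' φ w'' j) y =
      elementsCirc (fiberMap φ' σ.hom φ w' j) a (Grading.isElementary_of_isLocalTerminal _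
        (fiber_isLocalTerminal σ j) (hφ'.one_le_comp w') a)
        (elementsη _ (fiber_isLocalTerminal σ j))
        (transport M.Elements (fiber_fiberMap φ' σ.hom φ w' j a) x)) :
    h.elementsAct ω.hom (elementsCirc φ'' j hφ'' z y) =
      elementsCirc φ' (incl σ.hom j a) hφ' (h.elementsAct σ.hom z) x := by
  have h1 := congrArg (fun f => GenElem.map f (tens z.1 x.1))
    (h.equivariant' ω σ φ' φ'' φ w' w'' j a hφ' hφ'')
  rw [GenElem.map_comp, GenElem.map_comp, map_whiskerLeft, GenElem.map_comp,
    GenElem.map_comp, GenElem.map_comp, M.map_θ, map_whiskerRight,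
    ← Elements.val_transport (fiber_fiberMap φ' σ.hom φ w' j a), h.map_map_val] at h1
  -- Axiom (iii') has the element over `φ''⁻¹(j)` computed from `x` by inverting the induced
  -- isomorphism; by `hy` this element is `y`.
  have h2 : GenElem.map (M.map (fiberIso ω φ'' φ w'' j).symm)
      (elementsCirc (fiberMap φ' σ.hom φ w' j) a (Grading.isElementary_of_isLocalTerminal _
        (fiber_isLocalTerminal σ j) (hφ'.one_le_comp w') a)
        (elementsη _ (fiber_isLocalTerminal σ j))
        (transport M.Elements (fiber_fiberMap φ' σ.hom φ w' j a) x)).1 = y.1 := by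
    rw [h.map_map_val, ← hy]
    congr 1
    refine (h.elementsAct_comp _ _ y).symm.trans ?_
    exact (h.elementsAct_congr (fiberIso ω φ'' φ w'' j).inv_hom_id y).trans (h.elementsAct_id y)
  refine Elements.ext (Eq.trans ?_ h1)
  rw [← h.map_map_val]
  exact congrArg (fun b => GenElem.map (M.map ω) (GenElem.map (M.circ φ'' j hφ'') (tens z.1 b)))
    h2.symm

/-- The Markl's operad in sets given by the generalized elements. -/
noncomputable def elements : SetMarkl e M.Elements where
  act := h.elementsAct
  circ := elementsCirc
  η := elementsη
  eq_η := eq_elementsη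
  act_id := h.elementsAct_id
  act_comp := h.elementsAct_comp
  joint φ ψ ξ w i a hφ hψ z y x := by
    have h1 := congrArg (fun f => GenElem.map f (tens (tens z.1 y.1) x.1))
      (h.joint φ ψ ξ w i a hφ hψ)
    rw [GenElem.map_comp, GenElem.map_comp, GenElem.map_comp, map_whiskerRight,
      map_associator_hom, map_whiskerLeft, GenElem.map_comp, map_whiskerLeft,
      ← Elements.val_transport (fiber_fiberMap φ ψ ξ w i a)] at h1
    exact Elements.ext h1
  disjoint φ' ψ' φ'' ψ'' ξ w' w'' i k hik j l hj hl hφ' hψ' hφ'' hψ'' _ _ z a'' b'' a' b'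
      h₁ h₂ := by
    let s' := eqToIso (fiber_eq_of_trivial φ' ψ' ξ w' j k hj (hψ'.trivial k hik.symm)) ≪≫
      asIso (fiberMap φ'' ψ'' ξ w'' k)
    let s'' := eqToIso (fiber_eq_of_trivial φ'' ψ'' ξ w'' l i hl (hψ''.trivial i hik)) ≪≫
      asIso (fiberMap φ' ψ' ξ w' i)
    have h1 := congrArg (fun f => GenElem.map f (tens (tens z.1 a''.1) b''.1))
      (h.disjoint φ' ψ' φ'' ψ'' ξ w' w'' i k hik j l hj hl hφ' hψ' hφ'' hψ'' s' s'' rfl rfl)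
    rw [GenElem.map_comp, GenElem.map_comp, GenElem.map_comp, GenElem.map_comp,
      GenElem.map_comp, GenElem.map_comp, map_whiskerRight,
      map_associator_hom, map_whiskerLeft, map_braiding_hom, map_whiskerLeft, map_tensorHom,
      map_associator_inv, map_whiskerRight, h.map_map_val, h.map_map_val] at h1
    have h2 : h.elementsAct s'.hom a'' = a' := by
      change h.elementsAct (eqToHom (fiber_eq_of_trivial φ' ψ' ξ w' j k hj
        (hψ'.trivial k hik.symm)) ≫ fiberMap φ'' ψ'' ξ w'' k) a'' = a'
      rw [h.elementsAct_comp, ← h₁, h.elementsAct_eqToHom, transport_transport, transport_rfl]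
    have h3 : h.elementsAct s''.symm.hom b'' = b' := by
      have h4 : b'' = h.elementsAct s''.hom b' := by
        change b'' = h.elementsAct (eqToHom (fiber_eq_of_trivial φ'' ψ'' ξ w'' l i hl
          (hψ''.trivial i hik)) ≫ fiberMap φ' ψ' ξ w' i) b'
        rw [h.elementsAct_comp, ← h₂, h.elementsAct_eqToHom, transport_transport, transport_rfl]
      rw [h4, ← h.elementsAct_comp, 
        h.elementsAct_congr (show s''.symm.hom ≫ s''.hom = 𝟙 _ from s''.inv_hom_id), h.elementsAct_id]
    rw [h2, h3] at h1
    exact Elements.ext h1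
  unital f hU hT i x := by
    refine Elements.ext ?_
    rw [Elements.val_transport, ← h.unital f hU hT i, M.map_θ]
    rfl
  equivariant ω σ _ _ φ' φ'' φ w' w'' j a hφ' hφ'' z x y hy :=
    h.elements_equivariant (asIso ω) (asIso σ) φ' φ'' φ w' w'' j a hφ' hφ'' z x y hy

end IsExtUnital

end MarklData

end MarklElements

/-! ### Maps of ordered tensor products used in the compositions -/

section Lists

variable {V : Type u'} [Category.{v'} V] [MonoidalCategory V] {ι : Type*}

namespace tensorList

/-- Functoriality of the tensor product of a list, for morphisms defined for its members. -/
def mapOn (A B : ι → V) : ∀ l : List ι, (∀ j ∈ l, A j ⟶ B j) → (tensorList A l ⟶ tensorList B l)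
  | [], _ => 𝟙 (𝟙_ V)
  | a :: l, φ => φ a List.mem_cons_self ⊗ₘ mapOn A B l fun j hj => φ j (List.mem_cons_of_mem a hj)

/-- The morphism `⨂ A ⟶ 𝟙` given by morphisms `A j ⟶ 𝟙`. -/
def collapse (A : ι → V) (ε : ∀ j, A j ⟶ 𝟙_ V) : ∀ l : List ι, tensorList A l ⟶ 𝟙_ V
  | [] => 𝟙 (𝟙_ V)
  | a :: l => (ε a ⊗ₘ collapse A ε l) ≫ (λ_ (𝟙_ V)).hom

end tensorList

namespace GenElem

variable [SymmetricCategory V]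

theorem map_mapOn {A B : ι → V} (x : ∀ i, GenElem (A i)) (y : ∀ i, GenElem (B i)) :
    ∀ (l : List ι) (φ : ∀ j ∈ l, A j ⟶ B j), (∀ j hj, map (φ j hj) (x j) = y j) →
      map (tensorList.mapOn A B l φ) (tuple x l) = tuple y l
  | [], _, _ => map_id _
  | a :: l, φ, h => by
    change map (φ a List.mem_cons_self ⊗ₘ tensorList.mapOn A B l _) (tens (x a) (tuple x l)) =
      tens (y a) (tuple y l)
    rw [map_tensorHom, h, map_mapOn x y l]
    intro j hj
    exact h j _

theorem map_collapse {A : ι → V} (x : ∀ i, GenElem (A i)) (ε : ∀ j, A j ⟶ 𝟙_ V)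
    (h : ∀ j, map (ε j) (x j) = one) : ∀ l : List ι,
      map (tensorList.collapse A ε l) (tuple x l) = one
  | [] => map_id _
  | a :: l => by
    change map ((ε a ⊗ₘ tensorList.collapse A ε l) ≫ (λ_ (𝟙_ V)).hom)
      (tens (x a) (tuple x l)) = one
    rw [map_comp, map_tensorHom, h, map_collapse x ε h l, map_leftUnitor_hom]

end GenElem

end Lists

/-! ### The compositions of a Markl's operad -/

section MarklCompositions

variable {O : Type u} [Category.{v} O] [OperadicCategory O] {e : Grading O}

namespace OperadicCategory.Splitting

variable {T S : O} {f : T ⟶ S} (p : Splitting e f)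

theorem comp_comp : (p.ω ≫ p.π) ≫ p.ψ = f := (Category.assoc _ _ _).trans p.w

theorem isUnary : e.IsUnary (p.ω ≫ p.π) (incl p.ψ p.q p.a) := by
  have := p.isIso
  exact p.elementary.isUnary.precomp p.ω _ rfl

theorem isIso_fiberMap (he : ∀ {S T : O} (f : S ⟶ T), IsIso f ↔ e.gradeHom f = 0)
    {k : Fin (card S)} (hk : k ≠ p.q) : IsIso (fiberMap (p.ω ≫ p.π) p.ψ f p.comp_comp k) :=
  p.isUnary.isIso_fiberMap' he p.comp_comp (by rw [cardMap_incl]; exact hk)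

theorem fiber_eq : fiber p.π (incl p.ψ p.q p.a) = fiber (p.π ≫ p.ψ) p.q :=
  (fiber_fiberMap p.π p.ψ _ rfl p.q p.a).trans (p.trivial_q.fiber_eq _ p.a)

end OperadicCategory.Splitting

variable {V : Type u'} [Category.{v'} V] [MonoidalCategory V] [SymmetricCategory V]

open GenElem

namespace MarklData

variable (M : MarklData V e) (hη : ∀ t ht, IsIso (M.η t ht))
  (he : ∀ {S T : O} (f : S ⟶ T), IsIso f ↔ e.gradeHom f = 0)

/-- The composition along an isomorphism. -/
noncomputable def compositionIso {T S : O} (f : T ⟶ S) [IsIso f] :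
    tensorFibers M.obj f ⊗ M.obj S ⟶ M.obj T :=
  (tensorList.collapse (fun k => M.obj (fiber f k)) (fun k =>
    have := hη (fiber f k) (fiber_isLocalTerminal (asIso f) k)
    inv (M.η (fiber f k) (fiber_isLocalTerminal (asIso f) k))) _ ▷ M.obj S) ≫
    (λ_ (M.obj S)).hom ≫ M.map (asIso f)

/-- The composition along `f`, in terms of the composition along the last part of a splitting. -/
noncomputable def compositionSplitting {T S : O} {f : T ⟶ S} (p : Splitting e f)
    (c : tensorFibers M.obj p.ψ ⊗ M.obj S ⟶ M.obj p.Q) :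
    tensorFibers M.obj f ⊗ M.obj S ⟶ M.obj T :=
  have := p.isIso
  ((tensorList.pull (fun k => M.obj (fiber f k)) p.q _ (List.mem_finRange p.q)).hom ▷ M.obj S) ≫
    -- With the factor of `f⁻¹(q)` set aside, the other factors are carried to the fibers of `p.ψ`
    -- along inverse induced isomorphisms, and the extended unit fills the trivial fiber over `q`.
    ((M.obj (fiber f p.q) ◁
      (tensorList.mapOn (fun k => M.obj (fiber f k)) (fun k => M.obj (fiber p.ψ k))
        ((List.finRange (card S)).erase p.q) (fun j hj =>
          have := p.isIso_fiberMap he ((List.nodup_finRange (card S)).mem_erase_iff.1 hj).1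
          M.map (asIso (fiberMap (p.ω ≫ p.π) p.ψ f p.comp_comp j)).symm) ≫
        (λ_ _).inv ≫ (M.η _ p.trivial_q.isLocalTerminal ▷ _) ≫
        (tensorList.pull (fun k => M.obj (fiber p.ψ k)) p.q _ (List.mem_finRange p.q)).inv)) ▷
      M.obj S) ≫
    (α_ _ _ _).hom ≫ (M.obj (fiber f p.q) ◁ c) ≫ (β_ _ _).hom ≫
    (M.obj p.Q ◁ (M.map (asIso (fiberMap p.ω (p.π ≫ p.ψ) f p.w p.q)).symm ≫
      eqToHom (congrArg M.obj p.fiber_eq.symm))) ≫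
    M.circ p.π (incl p.ψ p.q p.a) p.elementary ≫ M.map (asIso p.ω)

theorem map_compositionIso {T S : O} (f : T ⟶ S) [IsIso f] (x : ∀ k, M.Elements (fiber f k))
    (z : GenElem (M.obj S)) :
    GenElem.map (M.compositionIso hη f) (tens (tuple (A := fun k => M.obj (fiber f k))
      (fun k => (x k).1) (List.finRange (card S))) z) = GenElem.map (M.map (asIso f)) z := by
  unfold compositionIso
  rw [GenElem.map_comp, GenElem.map_comp, map_whiskerRight,
    map_collapse (A := fun k => M.obj (fiber f k)), map_leftUnitor_hom]
  intro k
  rw [(x k).2 (fiber_isLocalTerminal (asIso f) k), ← GenElem.map_comp]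
  have := hη (fiber f k) (fiber_isLocalTerminal (asIso f) k)
  exact (congrArg (fun g => GenElem.map g one) (IsIso.hom_inv_id _)).trans (GenElem.map_id _)

theorem map_compositionSplitting {T S : O} {f : T ⟶ S} (p : Splitting e f)
    (c : tensorFibers M.obj p.ψ ⊗ M.obj S ⟶ M.obj p.Q) (x : ∀ k, GenElem (M.obj (fiber f k)))
    (y : ∀ k, GenElem (M.obj (fiber p.ψ k))) (u : GenElem (M.obj (fiber p.π (incl p.ψ p.q p.a))))
    (z : GenElem (M.obj S)) (hyq : GenElem.map (M.η _ p.trivial_q.isLocalTerminal) one = y p.q)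
    (hy : ∀ k, k ≠ p.q → ∀ [IsIso (fiberMap (p.ω ≫ p.π) p.ψ f p.comp_comp k)],
      GenElem.map (M.map (asIso (fiberMap (p.ω ≫ p.π) p.ψ f p.comp_comp k)).symm) (x k) = y k)
    (hu : ∀ [IsIso p.ω], GenElem.map (M.map (asIso (fiberMap p.ω (p.π ≫ p.ψ) f p.w p.q)).symm)
      (x p.q) = GenElem.map (eqToHom (congrArg M.obj p.fiber_eq)) u) :
    GenElem.map (M.compositionSplitting he p c) (tens (tuple (A := fun k => M.obj (fiber f k))
      x (List.finRange (card S))) z) =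
      GenElem.map (have := p.isIso; M.map (asIso p.ω)) (GenElem.map (M.circ p.π _ p.elementary)
        (tens (GenElem.map c (tens (tuple (A := fun k => M.obj (fiber p.ψ k)) y
          (List.finRange (card S))) z)) u)) := by
  have := p.isIso
  unfold compositionSplitting
  simp only [GenElem.map_comp]
  rw [map_whiskerRight, map_pull (A := fun k => M.obj (fiber f k)), map_whiskerRight,
    map_whiskerLeft]
  simp only [GenElem.map_comp]
  rw [map_mapOn (A := fun k => M.obj (fiber f k)) (B := fun k => M.obj (fiber p.ψ k)) x y,
    map_leftUnitor_inv, map_whiskerRight, hyq, map_pull_inv (A := fun k => M.obj (fiber p.ψ k)),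
    map_associator_hom, map_whiskerLeft, map_braiding_hom, map_whiskerLeft, GenElem.map_comp, hu,
    ← GenElem.map_comp (eqToHom _), eqToHom_trans, eqToHom_refl, GenElem.map_id]
  intro j hj
  have := p.isIso_fiberMap he ((List.nodup_finRange (card S)).mem_erase_iff.1 hj).1
  exact hy j ((List.nodup_finRange (card S)).mem_erase_iff.1 hj).1

variable (hFac : Factorizable O) (hSBU : BlowUp O) (hQBI : QuasiBijectionsInvertible O)

/-- The composition operations of a `1`-connected Markl's operad. -/
noncomputable def γ {T S : O} (f : T ⟶ S) : tensorFibers M.obj f ⊗ M.obj S ⟶ M.obj T :=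
  open scoped Classical in
  if h : e.grade S < e.grade T then
    M.compositionSplitting he (Classical.choice (nonempty_splitting he hFac hSBU hQBI f h))
      (γ (Classical.choice (nonempty_splitting he hFac hSBU hQBI f h)).ψ)
  else
    have := isIso_of_grade_eq he f (le_antisymm (not_lt.1 h) (Grading.grade_le f))
    M.compositionIso hη f
termination_by e.grade T
-- The middle object of a splitting is the target of a unary morphism, so its grade is strictly
-- smaller.
decreasing_by exact (Splitting.isUnary _).grade_lt

end MarklData

end MarklCompositions

/-! ### The operad of a `1`-connected Markl's operad -/

section MarklToOperad

variable {O : Type u} [Category.{v} O] [OperadicCategory O] {e : Grading O}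
  {V : Type u'} [Category.{v'} V] [MonoidalCategory V] [SymmetricCategory V]

open GenElem

namespace MarklData

variable (M : MarklData V e) (hη : ∀ t ht, IsIso (M.η t ht))
  (he : ∀ {S T : O} (f : S ⟶ T), IsIso f ↔ e.gradeHom f = 0)
  (hFac : Factorizable O) (hSBU : BlowUp O) (hQBI : QuasiBijectionsInvertible O)

theorem γ_of_isIso {T S : O} (f : T ⟶ S) [IsIso f] :
    M.γ hη he hFac hSBU hQBI f = M.compositionIso hη f := by
  rw [γ, dif_neg]
  rw [Grading.grade_eq_of_iso (e := e) f]
  exact lt_irrefl _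

theorem exists_γ_eq {T S : O} (f : T ⟶ S) (hf : e.grade S < e.grade T) :
    ∃ p : Splitting e f, M.γ hη he hFac hSBU hQBI f =
      M.compositionSplitting he p (M.γ hη he hFac hSBU hQBI p.ψ) := by
  refine ⟨Classical.choice (nonempty_splitting he hFac hSBU hQBI f hf), ?_⟩
  rw [γ, dif_pos hf]

namespace IsExtUnital

variable {M} (h : M.IsExtUnital)

/-- The composition operations on the generalized elements of a `1`-connected Markl's operad. -/
noncomputable def elementsγ : SetComposition M.Elements := fun _ S f x z =>
  ⟨GenElem.map (M.γ hη he hFac hSBU hQBI f) (tens (tuple (A := fun k => M.obj (fiber f k))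
    (fun k => (x k).1) (List.finRange (card S))) z.1), fun hT => by
    have := isIso_of_grade_eq he f (le_antisymm (by rw [Grading.grade_localTerminal hT]; omega)
      (Grading.grade_le f))
    rw [γ_of_isIso, map_compositionIso]
    exact (h.elementsAct f z).2 hT⟩

/-- The recursive formula for `γ`, read on elements, is the rule `SplitsAlong` for the chosen
splitting. This makes the associativity theorem for sets available. -/
theorem isGenerated : h.elements.IsGenerated (h.elementsγ hη he hFac hSBU hQBI) where
  iso {T S} f _ x z := by
    refine Elements.ext ?_
    change GenElem.map _ _ = GenElem.map (M.map (asIso f)) z.1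
    rw [γ_of_isIso, map_compositionIso]
  split f hf := by
    obtain ⟨p, hp⟩ := M.exists_γ_eq hη he hFac hSBU hQBI f hf
    refine ⟨p, fun x y u z hy hu => Elements.ext ?_⟩
    change GenElem.map (M.γ hη he hFac hSBU hQBI f) _ = _
    rw [hp]
    refine (M.map_compositionSplitting he p (M.γ hη he hFac hSBU hQBI p.ψ) _ (fun k => (y k).1)
      u.1 z.1 ((y p.q).2 _).symm ?_ ?_).trans rfl
    · intro k hk _
      rw [h.map_map_val, hy k hk]
      exact congrArg Subtype.val (h.elements.act_inv_act _ _)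
    · intro _
      rw [h.map_map_val, hu, ← Elements.val_transport p.fiber_eq]
      exact congrArg Subtype.val (h.elements.act_inv_act _ _)

-- The diagram is tested on tuples of elements that are extended units over local terminal objects.
-- On those it is the associativity already proved for sets.
include h in
theorem γ_assoc {T S R : O} (f : T ⟶ S) (g : S ⟶ R) (k : T ⟶ R) (w : f ≫ g = k) :
    (tensorList (fun i => tensorFibers M.obj (fiberMap f g k w i)) (List.finRange (card R)) ◁
        M.γ hη he hFac hSBU hQBI g) ≫
        (regroup M.obj f g k w ▷ M.obj S) ≫ M.γ hη he hFac hSBU hQBI f =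
      (α_ _ (tensorFibers M.obj g) (M.obj R)).inv ≫
        (tensorList.zip (fun i => tensorFibers M.obj (fiberMap f g k w i))
            (fun i => M.obj (fiber g i)) (List.finRange (card R)) ▷ M.obj R) ≫
        (tensorList.map (fun i => M.γ hη he hFac hSBU hQBI (fiberMap f g k w i))
          (List.finRange (card R)) ▷ M.obj R) ≫ M.γ hη he hFac hSBU hQBI k := by
  have hd := Elements.detects hη
  refine ((Detects.tuple (fun i => Detects.tuple (fun a => hd (fiber (fiberMap f g k w i) a))
    (List.nodup_finRange _)) (List.nodup_finRange _)).tens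
    ((Detects.tuple (fun i => hd (fiber g i)) (List.nodup_finRange _)).tens (hd R))).hom_ext ?_
  rintro _ ⟨_, ⟨x', hx', rfl⟩, _, ⟨_, ⟨y', hy, rfl⟩, _, ⟨z, rfl⟩, rfl⟩, rfl⟩
  choose x'' hx'' hxx using hx'
  choose x₁ hx₁ using hx''
  choose y hy using hy
  obtain rfl : (fun i => (y i).1) = y' := funext hy
  -- The test tuples are indexed by the fibers of the induced maps; they are glued to a family over
  -- the fibers of `f`, to which `AssocAt` applies.
  obtain ⟨x, hx⟩ := exists_restrict_eq (X := M.Elements) f g k w x₁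
  obtain rfl : (fun i => tuple (A := fun a => M.obj (fiber (fiberMap f g k w i) a))
      (restrict (X := fun T => GenElem (M.obj T)) f g k w (fun j => (x j).1) i)
      (List.finRange (card (fiber g i)))) = x' := by
    funext i
    rw [hxx]
    refine tuple_congr fun a _ => ?_
    rw [← hx₁, ← hx]
    exact (apply_transport (fun T => (Subtype.val : M.Elements T → _)) _ _).symm
  refine (map_composite (M.γ hη he hFac hSBU hQBI) f g k w _ _ _).trans
    (Eq.trans ?_ (map_composite' (M.γ hη he hFac hSBU hQBI) f g k w _ _ _).symm)
  refine (congrArg Subtype.val ((h.isGenerated hη he hFac hSBU hQBI).assoc he hFac hSBU hQBI f g k w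
    x y z)).trans ?_
  change GenElem.map _ _ = GenElem.map _ _
  congr 2
  refine tuple_congr fun i _ => ?_
  change GenElem.map _ _ = GenElem.map _ _
  congr 2
  refine tuple_congr fun a _ => ?_
  exact apply_transport (fun T => (Subtype.val : M.Elements T → _)) _ _

end IsExtUnital

end MarklData

end MarklToOperad

/-! ### Units and strictness of the reconstructed operad -/

section MarklToStrictOperad

variable {O : Type u} [Category.{v} O] [OperadicCategory O] {e : Grading O}
  {V : Type u'} [Category.{v'} V] [MonoidalCategory V] [SymmetricCategory V]

open GenElem

theorem SetMarkl.IsGenerated.eval_unit {X : O → Type w} {D : SetMarkl e X} {γ : SetComposition X}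
    (hγ : D.IsGenerated γ) (he : ∀ {S T : O} (f : S ⟶ T), IsIso f ↔ e.gradeHom f = 0)
    {T U : O} (f : T ⟶ U) (hU : IsTrivial U) (i : Fin (card U)) (x : ∀ j, X (fiber f j))
    (z : X U) : γ f x z = transport X (hU.fiber_eq f i) (x i) := by
  by_cases hT : 1 ≤ e.grade T
  · rw [hγ.eval_elementary he f i
      (Grading.isElementary_of_isLocalTerminal f hU.isLocalTerminal hT i),
      D.eq_η hU.isLocalTerminal z, D.unital f hU hT i]
  · exact D.eq_of_isLocalTerminal (isLocalTerminal_of_grade he (by omega)) _ _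

theorem MarklData.map_eqToHom_η (M : MarklData V e) {s t : O} (h : s = t)
    (hs : IsLocalTerminal s) (ht : IsLocalTerminal t) :
    GenElem.map (eqToHom (congrArg M.obj h)) (GenElem.map (M.η s hs) one) =
      GenElem.map (M.η t ht) one := by
  subst h
  exact GenElem.map_id _

namespace StrictMarkl

variable (M : StrictMarkl V e) (hη : ∀ t ht, IsIso (M.η t ht))
  (he : ∀ {S T : O} (f : S ⟶ T), IsIso f ↔ e.gradeHom f = 0)
  (hFac : Factorizable O) (hSBU : BlowUp O) (hQBI : QuasiBijectionsInvertible O)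

/-- The extended unital operad of a `1`-connected Markl's operad. -/
noncomputable def toExtUnitalOperad : ExtUnitalOperad O V where
  obj := M.obj
  unit c := M.η (chosen c) (chosen_isLocalTerminal c)
  γ f := M.γ hη he hFac hSBU hQBI f
  assoc f g k w := M.isExtUnital.γ_assoc hη he hFac hSBU hQBI f g k w
  id_γ T := by
    refine (MarklData.Elements.detects hη T).hom_ext ?_
    rintro _ ⟨z, rfl⟩
    have ht : ∀ i, IsLocalTerminal (fiber (𝟙 T) i) := fun i =>
      (isQuasiBijection_id T i).isLocalTerminal
    rw [GenElem.map_comp, GenElem.map_comp, map_leftUnitor_inv, map_whiskerRight, GenElem.map_id,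
      map_ofUnits (A := fun i => M.obj (fiber (𝟙 T) i))
        (fun i => (MarklData.elementsη (M := M.toMarklData) _ (ht i)).1)]
    · refine (congrArg Subtype.val ((M.isExtUnital.isGenerated hη he hFac hSBU hQBI).iso (𝟙 T)
        (fun i => MarklData.elementsη _ (ht i)) z)).trans ?_
      exact congrArg Subtype.val (M.isExtUnital.elementsAct_id z)
    · intro i _
      rw [GenElem.map_comp]
      exact M.map_eqToHom_η (isQuasiBijection_id T i).eq_chosen _ _
  γ_unit {T} c f i := by
    refine (MarklData.Elements.detects hη T).hom_ext ?_
    rintro _ ⟨(z : M.Elements T), rfl⟩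
    have hU : IsTrivial (chosen c) := ⟨c, rfl⟩
    have hx := MarklData.Elements.val_transport (hU.fiber_eq f i).symm z
    rw [GenElem.map_comp, GenElem.map_comp, GenElem.map_comp, map_rightUnitor_inv,
      map_whiskerLeft, map_whiskerRight, GenElem.map_comp, GenElem.map_id, ← hx,
      map_insertUnits (A := fun j => M.obj (fiber f j))
        (fun j => (transport M.Elements (hU.fiber_eq f j).symm z).1)]
    · refine (congrArg Subtype.val ((M.isExtUnital.isGenerated hη he hFac hSBU hQBI).eval_unit he f
        hU i (fun j => transport M.Elements (hU.fiber_eq f j).symm z)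
        (MarklData.elementsη _ (chosen_isLocalTerminal c)))).trans ?_
      rw [transport_transport, transport_rfl]
    · intro j hj
      exact absurd (Fin.ext (by have := card_chosen c; omega)) hj
  η := M.η
  η_chosen _ := rfl
  η_γ {s t} f hs ht hf := hom_ext_one (by
    rw [GenElem.map_comp, GenElem.map_comp, map_leftUnitor_inv, map_tensorHom,
      map_ofUnits (A := fun i => M.obj (fiber f i))
        (fun i => (MarklData.elementsη (M := M.toMarklData) _ (hf i)).1) _ _ fun _ _ => rfl]
    exact (M.isExtUnital.elementsγ hη he hFac hSBU hQBI f (fun i => MarklData.elementsη _ (hf i))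
      (MarklData.elementsη _ ht)).2 hs)

theorem elements_γ_eq {T S : O} (f : T ⟶ S) (x : ∀ j, M.Elements (fiber f j))
    (z : M.Elements S) :
    (M.toExtUnitalOperad hη he hFac hSBU hQBI).elements.γ f (fun j => (x j).1) z.1 =
      (M.isExtUnital.elementsγ hη he hFac hSBU hQBI f x z).1 := rfl

theorem elements_act_eq {T S : O} (f : T ⟶ S) [IsIso f] (z : M.Elements S) :
    (M.toExtUnitalOperad hη he hFac hSBU hQBI).elements.act f z.1 =
      (M.isExtUnital.elementsAct f z).1 :=
  congrArg Subtype.val ((M.isExtUnital.isGenerated hη he hFac hSBU hQBI).iso f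
    (fun i => MarklData.elementsη _ (fiber_isLocalTerminal (asIso f) i)) z)

theorem elements_circ_eq {T S : O} (f : T ⟶ S) (i : Fin (card S)) (hf : e.IsElementary f i)
    (z : M.Elements S) (u : M.Elements (fiber f i)) :
    (M.toExtUnitalOperad hη he hFac hSBU hQBI).elements.circ f i hf z.1 u.1 =
      GenElem.map (M.circ f i hf) (tens z.1 u.1) := by
  -- The family with units inserted consists of admissible elements, so the evaluation of `γ` along
  -- elementary morphisms applies to it.
  have h1 : ∀ j, ∃ x : M.Elements (fiber f j), (∀ h : i = j, u = transport _ (by rw [h]) x) ∧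
      x.1 = (M.toExtUnitalOperad hη he hFac hSBU hQBI).elements.insert f i
        (fun j hj => (hf.trivial j hj).isLocalTerminal) u.1 j := by
    intro j
    by_cases hj : j = i
    · subst hj
      exact ⟨u, fun _ => rfl, 
        (SetOperad.insert_self (M.toExtUnitalOperad hη he hFac hSBU hQBI).elements f j _ u.1).symm⟩
    · exact ⟨MarklData.elementsη _ (hf.trivial j hj).isLocalTerminal, fun h => absurd h.symm hj,
        (SetOperad.insert_ne (M.toExtUnitalOperad hη he hFac hSBU hQBI).elements f i
          (fun j hj => (hf.trivial j hj).isLocalTerminal) u.1 j hj).symm⟩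
  choose x hx hx' using h1
  unfold SetOperad.circ
  rw [← funext hx']
  refine (M.elements_γ_eq hη he hFac hSBU hQBI f x z).trans ?_
  rw [(M.isExtUnital.isGenerated hη he hFac hSBU hQBI).eval_elementary he f i hf]
  rw [hx i rfl]
  rfl

/-- The strictly extended unital operad of a `1`-connected Markl's operad. -/
noncomputable def toStrictOperad : StrictOperad V e where
  toExtUnitalOperad := M.toExtUnitalOperad hη he hFac hSBU hQBI
  strict {T t} f ht hT i := by
    obtain ⟨h, h'⟩ := M.isStrict f ht hT i
    refine ⟨h, Eq.trans ?_ h'⟩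
    rw [← ExtUnitalOperad.toMarklData_θ _ f ht hT i]
    refine (MarklData.Elements.detects hη (fiber f i)).hom_ext ?_
    rintro _ ⟨u, rfl⟩
    refine (MarklData.map_θ ((M.toExtUnitalOperad hη he hFac hSBU hQBI).toMarklData e)
      f ht hT i u.1).trans ?_
    refine (ExtUnitalOperad.map_toMarklData_circ (M.toExtUnitalOperad hη he hFac hSBU hQBI)
      f i _ _ u.1).trans ?_
    refine (M.elements_circ_eq hη he hFac hSBU hQBI f i _ (MarklData.elementsη t ht) u).trans ?_
    exact (M.map_θ f ht hT i u.1).symm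

theorem toMarklData_toStrictOperad_map {S T : O} (ω : S ≅ T) :
    ((M.toStrictOperad hη he hFac hSBU hQBI).toMarklData e).map ω = M.map ω := by
  refine (MarklData.Elements.detects hη T).hom_ext ?_
  rintro _ ⟨z, rfl⟩
  refine (ExtUnitalOperad.map_toMarklData_map (M.toExtUnitalOperad hη he hFac hSBU hQBI)
    e ω z.1).trans ?_
  exact (M.elements_act_eq hη he hFac hSBU hQBI ω.hom z).trans
    (M.isExtUnital.map_map_val ω z).symm

theorem toMarklData_toStrictOperad_circ {T S : O} (f : T ⟶ S) (i : Fin (card S))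
    (hf : e.IsElementary f i) :
    ((M.toStrictOperad hη he hFac hSBU hQBI).toMarklData e).circ f i hf = M.circ f i hf := by
  refine ((MarklData.Elements.detects hη S).tens
    (MarklData.Elements.detects hη (fiber f i))).hom_ext ?_
  rintro _ ⟨_, ⟨z, rfl⟩, _, ⟨u, rfl⟩, rfl⟩
  exact (ExtUnitalOperad.map_toMarklData_circ (M.toExtUnitalOperad hη he hFac hSBU hQBI)
    f i hf z.1 u.1).trans (M.elements_circ_eq hη he hFac hSBU hQBI f i hf z u)

theorem toMarklData_toStrictOperad :
    (M.toStrictOperad hη he hFac hSBU hQBI).toMarklData e = M.toMarklData := by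
  have h1' : @((M.toStrictOperad hη he hFac hSBU hQBI).toMarklData e).map = @M.map :=
    funext fun _ => funext fun _ => funext fun ω =>
      M.toMarklData_toStrictOperad_map hη he hFac hSBU hQBI ω
  have h2' : @((M.toStrictOperad hη he hFac hSBU hQBI).toMarklData e).circ = @M.circ :=
    funext fun _ => funext fun _ => funext fun f => funext fun i => funext fun hf =>
      M.toMarklData_toStrictOperad_circ hη he hFac hSBU hQBI f i hf
  change MarklData.mk M.obj (@((M.toStrictOperad hη he hFac hSBU hQBI).toMarklData e).map)
    (@((M.toStrictOperad hη he hFac hSBU hQBI).toMarklData e).circ) M.η = _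
  rw [h1', h2']

end StrictMarkl

end MarklToStrictOperad

/-! ### The two constructions are mutually inverse -/

section Isomorphism

variable {O : Type u} [Category.{v} O] [OperadicCategory O] {e : Grading O}
  {V : Type u'} [Category.{v'} V] [MonoidalCategory V] [SymmetricCategory V]

open GenElem

theorem StrictOperad.ext {P Q : StrictOperad V e} (h₁ : P.obj = Q.obj) (h₂ : HEq P.unit Q.unit)
    (h₃ : HEq @P.γ @Q.γ) (h₄ : HEq P.η Q.η) : P = Q := by
  obtain ⟨⟨⟨_, _, _, _, _, _⟩, _, _, _⟩, _⟩ := P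
  obtain ⟨⟨⟨_, _, _, _, _, _⟩, _, _, _⟩, _⟩ := Q
  dsimp only at h₁ h₂ h₃ h₄
  cases h₁
  cases h₂
  cases h₃
  cases h₄
  rfl

theorem StrictMarkl.ext {M N : StrictMarkl V e} (h : M.toMarklData = N.toMarklData) : M = N := by
  cases M
  cases N
  dsimp only at h
  cases h
  rfl

variable (he : ∀ {S T : O} (f : S ⟶ T), IsIso f ↔ e.gradeHom f = 0)
  (hFac : Factorizable O) (hSBU : BlowUp O) (hQBI : QuasiBijectionsInvertible O)

/-- Families of morphisms that are compatible with the presheaf structures, the circle products and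
the extended units are compatible with the composition operations. -/
theorem MarklData.IsExtUnital.γ_comp {M : MarklData V e} (h : M.IsExtUnital)
    (hη : ∀ t ht, IsIso (M.η t ht)) (P : ExtUnitalOperad O V) (α : ∀ T, M.obj T ⟶ P.obj T)
    (hmap : ∀ {S T : O} (ω : S ≅ T), M.map ω ≫ α S = α T ≫ (P.toMarklData e).map ω)
    (hcirc : ∀ {T S : O} (φ : T ⟶ S) (i : Fin (card S)) (hφ : e.IsElementary φ i),
      M.circ φ i hφ ≫ α T = (α S ⊗ₘ α (fiber φ i)) ≫ (P.toMarklData e).circ φ i hφ)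
    (hα : ∀ t ht, M.η t ht ≫ α t = P.η t ht) {T S : O} (f : T ⟶ S) :
    M.γ hη he hFac hSBU hQBI f ≫ α T =
      (tensorList.map (fun i => α (fiber f i)) (List.finRange (card S)) ⊗ₘ α S) ≫ P.γ f := by
  have hu : ∀ {t : O} (x : M.Elements t) (ht : IsLocalTerminal t),
      GenElem.map (α t) x.1 = P.elements.η t ht := by
    intro t x ht
    rw [x.2 ht, ← GenElem.map_comp, hα]
    rfl
  -- Compatibility is needed only along isomorphisms and elementary morphisms; there it is `hmap`
  -- and `hcirc`, once `hα` has identified the entries at local terminal fibers with extended units.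
  have key : (h.elementsγ hη he hFac hSBU hQBI).CommutesAt P.elements.γ
      (fun T (x : M.Elements T) => GenElem.map (α T) x.1) f := by
    refine (h.isGenerated hη he hFac hSBU hQBI).commutesAt he hFac hSBU hQBI
      P.elements.assoc ?_ ?_ f
    · intro T S f _ x z
      rw [(h.isGenerated hη he hFac hSBU hQBI).iso f]
      refine (GenElem.map_comp _ _ _).symm.trans ?_
      refine (congrArg (fun g => GenElem.map g z.1) (hmap (asIso f))).trans ?_
      refine (GenElem.map_comp _ _ _).trans ?_
      refine (P.map_toMarklData_map e (asIso f) _).trans ?_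
      unfold SetOperad.act
      congr 1
      exact funext fun i => (hu (x i) _).symm
    · intro T S f i hf x z
      rw [(h.isGenerated hη he hFac hSBU hQBI).eval_elementary he f i hf]
      refine (GenElem.map_comp _ _ _).symm.trans ?_
      refine (congrArg (fun g => GenElem.map g (tens z.1 (x i).1)) (hcirc f i hf)).trans ?_
      refine (GenElem.map_comp _ _ _).trans ?_
      refine (congrArg (GenElem.map ((P.toMarklData e).circ f i hf))
        (map_tensorHom (α S) (α (fiber f i)) z.1 (x i).1)).trans ?_
      refine (P.map_toMarklData_circ f i hf _ _).trans ?_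
      unfold SetOperad.circ
      congr 1
      funext j
      by_cases hj : j = i
      · subst hj
        exact P.elements.insert_self _ _ _ _
      · exact (P.elements.insert_ne _ _ _ _ _ hj).trans (hu (x j) _).symm
  refine ((Detects.tuple (fun i => MarklData.Elements.detects hη (fiber f i))
    (List.nodup_finRange _)).tens (MarklData.Elements.detects hη S)).hom_ext ?_
  rintro _ ⟨_, ⟨x', hx, rfl⟩, _, ⟨z, rfl⟩, rfl⟩
  choose x hx using hx
  obtain rfl : (fun i => (x i).1) = x' := funext hx
  rw [GenElem.map_comp, GenElem.map_comp, map_tensorHom, map_tensorListMap]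
  exact key x z

namespace StrictMarkl

/-- The morphism of operads given by a morphism of `1`-connected Markl's operads. -/
noncomputable def Hom.toStrictOperad {M N : StrictMarkl V e} (hM : ∀ t ht, IsIso (M.η t ht))
    (hN : ∀ t ht, IsIso (N.η t ht)) (φ : M.Hom N) :
    (M.toStrictOperad hM he hFac hSBU hQBI).Hom (N.toStrictOperad hN he hFac hSBU hQBI) where
  app := φ.app
  app_γ f := M.isExtUnital.γ_comp he hFac hSBU hQBI hM
    (N.toExtUnitalOperad hN he hFac hSBU hQBI) φ.app
    (fun {_ T} ω => (φ.app_map ω).trans (congrArg (fun g => φ.app T ≫ g)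
      (N.toMarklData_toStrictOperad_map hN he hFac hSBU hQBI ω).symm))
    (fun {_ S} f i hf => (φ.app_circ f i hf).trans
      (congrArg (fun g => (φ.app S ⊗ₘ φ.app (fiber f i)) ≫ g)
        (N.toMarklData_toStrictOperad_circ hN he hFac hSBU hQBI f i hf).symm)) φ.app_η f
  app_η := φ.app_η

end StrictMarkl

/-- Identity maps respect the action, the circle products and the units, hence all compositions by
`γ_comp`. So the original and the reconstructed `γ` coincide. -/
theorem StrictOperad.toStrictOperad_toStrictMarkl (P : StrictOperad V e)
    (hη : ∀ t ht, IsIso (P.η t ht)) :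
    P.toStrictMarkl.toStrictOperad hη he hFac hSBU hQBI = P := by
  refine StrictOperad.ext rfl (heq_of_eq (funext P.η_chosen)) (heq_of_eq ?_) HEq.rfl
  funext T S f
  have h := P.toStrictMarkl.isExtUnital.γ_comp he hFac hSBU hQBI hη P.toExtUnitalOperad
    (fun T => 𝟙 (P.obj T)) (fun ω => (Category.comp_id _).trans (Category.id_comp _).symm)
    (fun {_ S} φ i hφ => ((Category.comp_id _).trans (Category.id_comp _).symm).trans
      (congrArg (fun g => g ≫ (P.toMarklData e).circ φ i hφ)
        (id_tensorHom_id (P.obj S) (P.obj (fiber φ i))).symm))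
    (fun t ht => Category.comp_id _) f
  have h' : (tensorList.map (fun i => 𝟙 (P.obj (fiber f i))) (List.finRange (card S)) ⊗ₘ
      𝟙 (P.obj S)) = 𝟙 (tensorFibers P.obj f ⊗ P.obj S) := by
    rw [tensorList.map_id, id_tensorHom_id]
  exact (Category.comp_id _).symm.trans (h.trans
    ((congrArg (fun g => g ≫ P.γ f) h').trans (Category.id_comp _)))

/-- The inverse of the functor from `1`-connected operads to `1`-connected Markl's operads. -/
noncomputable def StrictMarkl.operadFunctor : (StrictMarkl.oneConnected V e).FullSubcategory ⥤
    (StrictOperad.oneConnected V e).FullSubcategory where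
  obj M := ⟨M.obj.toStrictOperad M.property he hFac hSBU hQBI, M.property⟩
  map {M N} φ := ObjectProperty.homMk
    (StrictMarkl.Hom.toStrictOperad he hFac hSBU hQBI M.property N.property φ.hom)
  map_id _ := rfl
  map_comp _ _ := rfl

/-- Equality of functors compares morphisms up to `eqToHom` between equal operads; this reduces the
comparison to components. -/
theorem StrictOperad.conj_eqToHom_app {P P' Q Q' : (StrictOperad.oneConnected V e).FullSubcategory}
    (hP : P' = P) (hQ : Q = Q') (φ : P ⟶ Q) (T : O) :
    StrictOperad.Hom.app (eqToHom hP ≫ φ ≫ eqToHom hQ).hom T =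
      eqToHom (congrArg (fun P => P.obj.obj T) hP) ≫ StrictOperad.Hom.app φ.hom T ≫
        eqToHom (congrArg (fun P => P.obj.obj T) hQ) := by
  subst hP hQ
  rw [eqToHom_refl, eqToHom_refl, eqToHom_refl, eqToHom_refl, Category.id_comp, Category.comp_id,
    Category.id_comp, Category.comp_id]

theorem StrictMarkl.conj_eqToHom_app {P P' Q Q' : (StrictMarkl.oneConnected V e).FullSubcategory}
    (hP : P' = P) (hQ : Q = Q') (φ : P ⟶ Q) (T : O) :
    StrictMarkl.Hom.app (eqToHom hP ≫ φ ≫ eqToHom hQ).hom T =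
      eqToHom (congrArg (fun P => P.obj.obj T) hP) ≫ StrictMarkl.Hom.app φ.hom T ≫
        eqToHom (congrArg (fun P => P.obj.obj T) hQ) := by
  subst hP hQ
  rw [eqToHom_refl, eqToHom_refl, eqToHom_refl, eqToHom_refl, Category.id_comp, Category.comp_id,
    Category.id_comp, Category.comp_id]

end Isomorphism

theorem theorem6p2
    {O : Type u} [Category.{v} O] [OperadicCategory O]
    (V : Type u') [Category.{v'} V] [MonoidalCategory V] [SymmetricCategory V]
    (hCF : ConstantFree O) (hFac : Factorizable O) (hSBU : BlowUp O)
    (hQBI : QuasiBijectionsInvertible O) (hUFib : UniqueFiber O)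
    (e : Grading O)
    (he : ∀ {S T : O} (f : S ⟶ T), IsIso f ↔ e.gradeHom f = 0) :
    ∃ Φ : StrictOperad V e ⥤ StrictMarkl V e,
      (∀ P : StrictOperad V e,
        (Φ.obj P).toMarklData = P.toExtUnitalOperad.toMarklData e) ∧
      Φ ⋙ StrictMarkl.underlying = StrictOperad.underlying ∧
      ∃ h : ∀ P : (StrictOperad.oneConnected V e).FullSubcategory,
          StrictMarkl.oneConnected V e (Φ.obj P.obj),
        IsIsomorphismOfCategories
          ((StrictMarkl.oneConnected V e).lift ((StrictOperad.oneConnected V e).ι ⋙ Φ) h) := by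
  refine ⟨StrictOperad.marklFunctor V e, fun _ => rfl, rfl, fun P => P.property,
    StrictMarkl.operadFunctor he hFac hSBU hQBI, ?_, ?_⟩
  · refine CategoryTheory.Functor.ext (fun P => ObjectProperty.FullSubcategory.ext
      (P.obj.toStrictOperad_toStrictMarkl he hFac hSBU hQBI P.property)) fun P Q φ => ?_
    refine ObjectProperty.hom_ext _ (StrictOperad.Hom.ext (funext fun T => ?_))
    refine Eq.trans ?_ (StrictOperad.conj_eqToHom_app _ _ _ T).symm
    -- The round trip leaves the underlying objects unchanged by definition, so the componentwise
    -- `eqToHom` are identities.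
    exact ((Category.id_comp _).trans (Category.comp_id _)).symm
  · refine CategoryTheory.Functor.ext (fun M => ObjectProperty.FullSubcategory.ext (StrictMarkl.ext
      (M.obj.toMarklData_toStrictOperad M.property he hFac hSBU hQBI))) fun M N φ => ?_
    refine ObjectProperty.hom_ext _ (StrictMarkl.Hom.ext (funext fun T => ?_))
    refine Eq.trans ?_ (StrictMarkl.conj_eqToHom_app _ _ _ T).symm
    exact ((Category.id_comp _).trans (Category.comp_id _)).symm
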